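/- Write $x=(y,z)\in\mathbb{R}^3=\mathbb{R}^2_y\times\mathbb{R}_z$, $H_y=-\Delta_y+|y|^2$, and let $\Phi_0(y)=\frac{1}{\sqrt{\pi}}e^{-|y|^2/2}$ be the $L^2(\mathbb{R}^2)$-normalized Gaussian ground state of $H_y$. Let $\Sigma=\{u\in H^1(\mathbb{R}^3;\mathbb{C}): yu\in L^2(\mathbb{R}^3)\}$ with $$\|u\|_\Sigma^2=\int_{\mathbb{R}^3}|u|^2+|\nabla_x u|^2+|y|^2|u|^2\,dx,\qquad \|u\|_{\dot\Sigma_y}^2=\int_{\mathbb{R}^3}|\nabla_y u|^2+|y|^2|u|^2-2|u|^2\,dx .$$ Fix a mass $m>0$. For $\omega>0$ let $$E_\omega(u)=\tfrac{\omega}{2}\|u\|_{\dot\Sigma_y}^2+\tfrac12\|\partial_zu\|_{L^2}^2-\tfrac14\|u\|_{L^4}^4,\qquad \mathcal{J}_\omega(m)=\inf\{E_\omega(u):u\in\Sigma,\ \|u\|_{L^2}^2=m,\ \|u\|_{\dot\Sigma_y}^2\le\sqrt\omega\},$$ and let $$E_\infty(w)=\tfrac12\|\partial_zw\|_{L^2(\mathbb{R})}^2-\tfrac1{8\pi}\|w\|_{L^4(\mathbb{R})}^4,\qquad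 \mathcal{J}_\infty(m)=\inf\{E_\infty(w):w\in H^1(\mathbb{R};\mathbb{C}),\ \|w\|_{L^2}^2=m\}.$$ Let $Q_\infty$ be the positive, even minimizer of $\mathcal{J}_\infty(m)$ that is nonincreasing in $|z|$. Let $Q_\omega$ denote any minimizer of $\mathcal{J}_\omega(m)$ normalized so that $Q_\omega(x)=Q_\omega(|y|,|z|)\ge 0$ is nonincreasing in $|y|$ and in $|z|$. For a real function $u$ on $\mathbb{R}^3$ put $u_{\parallel}(z)=\int_{\mathbb{R}^2}u(y,z)\Phi_0(y)\,dy$ and $P_1u=u-u_\parallel(z)\Phi_0(y)$. **Theorem.** There are constants $\omega_0\ge1$ and $C>0$, depending only on $m$, such that for every $\omega\ge\omega_0$ and every such $Q_\omega$ the following hold. 1. $Q_\omega-Q_\infty(z)\Phi_0(y)\in\Sigma$ and $\|Q_\omega(x)-Q_\infty(z)\Phi_0(y)\|_\Sigma\le C\omega^{-1/2}$. 2. There are Lagrange multipliers $\mu_\omega,\mu_\infty\in\mathbb{R}$ for which, in the weak sense, $\omega(H_y-2)Q_\omega-\partial_z^2Q_\omega-Q_\omega^3=-\mu_\omega Q_\omega$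 and $-\partial_z^2Q_\infty-\frac1{2\pi}Q_\infty^3=-\mu_\infty Q_\infty$, and any such multipliers satisfy $|\mu_\omega-\mu_\infty|\le C\omega^{-1}$. 3. $P_1Q_\omega\in\Sigma$, with $\|P_1Q_\omega\|_{L^2}\le C\omega^{-1}$, $\|P_1Q_\omega\|_{\dot\Sigma_y}\le C\omega^{-1}$ and $\|\partial_zP_1Q_\omega\|_{L^2}\le C\omega^{-1/2}$. 4. $Q_{\omega,\parallel}-Q_\infty\in H^1(\mathbb{R})$ and $(Q_{\omega,\parallel}(z)-Q_\infty(z))\Phi_0(y)\in H^1(\mathbb{R}^3)$, with $\|Q_{\omega,\parallel}-Q_\infty\|_{H^1(\mathbb{R})}\le C\omega^{-1}$ and $\|(Q_{\omega,\parallel}(z)-Q_\infty(z))\Phi_0(y)\|_{H^1(\mathbb{R}^3)}\le C\omega^{-1}$. -/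

import Mathlib

open MeasureTheory

noncomputable section

namespace DimRed

/-! ### Weak derivatives and `H¹` -/

/-- Smooth compactly supported real test functions. -/
def IsTest {E : Type*} [NormedAddCommGroup E] [NormedSpace ℝ E] (φ : E → ℝ) : Prop :=
  ContDiff ℝ ((⊤ : ℕ∞) : WithTop ℕ∞) φ ∧ HasCompactSupport φ

/-- `g` is a weak derivative of `u` in the direction `v`. -/
def HasWeakDeriv {E : Type*} [NormedAddCommGroup E] [NormedSpace ℝ E] [MeasureSpace E]
    {𝕜 : Type*} [RCLike 𝕜] (u : E → 𝕜) (v : E) (g : E → 𝕜) : Prop :=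
  LocallyIntegrable u volume ∧ LocallyIntegrable g volume ∧
    ∀ φ : E → ℝ, IsTest φ →
      ∫ x, (fderiv ℝ φ x v) • u x = - ∫ x, φ x • g x

open Classical in
/-- The weak derivative of `u` in the direction `v` (unique almost everywhere when it exists);
the value `0` is used when there is none. -/
def weakDeriv {E : Type*} [NormedAddCommGroup E] [NormedSpace ℝ E] [MeasureSpace E]
    {𝕜 : Type*} [RCLike 𝕜] (v : E) (u : E → 𝕜) : E → 𝕜 :=
  if h : ∃ g : E → 𝕜, HasWeakDeriv u v g then h.choose else 0

/-- `u ∈ H¹(E)`: `u` and all its weak directional derivatives are in `L²`. -/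
def MemH1 {E : Type*} [NormedAddCommGroup E] [NormedSpace ℝ E] [MeasureSpace E]
    {𝕜 : Type*} [RCLike 𝕜] (u : E → 𝕜) : Prop :=
  MemLp u 2 volume ∧ ∀ v : E, ∃ g : E → 𝕜, HasWeakDeriv u v g ∧ MemLp g 2 volume

/-- The squared `L²` norm (the mass `M(u)`). -/
def mass {E : Type*} [MeasureSpace E] {𝕜 : Type*} [RCLike 𝕜] (u : E → 𝕜) : ℝ :=
  ∫ x, ‖u x‖ ^ 2

/-- The `L²` norm. -/
def l2Norm {E : Type*} [MeasureSpace E] {𝕜 : Type*} [RCLike 𝕜] (u : E → 𝕜) : ℝ :=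
  Real.sqrt (mass u)

/-! ### The three-dimensional problem -/

/-- `ℝ²` with the variable `y`. -/
abbrev Y : Type := EuclideanSpace ℝ (Fin 2)

/-- `ℝ³ = ℝ²_y × ℝ_z`, with the product Lebesgue measure. -/
abbrev X : Type := Y × ℝ

/-- The unit coordinate directions in `y`. -/
def eY (i : Fin 2) : X := (EuclideanSpace.single i 1, 0)

/-- The unit coordinate direction in `z`. -/
def eZ : X := (0, 1)

/-- The weighted energy space `Σ = {u ∈ H¹(ℝ³) : y u ∈ L²(ℝ³)}`. -/
def MemSigma {𝕜 : Type*} [RCLike 𝕜] (u : X → 𝕜) : Prop :=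
  MemH1 u ∧ MemLp (fun x : X => ‖x.1‖ * ‖u x‖) 2 volume

/-- `|∇_y u|²` at `x`. -/
def gradYSq {𝕜 : Type*} [RCLike 𝕜] (u : X → 𝕜) (x : X) : ℝ :=
  ∑ i : Fin 2, ‖weakDeriv (eY i) u x‖ ^ 2

/-- The norm of `H¹(ℝ³)`. -/
def h1NormX {𝕜 : Type*} [RCLike 𝕜] (u : X → 𝕜) : ℝ :=
  Real.sqrt (∫ x : X, (‖u x‖ ^ 2 + (gradYSq u x + ‖weakDeriv eZ u x‖ ^ 2)))

/-- The norm of `Σ`. -/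
def sigmaNorm {𝕜 : Type*} [RCLike 𝕜] (u : X → 𝕜) : ℝ :=
  Real.sqrt (∫ x : X, (‖u x‖ ^ 2 + (gradYSq u x + ‖weakDeriv eZ u x‖ ^ 2)
    + ‖x.1‖ ^ 2 * ‖u x‖ ^ 2))

/-- The square of the seminorm `‖√(H_y - 2) u‖_{L²}`. -/
def sigmaYSq {𝕜 : Type*} [RCLike 𝕜] (u : X → 𝕜) : ℝ :=
  ∫ x : X, (gradYSq u x + ‖x.1‖ ^ 2 * ‖u x‖ ^ 2 - 2 * ‖u x‖ ^ 2)

/-- The seminorm `‖√(H_y - 2) u‖_{L²}`. -/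
def sigmaYNorm {𝕜 : Type*} [RCLike 𝕜] (u : X → 𝕜) : ℝ := Real.sqrt (sigmaYSq u)

/-- The energy `E_ω` on `Σ`. -/
def energy3 {𝕜 : Type*} [RCLike 𝕜] (ω : ℝ) (u : X → 𝕜) : ℝ :=
  ω / 2 * sigmaYSq u + 1 / 2 * mass (weakDeriv eZ u) - 1 / 4 * ∫ x, ‖u x‖ ^ 4

/-- The admissible class of the minimization problem `𝒥_ω(m)`. -/
def admissible3 (ω m : ℝ) : Set (X → ℂ) :=
  {u | MemSigma u ∧ mass u = m ∧ sigmaYSq u ≤ Real.sqrt ω}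

/-- `Q` is a minimizer of `𝒥_ω(m)` among complex-valued functions, in the normal form
`Q(y,z) = Q(|y|,|z|) ≥ 0`, nonincreasing in `|y|` and in `|z|` (the case of equal
absolute values in the last clause gives the symmetry). -/
structure IsMinimizer3 (ω m : ℝ) (Q : X → ℝ) : Prop where
  mem : (fun x => (Q x : ℂ)) ∈ admissible3 ω m
  isMinOn : IsMinOn (energy3 ω) (admissible3 ω m) (fun x => (Q x : ℂ))
  nonneg : ∀ x, 0 ≤ Q x
  symm_decreasing : ∀ x x' : X, ‖x.1‖ ≤ ‖x'.1‖ → |x.2| ≤ |x'.2| → Q x' ≤ Q x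

/-- `Q ∈ Σ` is a weak solution of `ω (H_y - 2) Q - ∂_z² Q - Q³ = - μ Q`,
where `H_y = - Δ_y + |y|²`. -/
def EulerLagrange3 (ω μ : ℝ) (Q : X → ℝ) : Prop :=
  MemSigma Q ∧ ∀ φ : X → ℝ, IsTest φ →
    ω * (∫ x : X, ((∑ i : Fin 2, weakDeriv (eY i) Q x * fderiv ℝ φ x (eY i))
        + ‖x.1‖ ^ 2 * Q x * φ x - 2 * Q x * φ x))
      + (∫ x : X, weakDeriv eZ Q x * fderiv ℝ φ x eZ)
      - (∫ x : X, Q x ^ 3 * φ x)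
      = - μ * ∫ x : X, Q x * φ x

/-! ### The one-dimensional problem -/

/-- The norm of `H¹(ℝ)`. -/
def h1NormZ {𝕜 : Type*} [RCLike 𝕜] (w : ℝ → 𝕜) : ℝ :=
  Real.sqrt (mass w + mass (weakDeriv 1 w))

/-- The energy `E_∞` on `H¹(ℝ)`. -/
def energy1 {𝕜 : Type*} [RCLike 𝕜] (w : ℝ → 𝕜) : ℝ :=
  1 / 2 * mass (weakDeriv 1 w) - 1 / (8 * Real.pi) * ∫ z, ‖w z‖ ^ 4

/-- The admissible class of the minimization problem `𝒥_∞(m)`. -/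
def admissible1 (m : ℝ) : Set (ℝ → ℂ) := {w | MemH1 w ∧ mass w = m}

/-- `Q` is a positive, even, decreasing minimizer of `𝒥_∞(m)`: the 1d ground state. -/
structure IsGroundState1 (m : ℝ) (Q : ℝ → ℝ) : Prop where
  mem : (fun z => (Q z : ℂ)) ∈ admissible1 m
  isMinOn : IsMinOn energy1 (admissible1 m) (fun z => (Q z : ℂ))
  pos : ∀ z, 0 < Q z
  symm_decreasing : ∀ z z' : ℝ, |z| ≤ |z'| → Q z' ≤ Q z

/-- `Q ∈ H¹(ℝ)` is a weak solution of `- Q'' - (1 / 2π) Q³ = - μ Q`. -/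
def EulerLagrange1 (μ : ℝ) (Q : ℝ → ℝ) : Prop :=
  MemH1 Q ∧ ∀ φ : ℝ → ℝ, IsTest φ →
    (∫ z, weakDeriv 1 Q z * deriv φ z) - 1 / (2 * Real.pi) * (∫ z, Q z ^ 3 * φ z)
      = - μ * ∫ z, Q z * φ z

/-! ### The projection onto the lowest Hermite state -/

/-- `Φ₀(y) = π^{-1/2} e^{-|y|²/2}`. -/
def Phi0 (y : Y) : ℝ := 1 / Real.sqrt Real.pi * Real.exp (-‖y‖ ^ 2 / 2)

/-- The function `w(z) Φ₀(y)`. -/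
def tensorPhi0 (w : ℝ → ℝ) (x : X) : ℝ := w x.2 * Phi0 x.1

/-- The `Φ₀`-component `u_∥(z) = ⟨u(·,z), Φ₀⟩_{L²(ℝ²)}`. -/
def par (u : X → ℝ) (z : ℝ) : ℝ := ∫ y : Y, u (y, z) * Phi0 y

/-- `P₁ u = u - u_∥(z) Φ₀(y)`. -/
def P1 (u : X → ℝ) (x : X) : ℝ := u x - tensorPhi0 (par u) x

end DimRed

end

open MeasureTheory Filter Topology ENNReal

noncomputable section

set_option linter.unusedSectionVars false

namespace DimRed

/-! ### Test functions, weak derivatives and H¹ -/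

section WeakCalculus

variable {E : Type*} [NormedAddCommGroup E] [NormedSpace ℝ E]

/-! Strong confinement pushes a minimizer onto the lowest transverse state Φ₀; what is left is a
one-dimensional cubic problem whose ground state is an explicit sech profile. Write Q = w(z)Φ₀(y) +
f with w = `par Q` and f = `P1 Q`, and put σ = `sigmaYSq Q`, Z = ‖∂_z Q‖².

Transverse part. In weak form H_y - 2 = Σ aᵢ*aᵢ with aᵢ = ∂_{yᵢ} + yᵢ, and aᵢΦ₀ = 0. Hence σ only
sees f, and a spectral gap gives ‖f‖² ≤ 8σ (`MemSigma.gap`). An anisotropic Gagliardo–Nirenberg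
inequality bounds ∫f⁴ by a constant times √m σ √Z; being linear in σ, this bound can be absorbed by
ωσ. Comparison with a soliton times Φ₀ shows that the minimal energy is negative, and with the
constraint σ ≤ √ω this yields σ = O(1/ω) and Z = O(1) (`exists_apriori`). The constraint is
therefore inactive and the Euler–Lagrange equation holds. Testing it with f gives ωσ + ‖∂_z f‖² ≤
A√σ + Bσ, so √σ and ‖f‖ are O(1/ω) and ‖∂_z f‖² is O(1/ω) (`exists_P1_bounds`).

Longitudinal part. Testing the equation with ψ(z)Φ₀(y) removes ω and leaves w'' = μw - w³/2π + R,
where R is the Φ₀-component of (wΦ₀)³ - Q³ and so is O(1/ω) in L¹. Moreover w is nonnegative, even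
and nonincreasing in |z|. Closeness to a soliton then follows from an ODE argument
(`IsApproxSoliton.exists_stability`): the almost conserved energy fixes w(0) up to O(ε), w'(0) = 0
by symmetry, Gronwall controls a bounded interval, and beyond it the equation for the difference of
two solutions has a potential bounded below by a positive constant, so an energy estimate controls
the tail.

Frequency. Comparing w with the soliton of the same frequency μ, and then comparing masses, gives √μ
- m/8π = O(1/ω). The soliton of mass m is then an approximate solution at frequency μ, and a second
use of stability compares it with w (`exists_soliton_close`). With zero error the same stability
theorem identifies the one-dimensional ground state with that soliton
(`IsGroundState1.ae_eq_soliton`). Of all the pieces only ∂_z f is bounded merely by ω^{-1/2}, which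
is what limits the rate obtained in Σ. -/

theorem IsTest.continuous {φ : E → ℝ} (h : IsTest φ) : Continuous φ := h.1.continuous

theorem IsTest.differentiable {φ : E → ℝ} (h : IsTest φ) : Differentiable ℝ φ :=
  h.1.differentiable (by simp)

theorem IsTest.fderiv_apply {φ : E → ℝ} (h : IsTest φ) (v : E) : IsTest (fun x => fderiv ℝ φ x v) := by
  refine ⟨?_, h.2.fderiv_apply (𝕜 := ℝ) v⟩
  have := h.1.fderiv_right (m := ((⊤ : ℕ∞) : WithTop ℕ∞)) (by simp)
  exact this.clm_apply contDiff_const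

theorem IsTest.mul_smooth {φ χ : E → ℝ} (h : IsTest φ)
    (hχ : ContDiff ℝ ((⊤ : ℕ∞) : WithTop ℕ∞) χ) : IsTest (fun x => χ x * φ x) :=
  ⟨hχ.mul h.1, h.2.mul_left⟩

theorem IsTest.add {φ χ : E → ℝ} (h : IsTest φ) (hχ : IsTest χ) : IsTest (fun x => φ x + χ x) :=
  ⟨h.1.add hχ.1, h.2.add hχ.2⟩

theorem IsTest.sub {φ χ : E → ℝ} (h : IsTest φ) (hχ : IsTest χ) : IsTest (fun x => φ x - χ x) :=
  ⟨h.1.sub hχ.1, h.2.sub hχ.2⟩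

theorem IsTest.const_mul {φ : E → ℝ} (h : IsTest φ) (c : ℝ) : IsTest (fun x => c * φ x) :=
  h.mul_smooth contDiff_const

variable [MeasureSpace E] [BorelSpace E]

theorem IsTest.memLp {φ : E → ℝ} (h : IsTest φ) [FiniteDimensional ℝ E]
    [IsFiniteMeasureOnCompacts (volume : Measure E)] (p : ENNReal) : MemLp φ p volume :=
  h.continuous.memLp_of_hasCompactSupport h.2

theorem IsTest.integrable_smul {F : Type*} [NormedAddCommGroup F] [NormedSpace ℝ F]
    {φ : E → ℝ} (h : IsTest φ) {u : E → F} (hu : LocallyIntegrable u volume) :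
    Integrable (fun x => φ x • u x) volume :=
  hu.integrable_smul_left_of_hasCompactSupport h.continuous h.2

variable [FiniteDimensional ℝ E] {𝕜 : Type*} [RCLike 𝕜]

theorem HasWeakDeriv.ae_unique {u g g' : E → 𝕜} {v : E} (h : HasWeakDeriv u v g)
    (h' : HasWeakDeriv u v g') : g =ᵐ[volume] g' := by
  refine ae_eq_of_integral_contDiff_smul_eq h.2.1 h'.2.1 fun φ hφ hc => ?_
  have h1 := h.2.2 φ ⟨hφ, hc⟩
  have h2 := h'.2.2 φ ⟨hφ, hc⟩
  exact neg_injective (h1.symm.trans h2)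

theorem HasWeakDeriv.weakDeriv {u g : E → 𝕜} {v : E} (h : HasWeakDeriv u v g) :
    HasWeakDeriv u v (weakDeriv v u) := by
  have h' : ∃ g : E → 𝕜, HasWeakDeriv u v g := ⟨g, h⟩
  rw [DimRed.weakDeriv, dif_pos h']
  exact h'.choose_spec

theorem HasWeakDeriv.weakDeriv_ae {u g : E → 𝕜} {v : E} (h : HasWeakDeriv u v g) :
    DimRed.weakDeriv v u =ᵐ[volume] g := h.weakDeriv.ae_unique h

/-- Membership in H¹ excludes the default value 0 of `weakDeriv`. -/
theorem MemH1.hasWeakDeriv {u : E → 𝕜} (h : MemH1 u) (v : E) :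
    HasWeakDeriv u v (weakDeriv v u) := by
  obtain ⟨g, hg, -⟩ := h.2 v
  exact hg.weakDeriv

theorem MemH1.memLp_weakDeriv {u : E → 𝕜} (h : MemH1 u) (v : E) :
    MemLp (weakDeriv v u) 2 volume := by
  obtain ⟨g, hg, hg2⟩ := h.2 v
  exact hg2.ae_eq hg.weakDeriv_ae.symm

theorem HasWeakDeriv.congr_ae {u u' g g' : E → 𝕜} {v : E} (h : HasWeakDeriv u v g)
    (hu : u =ᵐ[volume] u') (hg : g =ᵐ[volume] g') : HasWeakDeriv u' v g' := by
  refine ⟨h.1.congr hu, h.2.1.congr hg, fun φ hφ => ?_⟩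
  have e1 : ∫ x, (fderiv ℝ φ x v) • u x = ∫ x, (fderiv ℝ φ x v) • u' x :=
    integral_congr_ae (by filter_upwards [hu] with x hx using by rw [hx])
  have e2 : ∫ x, φ x • g x = ∫ x, φ x • g' x :=
    integral_congr_ae (by filter_upwards [hg] with x hx using by rw [hx])
  rw [← e1, ← e2]
  exact h.2.2 φ hφ

theorem HasWeakDeriv.add {u u' g g' : E → 𝕜} {v : E} (h : HasWeakDeriv u v g)
    (h' : HasWeakDeriv u' v g') : HasWeakDeriv (fun x => u x + u' x) v (fun x => g x + g' x) := by
  refine ⟨h.1.add h'.1, h.2.1.add h'.2.1, fun φ hφ => ?_⟩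
  simp only [smul_add]
  rw [integral_add ((hφ.fderiv_apply v).integrable_smul h.1) ((hφ.fderiv_apply v).integrable_smul h'.1),
    integral_add (hφ.integrable_smul h.2.1) (hφ.integrable_smul h'.2.1), h.2.2 φ hφ, h'.2.2 φ hφ]
  abel

theorem HasWeakDeriv.const_mul {u g : E → 𝕜} {v : E} (h : HasWeakDeriv u v g) (c : 𝕜) :
    HasWeakDeriv (fun x => c * u x) v (fun x => c * g x) := by
  refine ⟨h.1.smul c, h.2.1.smul c, fun φ hφ => ?_⟩
  simp only [← mul_smul_comm]
  rw [integral_const_mul, integral_const_mul, h.2.2 φ hφ, mul_neg]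

theorem HasWeakDeriv.sub {u u' g g' : E → 𝕜} {v : E} (h : HasWeakDeriv u v g)
    (h' : HasWeakDeriv u' v g') : HasWeakDeriv (fun x => u x - u' x) v (fun x => g x - g' x) := by
  have := h.add (h'.const_mul (-1))
  simpa [sub_eq_add_neg] using this

theorem HasWeakDeriv.add_dir {u g g' : E → 𝕜} {v v' : E} (h : HasWeakDeriv u v g)
    (h' : HasWeakDeriv u v' g') : HasWeakDeriv u (v + v') (fun x => g x + g' x) := by
  refine ⟨h.1, h.2.1.add h'.2.1, fun φ hφ => ?_⟩
  simp only [smul_add, map_add, add_smul]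
  rw [integral_add ((hφ.fderiv_apply v).integrable_smul h.1) ((hφ.fderiv_apply v').integrable_smul h.1),
    integral_add (hφ.integrable_smul h.2.1) (hφ.integrable_smul h'.2.1), h.2.2 φ hφ, h'.2.2 φ hφ]
  abel

theorem HasWeakDeriv.smul_dir {u g : E → 𝕜} {v : E} (h : HasWeakDeriv u v g) (c : ℝ) :
    HasWeakDeriv u (c • v) (fun x => c • g x) := by
  refine ⟨h.1, h.2.1.smul c, fun φ hφ => ?_⟩
  simp only [map_smul, smul_assoc, smul_comm _ c, integral_smul]
  rw [h.2.2 φ hφ, smul_neg]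

theorem MemH1.add {u u' : E → 𝕜} (h : MemH1 u) (h' : MemH1 u') : MemH1 (fun x => u x + u' x) :=
  ⟨h.1.add h'.1, fun v => ⟨_, (h.hasWeakDeriv v).add (h'.hasWeakDeriv v),
    (h.memLp_weakDeriv v).add (h'.memLp_weakDeriv v)⟩⟩

theorem MemH1.sub {u u' : E → 𝕜} (h : MemH1 u) (h' : MemH1 u') : MemH1 (fun x => u x - u' x) :=
  ⟨h.1.sub h'.1, fun v => ⟨_, (h.hasWeakDeriv v).sub (h'.hasWeakDeriv v),
    (h.memLp_weakDeriv v).sub (h'.memLp_weakDeriv v)⟩⟩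

theorem MemH1.const_mul {u : E → 𝕜} (h : MemH1 u) (c : 𝕜) : MemH1 (fun x => c * u x) :=
  ⟨h.1.const_mul c, fun v => ⟨_, (h.hasWeakDeriv v).const_mul c,
    (h.memLp_weakDeriv v).const_mul c⟩⟩

theorem MemH1.weakDeriv_add {u u' : E → 𝕜} (h : MemH1 u) (h' : MemH1 u') (v : E) :
    weakDeriv v (fun x => u x + u' x) =ᵐ[volume] fun x => weakDeriv v u x + weakDeriv v u' x :=
  ((h.hasWeakDeriv v).add (h'.hasWeakDeriv v)).weakDeriv_ae

theorem MemH1.weakDeriv_sub {u u' : E → 𝕜} (h : MemH1 u) (h' : MemH1 u') (v : E) :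
    weakDeriv v (fun x => u x - u' x) =ᵐ[volume] fun x => weakDeriv v u x - weakDeriv v u' x :=
  ((h.hasWeakDeriv v).sub (h'.hasWeakDeriv v)).weakDeriv_ae

theorem MemH1.weakDeriv_const_mul {u : E → 𝕜} (h : MemH1 u) (c : 𝕜) (v : E) :
    weakDeriv v (fun x => c * u x) =ᵐ[volume] fun x => c * weakDeriv v u x :=
  ((h.hasWeakDeriv v).const_mul c).weakDeriv_ae

/-- The variational problems range over complex functions, while the whole analysis is done on real
ones; this and the next lemmas pass between the two. -/
theorem HasWeakDeriv.ofReal {u g : E → ℝ} {v : E} (h : HasWeakDeriv u v g) :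
    HasWeakDeriv (fun x => (u x : 𝕜)) v (fun x => (g x : 𝕜)) := by
  have key : ∀ w : E → ℝ, LocallyIntegrable w volume →
      LocallyIntegrable (fun x => (w x : 𝕜)) volume := fun w hw x => by
    obtain ⟨s, hs, hi⟩ := hw x
    exact ⟨s, hs, hi.ofReal⟩
  refine ⟨key u h.1, key g h.2.1, fun φ hφ => ?_⟩
  have h1 := h.2.2 φ hφ
  simp only [smul_eq_mul] at h1
  simp only [RCLike.real_smul_eq_coe_mul, ← RCLike.ofReal_mul]
  rw [integral_ofReal, integral_ofReal, h1, RCLike.ofReal_neg]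

theorem HasWeakDeriv.re {u g : E → 𝕜} {v : E} (h : HasWeakDeriv u v g) :
    HasWeakDeriv (fun x => RCLike.re (u x)) v (fun x => RCLike.re (g x)) := by
  have key : ∀ w : E → 𝕜, LocallyIntegrable w volume →
      LocallyIntegrable (fun x => RCLike.re (w x)) volume := fun w hw x => by
    obtain ⟨s, hs, hi⟩ := hw x
    exact ⟨s, hs, hi.re⟩
  refine ⟨key u h.1, key g h.2.1, fun φ hφ => ?_⟩
  have h1 := congrArg RCLike.re (h.2.2 φ hφ)
  rw [map_neg, ← integral_re ((hφ.fderiv_apply v).integrable_smul h.1),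
    ← integral_re (hφ.integrable_smul h.2.1)] at h1
  simpa [RCLike.smul_re] using h1

theorem MemH1.ofReal {u : E → ℝ} (h : MemH1 u) : MemH1 (fun x => (u x : 𝕜)) :=
  ⟨h.1.ofReal, fun v => by
    obtain ⟨g, hg, hg2⟩ := h.2 v
    exact ⟨_, hg.ofReal, hg2.ofReal⟩⟩

theorem MemH1.of_ofReal {u : E → ℝ} (h : MemH1 (fun x => (u x : 𝕜))) : MemH1 u :=
  ⟨by simpa using h.1.re, fun v => by
    obtain ⟨g, hg, hg2⟩ := h.2 v
    exact ⟨_, by simpa using hg.re, hg2.re⟩⟩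

theorem MemH1.weakDeriv_ofReal {u : E → ℝ} (h : MemH1 u) (v : E) :
    weakDeriv v (fun x => (u x : 𝕜)) =ᵐ[volume] fun x => ((weakDeriv v u x : ℝ) : 𝕜) :=
  (h.hasWeakDeriv v).ofReal.weakDeriv_ae

/-- Leibniz rule, obtained by inserting χφ as test function. -/
theorem HasWeakDeriv.mul_smooth {u g χ : E → ℝ} {v : E} (h : HasWeakDeriv u v g)
    (hχ : ContDiff ℝ ((⊤ : ℕ∞) : WithTop ℕ∞) χ) :
    HasWeakDeriv (fun x => χ x * u x) v (fun x => χ x * g x + fderiv ℝ χ x v * u x) := by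
  have hd : Continuous (fun x => fderiv ℝ χ x v) :=
    ((hχ.fderiv_right (m := ((⊤ : ℕ∞) : WithTop ℕ∞)) (by simp)).clm_apply contDiff_const).continuous
  have l1 : LocallyIntegrable (fun x => χ x * u x) volume := h.1.continuous_mul hχ.continuous
  have l2 : LocallyIntegrable (fun x => χ x * g x) volume := h.2.1.continuous_mul hχ.continuous
  have l3 : LocallyIntegrable (fun x => fderiv ℝ χ x v * u x) volume := h.1.continuous_mul hd
  refine ⟨l1, l2.add l3, fun φ hφ => ?_⟩
  have h1 := h.2.2 _ (hφ.mul_smooth hχ)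
  simp only [smul_eq_mul, mul_add] at h1 ⊢
  have e : ∀ x, fderiv ℝ (fun x => χ x * φ x) x v * u x
      = fderiv ℝ φ x v * (χ x * u x) + φ x * (fderiv ℝ χ x v * u x) := fun x => by
    rw [fderiv_fun_mul (hχ.differentiable (by simp) x) (hφ.differentiable x)]
    simp; ring
  have i1 : Integrable (fun x => fderiv ℝ φ x v * (χ x * u x)) volume := (hφ.fderiv_apply v).integrable_smul l1
  have i2 : Integrable (fun x => φ x * (fderiv ℝ χ x v * u x)) volume := hφ.integrable_smul l3
  have i3 : Integrable (fun x => φ x * (χ x * g x)) volume := hφ.integrable_smul l2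
  simp only [e] at h1
  rw [integral_add i1 i2] at h1
  rw [integral_add i3 i2]
  have e2 : ∫ x, χ x * φ x * g x = ∫ x, φ x * (χ x * g x) := by congr 1; ext x; ring
  rw [e2] at h1
  linarith

theorem IsTest.hasWeakDeriv {φ : E → ℝ} (h : IsTest φ) [(volume : Measure E).IsAddHaarMeasure] (v : E) :
    HasWeakDeriv φ v (fun x => fderiv ℝ φ x v) := by
  refine ⟨h.continuous.locallyIntegrable, (h.fderiv_apply v).continuous.locallyIntegrable, fun ψ hψ => ?_⟩
  have i : ∀ a b : E → ℝ, IsTest a → IsTest b → Integrable (fun x => a x * b x) volume :=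
    fun a b ha hb => ((ha.continuous.mul hb.continuous).integrable_of_hasCompactSupport ha.2.mul_right)
  have := integral_mul_fderiv_eq_neg_fderiv_mul_of_integrable (μ := volume) (f := φ) (g := ψ) (v := v)
    (i _ _ (h.fderiv_apply v) hψ) (i _ _ h (hψ.fderiv_apply v)) (i _ _ h hψ)
    (fun x _ => h.differentiable x) (fun x _ => hψ.differentiable x)
  simp only [smul_eq_mul]
  simp only [mul_comm (fderiv ℝ ψ _ v), mul_comm (ψ _)]
  exact this

theorem IsTest.memH1 {φ : E → ℝ} (h : IsTest φ) [(volume : Measure E).IsAddHaarMeasure] : MemH1 φ :=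
  ⟨h.memLp 2, fun v => ⟨_, h.hasWeakDeriv v, (h.fderiv_apply v).memLp 2⟩⟩

end WeakCalculus

/-! ### L² norms and Cauchy–Schwarz -/

section L2

variable {E : Type*} [MeasureSpace E]

theorem mass_nonneg (u : E → ℝ) : 0 ≤ mass u := integral_nonneg fun _ => by positivity

theorem l2Norm_nonneg (u : E → ℝ) : 0 ≤ l2Norm u := Real.sqrt_nonneg _

theorem l2Norm_sq (u : E → ℝ) : l2Norm u ^ 2 = mass u := Real.sq_sqrt (mass_nonneg u)

theorem mass_eq_integral_sq (u : E → ℝ) : mass u = ∫ x, u x ^ 2 := by simp [mass]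

theorem mass_congr_ae {𝕜 : Type*} [RCLike 𝕜] {u v : E → 𝕜} (h : u =ᵐ[volume] v) :
    mass u = mass v :=
  integral_congr_ae (by filter_upwards [h] with x hx using by rw [hx])

theorem l2Norm_congr_ae {𝕜 : Type*} [RCLike 𝕜] {u v : E → 𝕜} (h : u =ᵐ[volume] v) :
    l2Norm u = l2Norm v := by rw [l2Norm, l2Norm, mass_congr_ae h]

theorem eLpNorm_two_eq {u : E → ℝ} (h : MemLp u 2 volume) :
    eLpNorm u 2 volume = ENNReal.ofReal (l2Norm u) := by
  rw [h.eLpNorm_eq_integral_rpow_norm (by norm_num) (by norm_num), l2Norm, mass]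
  congr 1
  rw [Real.sqrt_eq_rpow]
  norm_num

theorem l2Norm_eq_toReal {u : E → ℝ} (h : MemLp u 2 volume) :
    l2Norm u = (eLpNorm u 2 volume).toReal := by
  rw [eLpNorm_two_eq h, ENNReal.toReal_ofReal (l2Norm_nonneg u)]

theorem l2Norm_add_le {u v : E → ℝ} (hu : MemLp u 2 volume) (hv : MemLp v 2 volume) :
    l2Norm (fun x => u x + v x) ≤ l2Norm u + l2Norm v := by
  have h := eLpNorm_add_le hu.1 hv.1 (p := 2) (by norm_num)
  rw [l2Norm_eq_toReal hu, l2Norm_eq_toReal hv,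
    l2Norm_eq_toReal (u := fun x => u x + v x) (hu.add hv),
    ← ENNReal.toReal_add hu.2.ne hv.2.ne]
  exact ENNReal.toReal_mono (ENNReal.add_ne_top.2 ⟨hu.2.ne, hv.2.ne⟩) h

theorem l2Norm_const_mul (c : ℝ) (u : E → ℝ) : l2Norm (fun x => c * u x) = |c| * l2Norm u := by
  have : mass (fun x => c * u x) = c ^ 2 * mass u := by
    simp only [mass, norm_mul, mul_pow, integral_const_mul, Real.norm_eq_abs, sq_abs]
  rw [l2Norm, this, Real.sqrt_mul (sq_nonneg c), Real.sqrt_sq_eq_abs, l2Norm]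

theorem l2Norm_sub_le {u v : E → ℝ} (hu : MemLp u 2 volume) (hv : MemLp v 2 volume) :
    l2Norm (fun x => u x - v x) ≤ l2Norm u + l2Norm v := by
  have := l2Norm_add_le hu (hv.const_mul (-1))
  rw [l2Norm_const_mul] at this
  simpa [sub_eq_add_neg] using this

theorem abs_l2Norm_sub_le {u v : E → ℝ} (hu : MemLp u 2 volume) (hv : MemLp v 2 volume) :
    |l2Norm u - l2Norm v| ≤ l2Norm (fun x => u x - v x) := by
  have h1 := l2Norm_add_le (hu.sub hv) hv
  have h2 := l2Norm_sub_le hu (hu.sub hv)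
  have e1 : (fun x => (u - v) x + v x) = u := by ext x; simp
  have e2 : (fun x => u x - (u - v) x) = v := by ext x; simp
  rw [e1] at h1
  rw [e2] at h2
  rw [abs_le]
  constructor
  · have : l2Norm v ≤ l2Norm u + l2Norm (fun x => u x - v x) := h2
    linarith
  · have : l2Norm u ≤ l2Norm (fun x => u x - v x) + l2Norm v := h1
    linarith

theorem integrable_mul_of_memLp {u v : E → ℝ} (hu : MemLp u 2 volume) (hv : MemLp v 2 volume) :
    Integrable (fun x => u x * v x) volume := hu.integrable_mul hv

theorem integrable_sq_of_memLp {u : E → ℝ} (hu : MemLp u 2 volume) :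
    Integrable (fun x => u x ^ 2) volume := hu.integrable_sq

theorem integral_abs_mul_le {u v : E → ℝ} (hu : MemLp u 2 volume) (hv : MemLp v 2 volume) :
    ∫ x, |u x * v x| ≤ l2Norm u * l2Norm v := by
  have := integral_mul_norm_le_Lp_mul_Lq (μ := volume) (f := u) (g := v) (p := 2) (q := 2)
    (by constructor <;> norm_num) (by simpa using hu) (by simpa using hv)
  simp only [Real.norm_eq_abs, ← abs_mul] at this
  rw [l2Norm, l2Norm, Real.sqrt_eq_rpow, Real.sqrt_eq_rpow, mass, mass]
  simpa using this

theorem abs_integral_mul_le {u v : E → ℝ} (hu : MemLp u 2 volume) (hv : MemLp v 2 volume) :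
    |∫ x, u x * v x| ≤ l2Norm u * l2Norm v :=
  (abs_integral_le_integral_abs).trans (integral_abs_mul_le hu hv)

theorem tendsto_integral_mul_of_tendsto_l2 {u v : E → ℝ} {φ : ℕ → E → ℝ}
    (hu : MemLp u 2 volume) (hv : MemLp v 2 volume) (hφ : ∀ n, MemLp (φ n) 2 volume)
    (h : Tendsto (fun n => l2Norm (fun x => φ n x - v x)) atTop (𝓝 0)) :
    Tendsto (fun n => ∫ x, u x * φ n x) atTop (𝓝 (∫ x, u x * v x)) := by
  rw [tendsto_iff_norm_sub_tendsto_zero]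
  have h2 : Tendsto (fun n => l2Norm u * l2Norm (fun x => φ n x - v x)) atTop (𝓝 0) := by
    simpa using h.const_mul (l2Norm u)
  refine squeeze_zero (fun _ => norm_nonneg _) (fun n => ?_) h2
  rw [← integral_sub (integrable_mul_of_memLp hu (hφ n)) (integrable_mul_of_memLp hu hv),
    Real.norm_eq_abs]
  simp only [← mul_sub]
  exact abs_integral_mul_le hu ((hφ n).sub hv)

theorem tendsto_l2Norm_of_tendsto_l2 {v : E → ℝ} {φ : ℕ → E → ℝ}
    (hv : MemLp v 2 volume) (hφ : ∀ n, MemLp (φ n) 2 volume)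
    (h : Tendsto (fun n => l2Norm (fun x => φ n x - v x)) atTop (𝓝 0)) :
    Tendsto (fun n => l2Norm (φ n)) atTop (𝓝 (l2Norm v)) := by
  rw [tendsto_iff_norm_sub_tendsto_zero]
  exact squeeze_zero (fun _ => norm_nonneg _) (fun n => abs_l2Norm_sub_le (hφ n) hv) h

theorem l2Norm_mono_ae {u v : E → ℝ} (hv : MemLp v 2 volume) (h : ∀ᵐ x, |u x| ≤ |v x|) :
    l2Norm u ≤ l2Norm v := by
  refine Real.sqrt_le_sqrt (integral_mono_of_nonneg (.of_forall fun _ => by positivity)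
    (by simpa using integrable_sq_of_memLp hv) ?_)
  filter_upwards [h] with x hx
  exact pow_le_pow_left₀ (norm_nonneg _) hx 2

theorem memLp_of_abs_le {u v : E → ℝ} (hv : MemLp v 2 volume)
    (hu : AEStronglyMeasurable u volume) (h : ∀ x, |u x| ≤ |v x|) : MemLp u 2 volume :=
  hv.mono hu (.of_forall h)

/-- Cauchy–Schwarz for √r · (√r h). For a probability density r it is Jensen's inequality, the form
used for mollifiers. -/
theorem lintegral_mul_sq_le {α : Type*} [MeasurableSpace α] {μ : Measure α} {r h : α → ℝ≥0∞}
    (hr : AEMeasurable r μ) (hh : AEMeasurable h μ) :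
    (∫⁻ t, r t * h t ∂μ) ^ 2 ≤ (∫⁻ t, r t ∂μ) * ∫⁻ t, r t * h t ^ 2 ∂μ := by
  have H := ENNReal.lintegral_mul_le_Lp_mul_Lq μ (p := 2) (q := 2) (by constructor <;> norm_num)
    (f := fun t => r t ^ (1 / 2 : ℝ)) (g := fun t => r t ^ (1 / 2 : ℝ) * h t)
    (hr.pow_const _) ((hr.pow_const _).mul hh)
  have e0 : ∀ a : ℝ≥0∞, a ^ (1 / 2 : ℝ) * a ^ (1 / 2 : ℝ) = a := fun a => by
    rw [← ENNReal.rpow_add_of_nonneg _ _ (by norm_num) (by norm_num)]; norm_num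
  have e1 : ∀ a : ℝ≥0∞, (a ^ (1 / 2 : ℝ)) ^ (2 : ℝ) = a := fun a => by
    rw [← ENNReal.rpow_mul]; norm_num
  have e2 : ∀ a : ℝ≥0∞, (a ^ (1 / 2 : ℝ)) ^ 2 = a := fun a => by
    rw [sq, e0]
  simp only [Pi.mul_apply, ← mul_assoc, e0, e1, ENNReal.mul_rpow_of_nonneg _ _ (zero_le_two : (0 : ℝ) ≤ 2)] at H
  calc _ ≤ _ := pow_le_pow_left' H 2
    _ = _ := by simp only [mul_pow, e2, ENNReal.rpow_two]

end L2

/-! ### Mollification in L² -/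

section Mollification

variable {E : Type*} [NormedAddCommGroup E] [NormedSpace ℝ E] [MeasureSpace E] [BorelSpace E]
  [FiniteDimensional ℝ E] [(volume : Measure E).IsAddHaarMeasure]

/-- Translations are measure preserving and depend continuously on t, and composition with such maps
is jointly continuous on L². -/
theorem tendsto_eLpNorm_translate_sub {f : E → ℝ} (hf : MemLp f 2 volume) :
    Tendsto (fun t : E => eLpNorm (fun x => f (x - t) - f x) 2 volume) (𝓝 0) (𝓝 0) := by
  have : Fact ((1 : ℝ≥0∞) ≤ 2) := ⟨by norm_num⟩
  let g : E → C(E, E) := fun t => ⟨fun x => x - t, by fun_prop⟩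
  have hg : Continuous g := ContinuousMap.continuous_of_continuous_uncurry _ (by
    change Continuous fun p : E × E => p.2 - p.1
    fun_prop)
  have hgm : ∀ t, MeasurePreserving (g t) (volume : Measure E) volume := fun t =>
    measurePreserving_sub_right volume t
  have hc : Continuous fun t => Lp.compMeasurePreserving (g t) (hgm t) (hf.toLp f) :=
    Continuous.compMeasurePreservingLp (continuous_const (y := hf.toLp f)) hg hgm (by norm_num)
  have h0 := hc.tendsto 0
  rw [tendsto_iff_edist_tendsto_0] at h0
  convert h0 using 2 with t
  rw [Lp.edist_def]
  refine eLpNorm_congr_ae ?_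
  have a1 : ∀ s, Lp.compMeasurePreserving (g s) (hgm s) (hf.toLp f) =ᵐ[volume]
      fun x => f (x - s) := fun s => by
    refine (Lp.coeFn_compMeasurePreserving _ (hgm s)).trans ?_
    exact (hgm s).quasiMeasurePreserving.ae_eq_comp hf.coeFn_toLp
  filter_upwards [a1 t, a1 0] with x h1 h2
  rw [Pi.sub_apply, h1, h2, sub_zero]

/-- Mollification of `f` by the kernel `ρ`. -/
def mollify (ρ f : E → ℝ) (x : E) : ℝ := ∫ t, ρ (x - t) * f t

theorem mollify_eq (ρ f : E → ℝ) (x : E) : mollify ρ f x = ∫ t, ρ t * f (x - t) := by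
  rw [mollify, ← integral_sub_left_eq_self (fun t => ρ t * f (x - t)) volume x]
  simp

theorem mollify_eq_convolution (ρ f : E → ℝ) :
    mollify ρ f = convolution f ρ (ContinuousLinearMap.mul ℝ ℝ) volume := by
  ext x
  simp [mollify, convolution, mul_comm]

/-- The difference ρ∗f - f is a ρ-average of the translation differences f(· - t) - f. Jensen
pointwise and Tonelli reduce its L² norm to the largest translation difference with t in the support
of ρ. -/
theorem eLpNorm_mollify_sub_le {f ρ : E → ℝ} (hf : MemLp f 2 volume) (hρ : IsTest ρ)
    (h0 : ∀ x, 0 ≤ ρ x) (h1 : ∫ x, ρ x = 1) {r : ℝ} (hr : ∀ x, ρ x ≠ 0 → ‖x‖ < r) {ε : ℝ≥0∞}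
    (hε : ∀ t : E, ‖t‖ < r → eLpNorm (fun x => f (x - t) - f x) 2 volume ≤ ε) :
    eLpNorm (fun x => mollify ρ f x - f x) 2 volume ≤ ε := by
  have hfl : LocallyIntegrable f volume := hf.locallyIntegrable (by norm_num)
  have hρi : Integrable ρ volume := hρ.continuous.integrable_of_hasCompactSupport hρ.2
  have hρl : ∫⁻ t, ENNReal.ofReal (ρ t) = 1 := by
    rw [← ofReal_integral_eq_lintegral_ofReal hρi (.of_forall h0), h1, ENNReal.ofReal_one]
  have ms : AEStronglyMeasurable (fun p : E × E => f (p.1 - p.2) - f p.1)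
      ((volume : Measure E).prod volume) := by
    refine AEStronglyMeasurable.sub ?_ ?_
    · exact hf.1.comp_quasiMeasurePreserving
        (quasiMeasurePreserving_sub_of_right_invariant volume volume)
    · exact hf.1.comp_fst
  have hpt : ∀ᵐ x : E, ‖mollify ρ f x - f x‖ₑ ^ 2 ≤
      ∫⁻ t, ENNReal.ofReal (ρ t) * ‖f (x - t) - f x‖ₑ ^ 2 := by
    filter_upwards [ms.prodMk_left] with x hx
    have i1 : Integrable (fun t => ρ t * f (x - t)) volume := by
      have : Integrable (fun t => ρ (x - t) * f t) volume :=
        (hfl.integrable_smul_left_of_hasCompactSupport (g := fun t => ρ (x - t))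
          (by have := hρ.continuous; fun_prop)
          (hρ.2.comp_homeomorph (Homeomorph.subLeft x)))
      have := this.comp_sub_left x
      simpa using this
    have e : mollify ρ f x - f x = ∫ t, ρ t * (f (x - t) - f x) := by
      simp only [mul_sub]
      rw [mollify_eq, integral_sub i1 (hρi.mul_const _), integral_mul_const, h1, one_mul]
    rw [e]
    calc _ ≤ (∫⁻ t, ‖ρ t * (f (x - t) - f x)‖ₑ) ^ 2 :=
          pow_le_pow_left' (enorm_integral_le_lintegral_enorm _) 2
      _ = (∫⁻ t, ENNReal.ofReal (ρ t) * ‖f (x - t) - f x‖ₑ) ^ 2 := by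
          congr 2; ext t; rw [enorm_mul, Real.enorm_eq_ofReal (h0 t)]
      _ ≤ _ := lintegral_mul_sq_le hρ.continuous.measurable.ennreal_ofReal.aemeasurable hx.enorm
      _ = _ := by rw [hρl, one_mul]
  have key : eLpNorm (fun x => mollify ρ f x - f x) 2 volume ^ 2 ≤ ε ^ 2 := by
    have e2 : ∀ h : E → ℝ, eLpNorm h 2 volume ^ 2 = ∫⁻ x, ‖h x‖ₑ ^ 2 := fun h => by
      rw [eLpNorm_eq_lintegral_rpow_enorm_toReal (by norm_num) (by norm_num), ← ENNReal.rpow_two,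
        ← ENNReal.rpow_mul]
      simp
    rw [e2]
    calc _ ≤ ∫⁻ x, ∫⁻ t, ENNReal.ofReal (ρ t) * ‖f (x - t) - f x‖ₑ ^ 2 := lintegral_mono_ae hpt
      _ = ∫⁻ t, ∫⁻ x, ENNReal.ofReal (ρ t) * ‖f (x - t) - f x‖ₑ ^ 2 := by
          refine lintegral_lintegral_swap ?_
          exact (hρ.continuous.measurable.ennreal_ofReal.comp measurable_snd).aemeasurable.mul
            (ms.enorm.pow_const 2)
      _ ≤ ∫⁻ t, ENNReal.ofReal (ρ t) * ε ^ 2 := by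
          refine lintegral_mono fun t => ?_
          simp only
          rw [lintegral_const_mul' _ _ ENNReal.ofReal_ne_top, ← e2 fun x => f (x - t) - f x]
          by_cases ht : ρ t = 0
          · simp [ht]
          · gcongr
            exact hε t (hr t ht)
      _ = ε ^ 2 := by
          rw [lintegral_mul_const _ hρ.continuous.measurable.ennreal_ofReal, hρl, one_mul]
  exact (ENNReal.pow_le_pow_left_iff two_ne_zero).1 key

/-- A sequence of smooth probability densities supported in balls shrinking to the origin. -/
theorem exists_mollifier_seq : ∃ ρ : ℕ → E → ℝ, (∀ n, IsTest (ρ n)) ∧ (∀ n x, 0 ≤ ρ n x) ∧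
    (∀ n, ∫ x, ρ n x = 1) ∧ ∀ n x, ρ n x ≠ 0 → ‖x‖ < 1 / ((n : ℝ) + 1) := by
  have hpos : ∀ n : ℕ, (0 : ℝ) < 1 / ((n : ℝ) + 1) := fun n => by positivity
  let b : ℕ → ContDiffBump (0 : E) := fun n =>
    ⟨1 / ((n : ℝ) + 1) / 2, 1 / ((n : ℝ) + 1), half_pos (hpos n), half_lt_self (hpos n)⟩
  refine ⟨fun n => (b n).normed volume, fun n => ⟨(b n).contDiff_normed,
    (b n).hasCompactSupport_normed⟩, fun n x => (b n).nonneg_normed x,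
    fun n => (b n).integral_normed, fun n x hx => ?_⟩
  have : x ∈ Function.support ((b n).normed volume) := hx
  rw [(b n).support_normed_eq] at this
  exact mem_ball_zero_iff.1 this

theorem tendsto_mollify {f : E → ℝ} (hf : MemLp f 2 volume) {ρ : ℕ → E → ℝ}
    (h : ∀ n, IsTest (ρ n)) (h0 : ∀ n x, 0 ≤ ρ n x) (h1 : ∀ n, ∫ x, ρ n x = 1)
    (hr : ∀ n x, ρ n x ≠ 0 → ‖x‖ < 1 / ((n : ℝ) + 1)) :
    Tendsto (fun n => eLpNorm (fun x => mollify (ρ n) f x - f x) 2 volume) atTop (𝓝 0) := by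
  rw [ENNReal.tendsto_nhds_zero]
  intro ε hε
  have := (ENNReal.tendsto_nhds_zero.1 (tendsto_eLpNorm_translate_sub hf)) ε hε
  obtain ⟨δ, hδ, hb⟩ := Metric.eventually_nhds_iff.1 this
  obtain ⟨N, hN⟩ := exists_nat_one_div_lt hδ
  filter_upwards [eventually_ge_atTop N] with n hn
  refine eLpNorm_mollify_sub_le hf (h n) (h0 n) (h1 n) (hr n) fun t ht => hb ?_
  rw [dist_zero_right]
  refine ht.trans (lt_of_le_of_lt ?_ hN)
  gcongr

theorem contDiff_mollify {f ρ : E → ℝ} (hf : LocallyIntegrable f volume) (hρ : IsTest ρ) :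
    ContDiff ℝ ((⊤ : ℕ∞) : WithTop ℕ∞) (mollify ρ f) := by
  rw [mollify_eq_convolution]
  exact hρ.2.contDiff_convolution_right _ hf hρ.1

theorem isTest_mollify {f ρ : E → ℝ} (hf : LocallyIntegrable f volume) (hc : HasCompactSupport f)
    (hρ : IsTest ρ) : IsTest (mollify ρ f) :=
  ⟨contDiff_mollify hf hρ, by
    rw [mollify_eq_convolution]; exact HasCompactSupport.convolution _ hc hρ.2⟩

/-- The function t ↦ ρ(x - t) is a test function; the sign from the reflection cancels the sign in
the definition of a weak derivative. -/
theorem fderiv_mollify {f g ρ : E → ℝ} {v : E} (h : HasWeakDeriv f v g) (hρ : IsTest ρ) (x : E) :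
    fderiv ℝ (mollify ρ f) x v = mollify ρ g x := by
  have hd := hρ.2.hasFDerivAt_convolution_right (ContinuousLinearMap.mul ℝ ℝ) h.1
    (hρ.1.of_le (by simp)) x
  rw [mollify_eq_convolution, hd.fderiv, convolution_precompR_apply _ h.1 (hρ.2.fderiv (𝕜 := ℝ))
    (hρ.1.continuous_fderiv (by simp))]
  have ht : IsTest (fun t => ρ (x - t)) :=
    ⟨hρ.1.comp (contDiff_const.sub contDiff_id), hρ.2.comp_homeomorph (Homeomorph.subLeft x)⟩
  have h1 := h.2.2 _ ht
  have e : ∀ t, fderiv ℝ (fun t => ρ (x - t)) t v = - fderiv ℝ ρ (x - t) v := fun t => by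
    have hc : HasFDerivAt (fun t : E => x - t) (-ContinuousLinearMap.id ℝ E) t := by
      simpa using (hasFDerivAt_id t).const_sub x
    have := (hρ.differentiable (x - t)).hasFDerivAt.comp t hc
    rw [show (fun t => ρ (x - t)) = ρ ∘ fun t => x - t from rfl, this.fderiv]
    simp
  simp only [e, smul_eq_mul, neg_mul, integral_neg, neg_inj] at h1
  rw [mollify, ← h1]
  simp [convolution, mul_comm]

end Mollification

theorem tendsto_l2Norm_of_eLpNorm {E : Type*} [MeasureSpace E] {v : E → ℝ} {φ : ℕ → E → ℝ}
    (hv : MemLp v 2 volume) (hφ : ∀ n, MemLp (φ n) 2 volume)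
    (h : Tendsto (fun n => eLpNorm (fun x => φ n x - v x) 2 volume) atTop (𝓝 0)) :
    Tendsto (fun n => l2Norm (fun x => φ n x - v x)) atTop (𝓝 0) := by
  have := (ENNReal.continuousAt_toReal ENNReal.zero_ne_top).tendsto.comp h
  refine this.congr fun n => ?_
  exact (l2Norm_eq_toReal (u := fun x => φ n x - v x) ((hφ n).sub hv)).symm

instance : (volume : Measure X).IsAddHaarMeasure :=
  inferInstanceAs ((volume : Measure Y).prod (volume : Measure ℝ)).IsAddHaarMeasure

/-! ### Smooth cutoffs -/

section Cutoff

/-- Smooth cutoffs equal to one on larger and larger balls. -/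
theorem exists_cutoff_seq : ∃ (χ : ℕ → X → ℝ) (C : ℝ), 0 ≤ C ∧ (∀ n, IsTest (χ n)) ∧
    (∀ n x, 0 ≤ χ n x ∧ χ n x ≤ 1) ∧ (∀ x, ∀ᶠ n in atTop, χ n x = 1) ∧
    ∀ n v x, |fderiv ℝ (χ n) x v| ≤ C * ‖v‖ / ((n : ℝ) + 1) := by
  let b : ContDiffBump (0 : X) := ⟨1, 2, one_pos, one_lt_two⟩
  have hb : ContDiff ℝ ((⊤ : ℕ∞) : WithTop ℕ∞) (b : X → ℝ) := b.contDiff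
  have hbd : Continuous (fderiv ℝ (b : X → ℝ)) := hb.continuous_fderiv (by simp)
  obtain ⟨C, hC⟩ := hbd.bounded_above_of_compact_support (b.hasCompactSupport.fderiv (𝕜 := ℝ))
  have hpos : ∀ n : ℕ, (0 : ℝ) < 1 / ((n : ℝ) + 1) := fun n => by positivity
  refine ⟨fun n x => b ((1 / ((n : ℝ) + 1)) • x), C, (norm_nonneg _).trans (hC 0), fun n => ⟨?_, ?_⟩,
    fun n x => ⟨b.nonneg, b.le_one⟩, fun x => ?_, fun n v x => ?_⟩
  · exact hb.comp (contDiff_const_smul _)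
  · exact b.hasCompactSupport.comp_smul (hpos n).ne'
  · obtain ⟨N, hN⟩ := exists_nat_ge ‖x‖
    filter_upwards [eventually_ge_atTop N] with n hn
    refine b.one_of_mem_closedBall ?_
    rw [mem_closedBall_zero_iff, norm_smul, Real.norm_of_nonneg (hpos n).le, one_div,
      inv_mul_le_iff₀ (by positivity)]
    have : (N : ℝ) ≤ n := by exact_mod_cast hn
    change ‖x‖ ≤ ((n : ℝ) + 1) * 1
    linarith
  · have hd : HasFDerivAt (fun x : X => b ((1 / ((n : ℝ) + 1)) • x))
        ((fderiv ℝ (b : X → ℝ) ((1 / ((n : ℝ) + 1)) • x)).comp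
          ((1 / ((n : ℝ) + 1)) • ContinuousLinearMap.id ℝ X)) x :=
      ((hb.differentiable (by simp) _).hasFDerivAt).comp x
        ((hasFDerivAt_id x).const_smul (1 / ((n : ℝ) + 1)))
    rw [hd.fderiv]
    simp only [ContinuousLinearMap.comp_apply, _root_.smul_apply,
      ContinuousLinearMap.id_apply, map_smul, smul_eq_mul, abs_mul, abs_of_pos (hpos n)]
    have h1 := (fderiv ℝ (b : X → ℝ) ((1 / ((n : ℝ) + 1)) • x)).le_opNorm v
    have h2 : |fderiv ℝ (b : X → ℝ) ((1 / ((n : ℝ) + 1)) • x) v| ≤ C * ‖v‖ :=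
      h1.trans (by gcongr; exact hC _)
    calc _ ≤ 1 / ((n : ℝ) + 1) * (C * ‖v‖) := by gcongr
      _ = _ := by ring

theorem tendsto_cutoff {χ : ℕ → X → ℝ} (hχ : ∀ n, IsTest (χ n))
    (h01 : ∀ n x, 0 ≤ χ n x ∧ χ n x ≤ 1) (h1 : ∀ x, ∀ᶠ n in atTop, χ n x = 1)
    {f : X → ℝ} (hf : MemLp f 2 volume) :
    Tendsto (fun n => l2Norm (fun x => χ n x * f x - f x)) atTop (𝓝 0) := by
  have : Tendsto (fun n => ∫ x, ‖χ n x * f x - f x‖ ^ 2) atTop (𝓝 (∫ _ : X, (0 : ℝ))) := by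
    refine tendsto_integral_of_dominated_convergence (fun x => f x ^ 2) (fun n => ?_)
      (integrable_sq_of_memLp hf) (fun n => .of_forall fun x => ?_) (.of_forall fun x => ?_)
    · exact ((((hχ n).continuous.aestronglyMeasurable).mul hf.1).sub hf.1).norm.pow 2
    · have e : χ n x * f x - f x = (χ n x - 1) * f x := by ring
      rw [e, norm_mul, mul_pow, Real.norm_of_nonneg (by positivity)]
      simp only [Real.norm_eq_abs, sq_abs]
      have := h01 n x
      have : (χ n x - 1) ^ 2 ≤ 1 := by nlinarith
      nlinarith [sq_nonneg (f x)]
    · refine tendsto_const_nhds.congr' ?_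
      filter_upwards [h1 x] with n hn
      simp [hn]
  simp only [integral_zero] at this
  have h2 := (Real.continuous_sqrt.tendsto 0).comp this
  simpa [l2Norm, mass, Function.comp_def] using h2

theorem memLp_cutoff {χ : X → ℝ} (hχ : IsTest χ)
    (h01 : ∀ x, 0 ≤ χ x ∧ χ x ≤ 1) {f : X → ℝ} (hf : MemLp f 2 volume) :
    MemLp (fun x => χ x * f x) 2 volume := by
  refine hf.mono (hχ.continuous.aestronglyMeasurable.mul hf.1) (.of_forall fun x => ?_)
  rw [norm_mul, Real.norm_of_nonneg (h01 x).1]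
  exact mul_le_of_le_one_left (norm_nonneg _) (h01 x).2

end Cutoff

/-! ### The space Σ and density of test functions -/

theorem MemSigma.memLp {u : X → ℝ} (h : MemSigma u) : MemLp u 2 volume := h.1.1

theorem MemSigma.memLp_weight {u : X → ℝ} (h : MemSigma u) :
    MemLp (fun x : X => ‖x.1‖ * u x) 2 volume := by
  refine h.2.mono (((by fun_prop : Continuous fun x : X => ‖x.1‖).aestronglyMeasurable).mul h.memLp.1)
    (.of_forall fun x => ?_)
  simp

theorem memSigma_of_memLp_weight {u : X → ℝ} (h : MemH1 u)
    (h2 : MemLp (fun x : X => ‖x.1‖ * u x) 2 volume) : MemSigma u := by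
  refine ⟨h, by simpa [norm_mul] using h2.norm⟩

theorem MemSigma.add {u v : X → ℝ} (h : MemSigma u) (h' : MemSigma v) :
    MemSigma (fun x => u x + v x) :=
  memSigma_of_memLp_weight (h.1.add h'.1) (by
    simp only [mul_add]
    exact h.memLp_weight.add h'.memLp_weight)

theorem MemSigma.const_mul {u : X → ℝ} (h : MemSigma u) (c : ℝ) :
    MemSigma (fun x => c * u x) :=
  memSigma_of_memLp_weight (h.1.const_mul c) (by
    simpa [mul_left_comm] using h.memLp_weight.const_mul c)

theorem MemSigma.sub {u v : X → ℝ} (h : MemSigma u) (h' : MemSigma v) :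
    MemSigma (fun x => u x - v x) :=
  memSigma_of_memLp_weight (h.1.sub h'.1) (by
    simp only [mul_sub]
    exact h.memLp_weight.sub h'.memLp_weight)

theorem IsTest.memSigma {φ : X → ℝ} (h : IsTest φ) : MemSigma φ :=
  memSigma_of_memLp_weight h.memH1
    ((by have := h.continuous; fun_prop : Continuous fun x : X => ‖x.1‖ * φ x).memLp_of_hasCompactSupport
      h.2.mul_left)

/-- Convergence in `Σ` of a sequence of test functions. -/
def TendstoSigma (φ : ℕ → X → ℝ) (u : X → ℝ) : Prop :=
  Tendsto (fun n => l2Norm (fun x => φ n x - u x)) atTop (𝓝 0) ∧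
  (∀ i, Tendsto (fun n => l2Norm (fun x => fderiv ℝ (φ n) x (eY i) - weakDeriv (eY i) u x))
    atTop (𝓝 0)) ∧
  Tendsto (fun n => l2Norm (fun x => fderiv ℝ (φ n) x eZ - weakDeriv eZ u x)) atTop (𝓝 0) ∧
  Tendsto (fun n => l2Norm (fun x => ‖x.1‖ * φ n x - ‖x.1‖ * u x)) atTop (𝓝 0)

theorem exists_test_near_of_hasCompactSupport {u : X → ℝ} (hu : MemSigma u)
    (hc : HasCompactSupport u) {ε : ℝ} (hε : 0 < ε) : ∃ φ, IsTest φ ∧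
      l2Norm (fun x => φ x - u x) < ε ∧
      (∀ i, l2Norm (fun x => fderiv ℝ φ x (eY i) - weakDeriv (eY i) u x) < ε) ∧
      l2Norm (fun x => fderiv ℝ φ x eZ - weakDeriv eZ u x) < ε ∧
      l2Norm (fun x => ‖x.1‖ * φ x - ‖x.1‖ * u x) < ε := by
  obtain ⟨ρ, hρ, h0, h1, hr⟩ := exists_mollifier_seq (E := X)
  have hul : LocallyIntegrable u volume := hu.memLp.locallyIntegrable (by norm_num)
  have ht : ∀ n, IsTest (mollify (ρ n) u) := fun n => isTest_mollify hul hc (hρ n)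
  have c0 : Tendsto (fun n => l2Norm (fun x => mollify (ρ n) u x - u x)) atTop (𝓝 0) :=
    tendsto_l2Norm_of_eLpNorm hu.memLp (fun n => (ht n).memLp 2) (tendsto_mollify hu.memLp hρ h0 h1 hr)
  have cv : ∀ v, Tendsto (fun n => l2Norm (fun x => fderiv ℝ (mollify (ρ n) u) x v - weakDeriv v u x))
      atTop (𝓝 0) := fun v => by
    refine tendsto_l2Norm_of_eLpNorm (hu.1.memLp_weakDeriv v)
      (fun n => ((ht n).fderiv_apply v).memLp 2) ?_
    simp only [fun n => fderiv_mollify (hu.1.hasWeakDeriv v) (hρ n)]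
    exact tendsto_mollify (hu.1.memLp_weakDeriv v) hρ h0 h1 hr
  obtain ⟨R, hR⟩ := hc.isCompact.isBounded.exists_norm_le
  have hR0 : 0 ≤ max R 0 := le_max_right _ _
  -- The mollifiers live in the unit ball, so u and its mollifications all vanish outside a ball of
  -- radius max R 0 + 1; there the weight is bounded and unweighted convergence suffices.
  have cw : Tendsto (fun n => l2Norm (fun x : X => ‖x.1‖ * mollify (ρ n) u x - ‖x.1‖ * u x))
      atTop (𝓝 0) := by
    have hlim := c0.const_mul (max R 0 + 1)
    rw [mul_zero] at hlim
    refine squeeze_zero (fun n => l2Norm_nonneg _) (fun n => ?_) hlim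
    rw [← abs_of_nonneg (by positivity : 0 ≤ max R 0 + 1), ← l2Norm_const_mul]
    refine l2Norm_mono_ae (((((ht n).memLp 2).sub hu.memLp)).const_mul _) (.of_forall fun x => ?_)
    rw [← mul_sub, abs_mul, abs_mul, abs_norm]
    by_cases hx : ‖x‖ ≤ max R 0 + 1
    · gcongr
      exact (norm_fst_le x).trans (hx.trans (le_abs_self _))
    · push Not at hx
      have u0 : u x = 0 := by
        by_contra h
        have := hR x (subset_tsupport _ h)
        linarith [le_max_left R 0]
      have m0 : mollify (ρ n) u x = 0 := by
        rw [mollify]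
        refine integral_eq_zero_of_ae (.of_forall fun t => ?_)
        by_contra h
        have h' := mul_ne_zero_iff.1 h
        have h2 := hr n _ h'.1
        have h3 := hR t (subset_tsupport _ h'.2)
        have h4 : ‖x‖ ≤ ‖x - t‖ + ‖t‖ := by simpa using norm_add_le (x - t) t
        have h5 : 1 / ((n : ℝ) + 1) ≤ 1 := by
          rw [div_le_one (by positivity)]; linarith [(Nat.cast_nonneg n : (0 : ℝ) ≤ n)]
        linarith [le_max_left R 0]
      simp [u0, m0]
  obtain ⟨n, hn⟩ := ((c0.eventually_lt_const hε).and (((cv (eY 0)).eventually_lt_const hε).and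
    (((cv (eY 1)).eventually_lt_const hε).and (((cv eZ).eventually_lt_const hε).and
    (cw.eventually_lt_const hε))))).exists
  refine ⟨_, ht n, hn.1, fun i => ?_, hn.2.2.2.1, hn.2.2.2.2⟩
  fin_cases i
  · exact hn.2.1
  · exact hn.2.2.1

/-- Cut off first, then mollify to within 1/(n+1). The extra term u∇χₙ created by the cutoff is
O(1/n) in L² because the gradient of χₙ is O(1/n). -/
theorem MemSigma.exists_test_seq {u : X → ℝ} (hu : MemSigma u) :
    ∃ φ : ℕ → X → ℝ, (∀ n, IsTest (φ n)) ∧ TendstoSigma φ u := by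
  obtain ⟨χ, C, hC, hχ, h01, h1, hd⟩ := exists_cutoff_seq
  have hdv : ∀ n v, HasWeakDeriv (fun x => χ n x * u x) v
      (fun x => χ n x * weakDeriv v u x + fderiv ℝ (χ n) x v * u x) := fun n v =>
    (hu.1.hasWeakDeriv v).mul_smooth (hχ n).1
  have hdl : ∀ n v, MemLp (fun x => fderiv ℝ (χ n) x v * u x) 2 volume := fun n v => by
    refine (hu.memLp.const_mul (C * ‖v‖ / ((n : ℝ) + 1))).mono
      (((hχ n).fderiv_apply v).continuous.aestronglyMeasurable.mul hu.memLp.1)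
      (.of_forall fun x => ?_)
    rw [norm_mul, norm_mul]
    gcongr
    exact (hd n v x).trans (le_abs_self _)
  have hdm : ∀ n v, MemLp (fun x => χ n x * weakDeriv v u x + fderiv ℝ (χ n) x v * u x) 2 volume :=
    fun n v => (memLp_cutoff (hχ n) (h01 n) (hu.1.memLp_weakDeriv v)).add (hdl n v)
  have hs : ∀ n, MemSigma (fun x => χ n x * u x) := fun n => by
    refine memSigma_of_memLp_weight ⟨memLp_cutoff (hχ n) (h01 n) hu.memLp, fun v => ⟨_, hdv n v, hdm n v⟩⟩ ?_
    have := memLp_cutoff (hχ n) (h01 n) hu.memLp_weight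
    refine this.congr_norm ?_ ?_
    · exact ((by fun_prop : Continuous fun x : X => ‖x.1‖).aestronglyMeasurable).mul
        ((hχ n).continuous.aestronglyMeasurable.mul hu.memLp.1)
    · exact .of_forall fun x => by simp [mul_left_comm]
  have hcs : ∀ n, HasCompactSupport (fun x => χ n x * u x) := fun n => (hχ n).2.mul_right
  have hinv : Tendsto (fun n : ℕ => 1 / ((n : ℝ) + 1)) atTop (𝓝 0) := tendsto_one_div_add_atTop_nhds_zero_nat
  choose φ ht e0 eY eZ ew using fun n => exists_test_near_of_hasCompactSupport (hs n) (hcs n)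
    (by positivity : (0 : ℝ) < 1 / ((n : ℝ) + 1))
  have tri : ∀ {a b c : X → ℝ}, MemLp a 2 volume → MemLp b 2 volume → MemLp c 2 volume →
      l2Norm (fun x => a x - c x) ≤ l2Norm (fun x => a x - b x) + l2Norm (fun x => b x - c x) := by
    intro a b c ha hb hc
    refine le_of_eq_of_le ?_ (l2Norm_add_le (ha.sub hb) (hb.sub hc))
    congr 1
    ext x
    simp
  have dlim : ∀ v, Tendsto (fun n => l2Norm (fun x => weakDeriv v (fun x => χ n x * u x) x - weakDeriv v u x))
      atTop (𝓝 0) := fun v => by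
    have h2 : Tendsto (fun n : ℕ => C * ‖v‖ * (1 / ((n : ℝ) + 1)) * l2Norm u) atTop (𝓝 0) := by
      simpa using (hinv.const_mul (C * ‖v‖)).mul_const (l2Norm u)
    have h3 := (tendsto_cutoff hχ h01 h1 (hu.1.memLp_weakDeriv v)).add h2
    rw [add_zero] at h3
    refine squeeze_zero (fun n => l2Norm_nonneg _) (fun n => ?_) h3
    have e : (fun x => weakDeriv v (fun x => χ n x * u x) x - weakDeriv v u x) =ᵐ[volume]
        fun x => (χ n x * weakDeriv v u x - weakDeriv v u x) + fderiv ℝ (χ n) x v * u x := by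
      filter_upwards [(hdv n v).weakDeriv_ae] with x hx
      rw [hx]; ring
    rw [l2Norm_congr_ae e]
    refine (l2Norm_add_le ((memLp_cutoff (hχ n) (h01 n) (hu.1.memLp_weakDeriv v)).sub
      (hu.1.memLp_weakDeriv v)) (hdl n v)).trans (add_le_add le_rfl ?_)
    rw [← abs_of_nonneg (by positivity : 0 ≤ C * ‖v‖ * (1 / ((n : ℝ) + 1))), ← l2Norm_const_mul]
    refine l2Norm_mono_ae (hu.memLp.const_mul _) (.of_forall fun x => ?_)
    rw [abs_mul, abs_mul]
    refine mul_le_mul_of_nonneg_right ?_ (abs_nonneg _)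
    refine (hd n v x).trans (le_trans (le_of_eq (mul_one_div _ _).symm) (le_abs_self _))
  refine ⟨φ, ht, ?_, fun i => ?_, ?_, ?_⟩
  · have h3 := hinv.add (tendsto_cutoff hχ h01 h1 hu.memLp)
    rw [add_zero] at h3
    exact squeeze_zero (fun n => l2Norm_nonneg _) (fun n =>
      (tri ((ht n).memLp 2) (hs n).memLp hu.memLp).trans (add_le_add (e0 n).le le_rfl)) h3
  · have h3 := hinv.add (dlim (DimRed.eY i))
    rw [add_zero] at h3
    exact squeeze_zero (fun n => l2Norm_nonneg _) (fun n =>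
      (tri (((ht n).fderiv_apply _).memLp 2) ((hs n).1.memLp_weakDeriv _)
        (hu.1.memLp_weakDeriv _)).trans (add_le_add (eY n i).le le_rfl)) h3
  · have h3 := hinv.add (dlim DimRed.eZ)
    rw [add_zero] at h3
    exact squeeze_zero (fun n => l2Norm_nonneg _) (fun n =>
      (tri (((ht n).fderiv_apply _).memLp 2) ((hs n).1.memLp_weakDeriv _)
        (hu.1.memLp_weakDeriv _)).trans (add_le_add (eZ n).le le_rfl)) h3
  · have h4 : Tendsto (fun n => l2Norm (fun x : X => ‖x.1‖ * (χ n x * u x) - ‖x.1‖ * u x))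
        atTop (𝓝 0) := by
      simpa only [mul_left_comm] using tendsto_cutoff hχ h01 h1 hu.memLp_weight
    have h3 := hinv.add h4
    rw [add_zero] at h3
    exact squeeze_zero (fun n => l2Norm_nonneg _) (fun n =>
      (tri ((ht n).memSigma.memLp_weight) (hs n).memLp_weight
        hu.memLp_weight).trans (add_le_add (ew n).le le_rfl)) h3

/-! ### Transverse coordinates -/

section Coordinates

theorem continuous_coord (i : Fin 2) : Continuous fun x : X => x.1 i := by fun_prop

theorem abs_coord_le (x : X) (i : Fin 2) : |x.1 i| ≤ ‖x.1‖ := by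
  simpa using PiLp.norm_apply_le x.1 i

theorem norm_fst_sq (x : X) : ‖x.1‖ ^ 2 = ∑ i, x.1 i ^ 2 := by
  rw [EuclideanSpace.norm_sq_eq]; simp

theorem contDiff_coord (i : Fin 2) :
    ContDiff ℝ ((⊤ : ℕ∞) : WithTop ℕ∞) (fun x : X => x.1 i) := by fun_prop

theorem hasFDerivAt_coord (i : Fin 2) (x : X) : HasFDerivAt (fun x : X => x.1 i)
    ((EuclideanSpace.proj i : Y →L[ℝ] ℝ).comp (ContinuousLinearMap.fst ℝ Y ℝ)) x :=
  ((EuclideanSpace.proj i : Y →L[ℝ] ℝ).comp (ContinuousLinearMap.fst ℝ Y ℝ)).hasFDerivAt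

theorem fderiv_coord (i j : Fin 2) (x : X) :
    fderiv ℝ (fun x : X => x.1 i) x (eY j) = if i = j then 1 else 0 := by
  rw [(hasFDerivAt_coord i x).fderiv]
  simp [eY]

theorem MemSigma.memLp_coord {u : X → ℝ} (h : MemSigma u) (i : Fin 2) :
    MemLp (fun x : X => x.1 i * u x) 2 volume := by
  refine memLp_of_abs_le h.memLp_weight ((continuous_coord i).aestronglyMeasurable.mul h.memLp.1)
    fun x => ?_
  rw [abs_mul, abs_mul, abs_norm]
  gcongr
  exact abs_coord_le x i

end Coordinates

/-! ### Integration by parts in Σ and factorization of H_y - 2 -/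

section IntegrationByParts

theorem TendstoSigma.coord {φ : ℕ → X → ℝ} {u : X → ℝ} (h : TendstoSigma φ u)
    (hu : MemSigma u) (hφ : ∀ n, IsTest (φ n)) (i : Fin 2) :
    Tendsto (fun n => l2Norm (fun x => x.1 i * φ n x - x.1 i * u x)) atTop (𝓝 0) := by
  refine squeeze_zero (fun n => l2Norm_nonneg _) (fun n => ?_) h.2.2.2
  refine l2Norm_mono_ae ((hφ n).memSigma.memLp_weight.sub hu.memLp_weight) (.of_forall fun x => ?_)
  rw [← mul_sub, ← mul_sub, abs_mul, abs_mul, abs_norm]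
  gcongr
  exact abs_coord_le x i

/-- Extends the definition of weak derivative from test functions to all of Σ by density. This is
needed for test objects such as ψ(z)Φ₀(y), which are not compactly supported. -/
theorem MemH1.integral_weakDeriv_eZ_mul {u v : X → ℝ} (hu : MemH1 u) (hv : MemSigma v) :
    ∫ x, weakDeriv eZ u x * v x = - ∫ x, u x * weakDeriv eZ v x := by
  obtain ⟨φ, hφ, hc⟩ := hv.exists_test_seq
  have l1 := tendsto_integral_mul_of_tendsto_l2 (hu.memLp_weakDeriv eZ) hv.memLp
    (fun n => (hφ n).memLp 2) hc.1
  have l2 := tendsto_integral_mul_of_tendsto_l2 hu.1 (hv.1.memLp_weakDeriv eZ)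
    (fun n => ((hφ n).fderiv_apply eZ).memLp 2) hc.2.2.1
  refine tendsto_nhds_unique (l1.congr fun n => ?_) l2.neg
  have := (hu.hasWeakDeriv eZ).2.2 _ (hφ n)
  simp only [smul_eq_mul] at this
  simp only [mul_comm (u _), this, mul_comm (weakDeriv eZ u _), neg_neg]

/-- Weak form of the commutator [∂_{yᵢ}, yᵢ] = 1: use yᵢφ as test function, then pass to the limit
in φ. -/
theorem MemSigma.integral_weakDeriv_eY_coord {u v : X → ℝ} (hu : MemSigma u) (hv : MemSigma v)
    (i : Fin 2) :
    (∫ x : X, weakDeriv (eY i) u x * (x.1 i * v x)) + (∫ x : X, (x.1 i * u x) * weakDeriv (eY i) v x)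
      + ∫ x, u x * v x = 0 := by
  obtain ⟨φ, hφ, hc⟩ := hv.exists_test_seq
  have l1 := tendsto_integral_mul_of_tendsto_l2 (hu.1.memLp_weakDeriv (eY i)) (hv.memLp_coord i)
    (fun n => (hφ n).memSigma.memLp_coord i) (hc.coord hv hφ i)
  have l2 := tendsto_integral_mul_of_tendsto_l2 (hu.memLp_coord i) (hv.1.memLp_weakDeriv (eY i))
    (fun n => ((hφ n).fderiv_apply (eY i)).memLp 2) (hc.2.1 i)
  have l3 := tendsto_integral_mul_of_tendsto_l2 hu.memLp hv.memLp
    (fun n => (hφ n).memLp 2) hc.1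
  refine tendsto_nhds_unique ((l1.add l2).add l3) (tendsto_const_nhds.congr fun n => ?_)
  have h1 := (hu.1.hasWeakDeriv (eY i)).2.2 _ ((hφ n).mul_smooth (contDiff_coord i))
  have e : ∀ x, fderiv ℝ (fun x : X => x.1 i * φ n x) x (eY i)
      = φ n x + x.1 i * fderiv ℝ (φ n) x (eY i) := fun x => by
    rw [fderiv_fun_mul (hasFDerivAt_coord i x).differentiableAt ((hφ n).differentiable x)]
    simp [fderiv_coord]; ring
  simp only [e, smul_eq_mul, add_mul] at h1
  have i1 : Integrable (fun x => φ n x * u x) volume := integrable_mul_of_memLp ((hφ n).memLp 2) hu.memLp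
  have i2 : Integrable (fun x : X => x.1 i * fderiv ℝ (φ n) x (eY i) * u x) volume := by
    have := integrable_mul_of_memLp (hu.memLp_coord i) (((hφ n).fderiv_apply (eY i)).memLp 2)
    refine this.congr (.of_forall fun x => by ring)
  rw [integral_add i1 i2] at h1
  have e1 : ∫ x : X, weakDeriv (eY i) u x * (x.1 i * φ n x) = ∫ x, x.1 i * φ n x * weakDeriv (eY i) u x := by
    congr 1; ext x; ring
  have e2 : ∫ x : X, (x.1 i * u x) * fderiv ℝ (φ n) x (eY i)
      = ∫ x : X, x.1 i * fderiv ℝ (φ n) x (eY i) * u x := by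
    congr 1; ext x; ring
  have e3 : ∫ x, u x * φ n x = ∫ x, φ n x * u x := by congr 1; ext x; ring
  rw [e1, e2, e3]
  linarith

/-- The annihilation operator `∂_{y_i} + y_i`. -/
def ann (i : Fin 2) (u : X → ℝ) (x : X) : ℝ := weakDeriv (eY i) u x + x.1 i * u x

theorem MemSigma.memLp_ann {u : X → ℝ} (hu : MemSigma u) (i : Fin 2) : MemLp (ann i u) 2 volume :=
  (hu.1.memLp_weakDeriv (eY i)).add (hu.memLp_coord i)

theorem MemSigma.integral_ann_mul_ann {u v : X → ℝ} (hu : MemSigma u) (hv : MemSigma v)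
    (i : Fin 2) : ∫ x, ann i u x * ann i v x = (∫ x, weakDeriv (eY i) u x * weakDeriv (eY i) v x)
      + (∫ x : X, (x.1 i * u x) * (x.1 i * v x)) - ∫ x, u x * v x := by
  have h := hu.integral_weakDeriv_eY_coord hv i
  have i1 := integrable_mul_of_memLp (hu.1.memLp_weakDeriv (eY i)) (hv.1.memLp_weakDeriv (eY i))
  have i2 := integrable_mul_of_memLp (hu.memLp_coord i) (hv.memLp_coord i)
  have i3 := integrable_mul_of_memLp (hu.1.memLp_weakDeriv (eY i)) (hv.memLp_coord i)
  have i4 := integrable_mul_of_memLp (hu.memLp_coord i) (hv.1.memLp_weakDeriv (eY i))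
  have e : ∀ x, ann i u x * ann i v x = (weakDeriv (eY i) u x * weakDeriv (eY i) v x
      + (x.1 i * u x) * (x.1 i * v x)) + (weakDeriv (eY i) u x * (x.1 i * v x)
      + (x.1 i * u x) * weakDeriv (eY i) v x) := fun x => by simp only [ann]; ring
  simp only [e]
  have a1 := integral_add (i1.add i2) (i3.add i4)
  have a2 := integral_add i1 i2
  have a3 := integral_add i3 i4
  simp only [Pi.add_apply] at a1
  rw [a1, a2, a3]
  linarith

/-- The factorization H_y - 2 = Σ aᵢ*aᵢ: in each of the two directions the cross terms of (∂ᵢu +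
yᵢu)(∂ᵢv + yᵢv) integrate to -∫uv, which accounts for the constant 2. -/
theorem MemSigma.integral_formY {u v : X → ℝ} (hu : MemSigma u) (hv : MemSigma v) :
    ∫ x : X, ((∑ i : Fin 2, weakDeriv (eY i) u x * weakDeriv (eY i) v x)
        + ‖x.1‖ ^ 2 * u x * v x - 2 * u x * v x) = ∑ i, ∫ x, ann i u x * ann i v x := by
  have i1 := fun i => integrable_mul_of_memLp (hu.1.memLp_weakDeriv (eY i)) (hv.1.memLp_weakDeriv (eY i))
  have i2 := fun i => integrable_mul_of_memLp (hu.memLp_coord i) (hv.memLp_coord i)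
  have i3 := integrable_mul_of_memLp hu.memLp hv.memLp
  have e : ∀ x : X, ((∑ i : Fin 2, weakDeriv (eY i) u x * weakDeriv (eY i) v x)
        + ‖x.1‖ ^ 2 * u x * v x - 2 * u x * v x) =
      ∑ i : Fin 2, ((weakDeriv (eY i) u x * weakDeriv (eY i) v x + (x.1 i * u x) * (x.1 i * v x))
        - u x * v x) := fun x => by
    rw [norm_fst_sq]; simp only [Fin.sum_univ_two]; ring
  simp only [e]
  have i4 : ∀ i, Integrable (fun x : X => (weakDeriv (eY i) u x * weakDeriv (eY i) v x
      + (x.1 i * u x) * (x.1 i * v x)) - u x * v x) volume := fun i => ((i1 i).add (i2 i)).sub i3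
  rw [integral_finsetSum _ fun i _ => i4 i]
  refine Finset.sum_congr rfl fun i _ => ?_
  rw [hu.integral_ann_mul_ann hv i, ← integral_add (i1 i) (i2 i)]
  exact integral_sub ((i1 i).add (i2 i)) i3

theorem MemSigma.sigmaYSq_eq {u : X → ℝ} (hu : MemSigma u) : sigmaYSq u = ∑ i, mass (ann i u) := by
  have h := hu.integral_formY hu
  simp only [mass_eq_integral_sq, sq]
  rw [← h, sigmaYSq]
  congr 1
  ext x
  simp only [gradYSq, Real.norm_eq_abs, sq_abs]
  simp only [sq, mul_assoc]

/-- Recovers the full transverse gradient from σ and the mass; combined with the spectral gap it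
bounds ∇_y of the orthogonal part by σ alone. -/
theorem MemSigma.sum_mass_eq {u : X → ℝ} (hu : MemSigma u) :
    (∑ i, mass (weakDeriv (eY i) u)) + mass (fun x : X => ‖x.1‖ * u x) = sigmaYSq u + 2 * mass u := by
  have e : mass (fun x : X => ‖x.1‖ * u x) = ∑ i, mass (fun x : X => x.1 i * u x) := by
    simp only [mass_eq_integral_sq]
    rw [← integral_finsetSum _ fun i _ => integrable_sq_of_memLp (hu.memLp_coord i)]
    congr 1
    ext x
    simp only [mul_pow, norm_fst_sq, Finset.sum_mul]
  rw [hu.sigmaYSq_eq, e, ← Finset.sum_add_distrib]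
  have : ∀ i, mass (ann i u) = mass (weakDeriv (eY i) u) + mass (fun x : X => x.1 i * u x) - mass u :=
    fun i => by
      have := hu.integral_ann_mul_ann hu i
      simpa only [mass_eq_integral_sq, sq] using this
  simp only [this, Fin.sum_univ_two]
  ring

end IntegrationByParts

/-! ### Anisotropic Gagliardo–Nirenberg inequality -/

section GagliardoNirenberg

theorem decomp_dir (x : X) : x = (∑ i : Fin 2, x.1 i • eY i) + x.2 • eZ := by
  refine Prod.ext ?_ ?_
  · ext j
    simp only [eY, eZ, Prod.fst_add, Prod.smul_fst, smul_zero, add_zero,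
      Fin.sum_univ_two]
    fin_cases j <;> simp
  · simp [eY, eZ]

theorem opNorm_le_dir (l : X →L[ℝ] ℝ) : ‖l‖ ≤ (∑ i : Fin 2, |l (eY i)|) + |l eZ| := by
  refine l.opNorm_le_bound (by positivity) fun x => ?_
  conv_lhs => rw [decomp_dir x]
  simp only [map_add, map_smul, smul_eq_mul, Fin.sum_univ_two, Real.norm_eq_abs]
  have h0 := (abs_coord_le x 0).trans (norm_fst_le x)
  have h1 := (abs_coord_le x 1).trans (norm_fst_le x)
  have h2 : |x.2| ≤ ‖x‖ := norm_snd_le x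
  calc _ ≤ |x.1 0 * l (eY 0)| + |x.1 1 * l (eY 1)| + |x.2 * l eZ| := abs_add_three _ _ _
    _ ≤ ‖x‖ * |l (eY 0)| + ‖x‖ * |l (eY 1)| + ‖x‖ * |l eZ| := by
        simp only [abs_mul]; gcongr
    _ = _ := by ring

theorem opNorm_sq_le_dir (l : X →L[ℝ] ℝ) :
    ‖l‖ ^ 2 ≤ 3 * ((∑ i : Fin 2, l (eY i) ^ 2) + l eZ ^ 2) := by
  have h := opNorm_le_dir l
  simp only [Fin.sum_univ_two] at h ⊢
  have h2 := pow_le_pow_left₀ (norm_nonneg l) h 2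
  have e : ∀ a : ℝ, a ^ 2 = |a| ^ 2 := fun a => (sq_abs a).symm
  rw [e (l (eY 0)), e (l (eY 1)), e (l eZ)]
  nlinarith [sq_nonneg (|l (eY 0)| - |l (eY 1)|), sq_nonneg (|l (eY 0)| - |l eZ|),
    sq_nonneg (|l (eY 1)| - |l eZ|)]

/-- The Sobolev embedding of exponent 6 in dimension three, with the operator norm of the derivative
replaced by the three coordinate derivatives (factor 3, cubed to 27). -/
theorem exists_sobolev_test : ∃ C : ℝ, 0 ≤ C ∧ ∀ u : X → ℝ, IsTest u →
    ∫ x, u x ^ 6 ≤ C * ((∑ i, mass (fun x => fderiv ℝ u x (eY i)))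
      + mass (fun x => fderiv ℝ u x eZ)) ^ 3 := by
  have hfr : Module.finrank ℝ X = 3 := by simp [X, Y]
  let K := SNormLESNormFDerivOfEqConst (E := X) ℝ volume 2
  refine ⟨(K : ℝ) ^ 6 * 27, by positivity, fun u hu => ?_⟩
  have h := eLpNorm_le_eLpNorm_fderiv_of_eq (μ := (volume : Measure X)) (p := 2) (p' := 6)
    (hu.1.of_le (by simp)) hu.2 (by norm_num) (by rw [hfr]; norm_num) (by rw [hfr]; norm_num)
  have hcd : Continuous (fderiv ℝ u) := hu.1.continuous_fderiv (by simp)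
  have hm : MemLp (fderiv ℝ u) 2 volume :=
    hcd.memLp_of_hasCompactSupport (hu.2.fderiv (𝕜 := ℝ))
  have e6 : eLpNorm u ((6 : NNReal) : ℝ≥0∞) volume = ENNReal.ofReal ((∫ x, u x ^ 6) ^ (1 / 6 : ℝ)) := by
    rw [(hu.memLp _).eLpNorm_eq_integral_rpow_norm (by norm_num) (by norm_num)]
    norm_num
    congr 2
    congr 1
    ext x
    exact Even.pow_abs (by decide) _
  have e2 : eLpNorm (fderiv ℝ u) ((2 : NNReal) : ℝ≥0∞) volume
      = ENNReal.ofReal ((∫ x, ‖fderiv ℝ u x‖ ^ 2) ^ (1 / 2 : ℝ)) := by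
    rw [MemLp.eLpNorm_eq_integral_rpow_norm (by norm_num) (by norm_num) (by exact_mod_cast hm)]
    norm_num
  rw [e6, e2] at h
  have hK : (SNormLESNormFDerivOfEqConst (E := X) ℝ volume ((2 : NNReal) : ℝ) : ℝ≥0∞) = ENNReal.ofReal K := by
    simp [K]
  rw [hK, ← ENNReal.ofReal_mul (by positivity), ENNReal.ofReal_le_ofReal_iff (by positivity)] at h
  have i6 : 0 ≤ ∫ x, u x ^ 6 := integral_nonneg fun x => by positivity
  have i2 : 0 ≤ ∫ x, ‖fderiv ℝ u x‖ ^ 2 := integral_nonneg fun x => by positivity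
  have h6 := pow_le_pow_left₀ (by positivity) h 6
  rw [mul_pow, ← Real.rpow_natCast, ← Real.rpow_mul i6, ← Real.rpow_natCast (_ ^ _) 6,
    ← Real.rpow_mul i2] at h6
  norm_num at h6
  have hb : ∫ x, ‖fderiv ℝ u x‖ ^ 2 ≤ 3 * ((∑ i, mass (fun x => fderiv ℝ u x (eY i)))
      + mass (fun x => fderiv ℝ u x eZ)) := by
    have ii : ∀ v : X, Integrable (fun x => fderiv ℝ u x v ^ 2) volume := fun v =>
      integrable_sq_of_memLp ((hu.fderiv_apply v).memLp 2)
    simp only [mass_eq_integral_sq]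
    rw [← integral_finsetSum _ fun i _ => ii (eY i),
      ← integral_add (integrable_finsetSum _ fun i _ => ii (eY i)) (ii eZ), ← integral_const_mul]
    refine integral_mono (by simpa using hm.integrable_norm_pow (by norm_num)) ?_
      fun x => opNorm_sq_le_dir _
    exact ((integrable_finsetSum _ fun i _ => ii (eY i)).add (ii eZ)).const_mul 3
  calc _ ≤ (K : ℝ) ^ 6 * (∫ x, ‖fderiv ℝ u x‖ ^ 2) ^ 3 := h6
    _ ≤ (K : ℝ) ^ 6 * (3 * ((∑ i, mass (fun x => fderiv ℝ u x (eY i)))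
      + mass (fun x => fderiv ℝ u x eZ))) ^ 3 := by gcongr
    _ = _ := by ring

/-- Dilation in the `z` variable. -/
def dilZ (c : ℝ) : X →L[ℝ] X :=
  (ContinuousLinearMap.fst ℝ Y ℝ).prod (c • ContinuousLinearMap.snd ℝ Y ℝ)

theorem dilZ_apply (c : ℝ) (x : X) : dilZ c x = (x.1, c * x.2) := by simp [dilZ]

theorem hasCompactSupport_comp_dilZ {f : X → ℝ} (hf : HasCompactSupport f) {c : ℝ} (hc : 0 < c) :
    HasCompactSupport (fun x => f (dilZ c x)) := by
  let e : X ≃ₜ X := (Homeomorph.refl Y).prodCongr (Homeomorph.mulLeft₀ c hc.ne')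
  have : (fun x => f (dilZ c x)) = f ∘ e := by
    ext x; simp [dilZ, e, Homeomorph.prodCongr]; rfl
  rw [this]
  exact hf.comp_homeomorph e

theorem integral_comp_dilZ {f : X → ℝ} (hf : Continuous f) (hs : HasCompactSupport f)
    {c : ℝ} (hc : 0 < c) : ∫ x, f (dilZ c x) = c⁻¹ * ∫ x, f x := by
  have i1 : Integrable f ((volume : Measure Y).prod (volume : Measure ℝ)) :=
    hf.integrable_of_hasCompactSupport hs
  have i2 : Integrable (fun x => f (dilZ c x)) ((volume : Measure Y).prod (volume : Measure ℝ)) :=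
    (hf.comp (dilZ c).continuous).integrable_of_hasCompactSupport (hasCompactSupport_comp_dilZ hs hc)
  change ∫ x, f (dilZ c x) ∂((volume : Measure Y).prod (volume : Measure ℝ))
    = c⁻¹ * ∫ x, f x ∂((volume : Measure Y).prod (volume : Measure ℝ))
  rw [integral_prod _ i1, integral_prod _ i2, ← integral_const_mul]
  congr 1
  ext y
  simp only [dilZ_apply]
  rw [Measure.integral_comp_mul_left (fun z => f (y, z)) c, abs_of_pos (inv_pos.2 hc), smul_eq_mul]

theorem IsTest.pow {E : Type*} [NormedAddCommGroup E] [NormedSpace ℝ E] {φ : E → ℝ}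
    (h : IsTest φ) {n : ℕ} (hn : n ≠ 0) : IsTest (fun x => φ x ^ n) :=
  ⟨h.1.pow n, h.2.comp_left (g := fun t : ℝ => t ^ n) (zero_pow hn)⟩

/-- The best dilation is c² = A/B. Adding δ to both A and B covers the cases where one of them
vanishes; then δ → 0. -/
theorem le_of_forall_scaling {I A B C : ℝ} (hA : 0 ≤ A) (hB : 0 ≤ B) (hC : 0 ≤ C)
    (h : ∀ c : ℝ, 0 < c → I ≤ C * (A + c ^ 2 * B) ^ 3 / c ^ 2) : I ≤ 8 * C * A ^ 2 * B := by
  have hδ : ∀ δ : ℝ, 0 < δ → I ≤ 8 * C * (A + δ) ^ 2 * (B + δ) := by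
    intro δ hδ
    have ha : 0 < A + δ := by linarith
    have hb : 0 < B + δ := by linarith
    have hc : 0 < Real.sqrt ((A + δ) / (B + δ)) := Real.sqrt_pos.2 (div_pos ha hb)
    refine (h _ hc).trans ?_
    rw [Real.sq_sqrt (div_pos ha hb).le]
    have h1 : A + (A + δ) / (B + δ) * B ≤ 2 * (A + δ) := by
      have : (A + δ) / (B + δ) * B ≤ A + δ := by
        rw [div_mul_eq_mul_div, div_le_iff₀ hb]
        gcongr
        linarith
      linarith
    have h2 : 0 ≤ A + (A + δ) / (B + δ) * B := by positivity
    rw [div_le_iff₀ (div_pos ha hb)]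
    calc C * (A + (A + δ) / (B + δ) * B) ^ 3 ≤ C * (2 * (A + δ)) ^ 3 := by gcongr
      _ = _ := by field_simp; ring
  have hl : Tendsto (fun δ : ℝ => 8 * C * (A + δ) ^ 2 * (B + δ)) (𝓝[>] 0) (𝓝 (8 * C * A ^ 2 * B)) := by
    have : Continuous (fun δ : ℝ => 8 * C * (A + δ) ^ 2 * (B + δ)) := by fun_prop
    have := (this.tendsto 0).mono_left (nhdsWithin_le_nhds (s := Set.Ioi 0))
    simpa using this
  exact ge_of_tendsto hl (eventually_mem_nhdsWithin.mono hδ)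

theorem IsTest.comp_dilZ {u : X → ℝ} (hu : IsTest u) {c : ℝ} (hc : 0 < c) :
    IsTest (fun x => u (dilZ c x)) :=
  ⟨hu.1.comp (dilZ c).contDiff, hasCompactSupport_comp_dilZ hu.2 hc⟩

theorem fderiv_comp_dilZ {u : X → ℝ} (hu : IsTest u) (c : ℝ) (x v : X) :
    fderiv ℝ (fun x => u (dilZ c x)) x v = fderiv ℝ u (dilZ c x) (dilZ c v) := by
  have := (hu.differentiable (dilZ c x)).hasFDerivAt.comp x (dilZ c).hasFDerivAt
  rw [show (fun x => u (dilZ c x)) = u ∘ dilZ c from rfl, this.fderiv]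
  rfl

theorem IsTest.integral_comp_dilZ {u : X → ℝ} (hu : IsTest u) {c : ℝ} (hc : 0 < c) {n : ℕ}
    (hn : n ≠ 0) : ∫ x, u (dilZ c x) ^ n = c⁻¹ * ∫ x, u x ^ n :=
  DimRed.integral_comp_dilZ (hu.pow hn).continuous (hu.pow hn).2 hc

/-- Apply the isotropic inequality to u(y, cz). The integral of u⁶ and the y-derivative masses scale
like 1/c, the z-derivative mass like c; optimizing in c separates the two kinds of derivatives. -/
theorem exists_sobolev_anisotropic_test : ∃ C : ℝ, 0 ≤ C ∧ ∀ u : X → ℝ, IsTest u →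
    ∫ x, u x ^ 6 ≤ C * (∑ i, mass (fun x => fderiv ℝ u x (eY i))) ^ 2
      * mass (fun x => fderiv ℝ u x eZ) := by
  obtain ⟨C, hC, H⟩ := exists_sobolev_test
  refine ⟨8 * C, by positivity, fun u hu => le_of_forall_scaling
    (Finset.sum_nonneg fun i _ => mass_nonneg _) (mass_nonneg _) hC fun c hc => ?_⟩
  have hY : ∀ i, mass (fun x => fderiv ℝ (fun x => u (dilZ c x)) x (eY i))
      = c⁻¹ * mass (fun x => fderiv ℝ u x (eY i)) := fun i => by
    have e : dilZ c (eY i) = eY i := by simp [dilZ_apply, eY]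
    simp only [mass_eq_integral_sq, fderiv_comp_dilZ hu, e]
    exact (hu.fderiv_apply (eY i)).integral_comp_dilZ hc two_ne_zero
  have hZ : mass (fun x => fderiv ℝ (fun x => u (dilZ c x)) x eZ)
      = c ^ 2 * (c⁻¹ * mass (fun x => fderiv ℝ u x eZ)) := by
    have e : dilZ c eZ = c • eZ := by simp [dilZ_apply, eZ]
    simp only [mass_eq_integral_sq, fderiv_comp_dilZ hu, e, map_smul, smul_eq_mul, mul_pow]
    rw [integral_const_mul, (hu.fderiv_apply eZ).integral_comp_dilZ hc two_ne_zero]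
  have h := H _ (hu.comp_dilZ hc)
  rw [hu.integral_comp_dilZ hc (by norm_num), hZ] at h
  simp only [hY, ← Finset.mul_sum] at h
  generalize (∑ i, mass (fun x => fderiv ℝ u x (eY i))) = A at h ⊢
  generalize mass (fun x => fderiv ℝ u x eZ) = B at h ⊢
  generalize ∫ x, u x ^ 6 = I at h ⊢
  have e : C * (c⁻¹ * A + c ^ 2 * (c⁻¹ * B)) ^ 3 = C * (A + c ^ 2 * B) ^ 3 / c ^ 2 * c⁻¹ := by
    field_simp
  rw [e, mul_comm c⁻¹] at h
  exact le_of_mul_le_mul_right h (inv_pos.2 hc)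

/-- Cauchy–Schwarz on u⁴ = u · u³ and the anisotropic bound for ∫u⁶. The result is linear in the
transverse Dirichlet energy. -/
theorem exists_gagliardo_test : ∃ C : ℝ, 0 ≤ C ∧ ∀ u : X → ℝ, IsTest u →
    ∫ x, u x ^ 4 ≤ C * l2Norm u * (∑ i, mass (fun x => fderiv ℝ u x (eY i)))
      * l2Norm (fun x => fderiv ℝ u x eZ) := by
  obtain ⟨C, hC, H⟩ := exists_sobolev_anisotropic_test
  refine ⟨Real.sqrt C, Real.sqrt_nonneg C, fun u hu => ?_⟩
  have h1 := (le_abs_self _).trans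
    (abs_integral_mul_le (hu.memLp 2) ((hu.pow (n := 3) (by norm_num)).memLp 2))
  have h6 := H u hu
  have hA : 0 ≤ ∑ i, mass (fun x => fderiv ℝ u x (eY i)) :=
    Finset.sum_nonneg fun i _ => mass_nonneg _
  have hn := l2Norm_nonneg u
  have e : ∫ x, u x * u x ^ 3 = ∫ x, u x ^ 4 := by congr 1; ext x; ring
  have e3 : l2Norm (fun x => u x ^ 3) = Real.sqrt (∫ x, u x ^ 6) := by
    rw [l2Norm, mass_eq_integral_sq]
    congr 2
    ext x
    ring
  have eZ : l2Norm (fun x => fderiv ℝ u x eZ) = Real.sqrt (mass (fun x => fderiv ℝ u x eZ)) := rfl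
  rw [e, e3] at h1
  rw [eZ]
  generalize (∑ i, mass (fun x => fderiv ℝ u x (eY i))) = A at *
  generalize mass (fun x => fderiv ℝ u x DimRed.eZ) = B at *
  generalize ∫ x, u x ^ 6 = I at *
  have h2 : Real.sqrt I ≤ Real.sqrt C * A * Real.sqrt B := by
    refine (Real.sqrt_le_sqrt h6).trans (le_of_eq ?_)
    rw [Real.sqrt_mul (by positivity), Real.sqrt_mul hC, Real.sqrt_sq hA]
  calc _ ≤ l2Norm u * (Real.sqrt C * A * Real.sqrt B) := h1.trans (by gcongr)
    _ = _ := by ring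

/-- An anisotropic Gagliardo–Nirenberg inequality. -/
theorem exists_gagliardo : ∃ C : ℝ, 0 ≤ C ∧ ∀ u : X → ℝ, MemSigma u →
    MemLp u 4 volume ∧ ∫ x, u x ^ 4 ≤ C * l2Norm u * (∑ i, mass (weakDeriv (eY i) u))
      * l2Norm (weakDeriv eZ u) := by
  obtain ⟨C, hC, H⟩ := exists_gagliardo_test
  refine ⟨C, hC, fun u hu => ?_⟩
  obtain ⟨φ, hφ, hc⟩ := hu.exists_test_seq
  set b := C * l2Norm u * (∑ i, mass (weakDeriv (eY i) u)) * l2Norm (weakDeriv eZ u) with hb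
  have t0 := tendsto_l2Norm_of_tendsto_l2 hu.memLp (fun n => (hφ n).memLp 2) hc.1
  have tY := fun i => tendsto_l2Norm_of_tendsto_l2 (hu.1.memLp_weakDeriv (eY i))
    (fun n => ((hφ n).fderiv_apply (eY i)).memLp 2) (hc.2.1 i)
  have tZ := tendsto_l2Norm_of_tendsto_l2 (hu.1.memLp_weakDeriv eZ)
    (fun n => ((hφ n).fderiv_apply eZ).memLp 2) hc.2.2.1
  have hlim : Tendsto (fun n => C * l2Norm (φ n) * (∑ i, mass (fun x => fderiv ℝ (φ n) x (eY i)))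
      * l2Norm (fun x => fderiv ℝ (φ n) x eZ)) atTop (𝓝 b) := by
    refine ((t0.const_mul C).mul (tendsto_finsetSum _ fun i _ => ?_)).mul tZ
    simpa only [l2Norm_sq] using (tY i).pow 2
  have hmeas : TendstoInMeasure volume φ atTop u := by
    refine tendstoInMeasure_of_tendsto_eLpNorm (p := 2) (by norm_num)
      (fun n => (hφ n).continuous.aestronglyMeasurable) hu.memLp.1 ?_
    have h0 := ENNReal.tendsto_ofReal hc.1
    rw [ENNReal.ofReal_zero] at h0
    refine h0.congr fun n => ?_
    exact (eLpNorm_two_eq (u := fun x => φ n x - u x) (((hφ n).memLp 2).sub hu.memLp)).symm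
  obtain ⟨ns, hns, hae⟩ := hmeas.exists_seq_tendsto_ae
  have h4 : ∀ n, IsTest (fun x => φ n x ^ 4) := fun n => (hφ n).pow (by norm_num)
  have hkey : ∀ n, ∫⁻ x, ENNReal.ofReal (φ n x ^ 4) = ENNReal.ofReal (∫ x, φ n x ^ 4) := fun n =>
    (ofReal_integral_eq_lintegral_ofReal
      ((h4 n).continuous.integrable_of_hasCompactSupport (h4 n).2)
      (.of_forall fun x => by positivity)).symm
  -- L² convergence gives a subsequence converging almost everywhere; Fatou then yields both the L⁴
  -- membership and the bound, since the right-hand sides converge.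
  have hfat : ∫⁻ x, ENNReal.ofReal (u x ^ 4) ≤ ENNReal.ofReal b := by
    calc ∫⁻ x, ENNReal.ofReal (u x ^ 4)
        = ∫⁻ x, liminf (fun n => ENNReal.ofReal (φ (ns n) x ^ 4)) atTop := by
          refine lintegral_congr_ae ?_
          filter_upwards [hae] with x hx
          exact ((ENNReal.tendsto_ofReal (hx.pow 4)).liminf_eq).symm
      _ ≤ liminf (fun n => ∫⁻ x, ENNReal.ofReal (φ (ns n) x ^ 4)) atTop :=
          lintegral_liminf_le fun n => ((h4 (ns n)).continuous.measurable).ennreal_ofReal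
      _ ≤ liminf (fun n => ENNReal.ofReal (C * l2Norm (φ (ns n))
            * (∑ i, mass (fun x => fderiv ℝ (φ (ns n)) x (eY i)))
            * l2Norm (fun x => fderiv ℝ (φ (ns n)) x eZ))) atTop := by
          refine liminf_le_liminf (.of_forall fun n => ?_)
          exact (hkey (ns n)).trans_le (ENNReal.ofReal_le_ofReal (H _ (hφ (ns n))))
      _ = ENNReal.ofReal b := (ENNReal.tendsto_ofReal (hlim.comp hns.tendsto_atTop)).liminf_eq
  have hb0 : 0 ≤ b := by
    have := Finset.sum_nonneg fun (i : Fin 2) (_ : i ∈ Finset.univ) => mass_nonneg (weakDeriv (eY i) u)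
    have := l2Norm_nonneg u
    have := l2Norm_nonneg (weakDeriv eZ u)
    positivity
  have hm4 : AEStronglyMeasurable (fun x => u x ^ 4) volume := hu.memLp.1.pow 4
  have hint : Integrable (fun x => u x ^ 4) volume := by
    refine ⟨hm4, ?_⟩
    rw [hasFiniteIntegral_iff_ofReal (.of_forall fun x => by positivity)]
    exact hfat.trans_lt ENNReal.ofReal_lt_top
  refine ⟨?_, ?_⟩
  · rw [← integrable_norm_rpow_iff hu.memLp.1 (by norm_num) (by norm_num)]
    refine hint.congr (.of_forall fun x => ?_)
    norm_num
    exact (Even.pow_abs (by decide) _).symm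
  · rw [integral_eq_lintegral_of_nonneg_ae (.of_forall fun x => by positivity) hm4]
    exact ENNReal.toReal_le_of_le_ofReal hb0 hfat

end GagliardoNirenberg

/-! ### Fibrewise projection onto a unit vector -/

section Fibre

variable {A B : Type*} [MeasureSpace A] [MeasureSpace B] [SigmaFinite (volume : Measure A)]
  [SigmaFinite (volume : Measure B)]

/-- The product function `w ⊗ b`. -/
def gtens (b : A → ℝ) (w : B → ℝ) (x : A × B) : ℝ := w x.2 * b x.1

/-- The fibrewise scalar product with `b`. -/
def gpar (b : A → ℝ) (u : A × B → ℝ) (z : B) : ℝ := ∫ a, u (a, z) * b a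

/-- The fibrewise component orthogonal to `b`. -/
def gproj (b : A → ℝ) (u : A × B → ℝ) (x : A × B) : ℝ := u x - gtens b (gpar b u) x

theorem integrable_gtens {b : A → ℝ} {w : B → ℝ} (hb : Integrable b volume)
    (hw : Integrable w volume) : Integrable (gtens b w) volume := by
  have := hb.mul_prod hw
  exact this.congr (.of_forall fun x => mul_comm _ _)

theorem integral_gtens (b : A → ℝ) (w : B → ℝ) :
    ∫ x, gtens b w x = (∫ z, w z) * ∫ a, b a := by
  rw [mul_comm, ← integral_prod_mul]
  exact integral_congr_ae (.of_forall fun x => mul_comm _ _)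

theorem aestronglyMeasurable_gtens {b : A → ℝ} {w : B → ℝ} (hb : AEStronglyMeasurable b volume)
    (hw : AEStronglyMeasurable w volume) : AEStronglyMeasurable (gtens b w) volume :=
  AEStronglyMeasurable.mul (μ := (volume : Measure A).prod (volume : Measure B)) hw.comp_snd hb.comp_fst

theorem gtens_pow (b : A → ℝ) (w : B → ℝ) (n : ℕ) (x : A × B) :
    gtens b w x ^ n = gtens (fun a => b a ^ n) (fun z => w z ^ n) x := mul_pow _ _ _

theorem memLp_gtens {b : A → ℝ} {w : B → ℝ} (hb : MemLp b 2 volume) (hw : MemLp w 2 volume) :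
    MemLp (gtens b w) 2 volume := by
  rw [memLp_two_iff_integrable_sq (aestronglyMeasurable_gtens hb.1 hw.1)]
  simp only [gtens_pow]
  exact integrable_gtens hb.integrable_sq hw.integrable_sq

theorem mass_gtens (b : A → ℝ) (w : B → ℝ) : mass (gtens b w) = mass w * mass b := by
  simp only [mass_eq_integral_sq, gtens_pow, integral_gtens]

theorem memLp_slice {u : A × B → ℝ} (hu : MemLp u 2 volume) :
    ∀ᵐ z : B, MemLp (fun a => u (a, z)) 2 volume := by
  have h1 : ∀ᵐ z : B, AEStronglyMeasurable (fun a => u (a, z)) volume :=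
    (AEStronglyMeasurable.prod_swap (μ := (volume : Measure B)) (ν := (volume : Measure A)) hu.1).prodMk_left
  have h2 := Integrable.prod_left_ae (μ := (volume : Measure A)) (ν := (volume : Measure B)) hu.integrable_sq
  filter_upwards [h1, h2] with z hz1 hz2
  exact (memLp_two_iff_integrable_sq hz1).2 hz2

theorem integrable_mass_slice {u : A × B → ℝ} (hu : MemLp u 2 volume) :
    Integrable (fun z : B => mass (fun a => u (a, z))) volume := by
  simp only [mass_eq_integral_sq]
  exact Integrable.integral_prod_right (μ := (volume : Measure A)) (ν := (volume : Measure B)) hu.integrable_sq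

theorem integral_mass_slice {u : A × B → ℝ} (hu : MemLp u 2 volume) :
    ∫ z : B, mass (fun a => u (a, z)) = mass u := by
  simp only [mass_eq_integral_sq]
  exact (integral_prod_symm _ hu.integrable_sq).symm

theorem memLp_gpar {b : A → ℝ} {u : A × B → ℝ} (hb : MemLp b 2 volume) (hu : MemLp u 2 volume) :
    MemLp (gpar b u) 2 volume := by
  have hm : AEStronglyMeasurable (gpar b u) volume := by
    have h1 : AEStronglyMeasurable (fun x : A × B => u x * b x.1)
      ((volume : Measure A).prod (volume : Measure B)) := hu.1.mul hb.1.comp_fst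
    exact h1.prod_swap.integral_prod_right'
  rw [memLp_two_iff_integrable_sq hm]
  refine ((integrable_mass_slice hu).mul_const (mass b)).mono' (hm.pow 2) ?_
  filter_upwards [memLp_slice hu] with z hz
  rw [Real.norm_of_nonneg (sq_nonneg _), gpar, ← sq_abs]
  refine (pow_le_pow_left₀ (abs_nonneg _) (abs_integral_mul_le hz hb) 2).trans (le_of_eq ?_)
  rw [mul_pow, l2Norm_sq, l2Norm_sq]

/-- Fubini: the fibrewise scalar product is the adjoint of tensoring with b. -/
theorem integral_mul_gtens {b : A → ℝ} {w : B → ℝ} {u : A × B → ℝ} (hb : MemLp b 2 volume)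
    (hw : MemLp w 2 volume) (hu : MemLp u 2 volume) :
    ∫ x, u x * gtens b w x = ∫ z, gpar b u z * w z := by
  have hi := integrable_mul_of_memLp hu (memLp_gtens hb hw)
  refine (integral_prod_symm (μ := (volume : Measure A)) (ν := (volume : Measure B)) _ hi).trans ?_
  congr 1
  ext z
  rw [gpar, ← integral_mul_const]
  congr 1
  ext a
  simp only [gtens]
  ring

theorem gpar_gtens {b : A → ℝ} (w : B → ℝ) (h1 : mass b = 1) : gpar b (gtens b w) = w := by
  ext z
  simp only [gpar, gtens, mul_assoc]
  rw [integral_const_mul]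
  have : ∫ a, b a * b a = 1 := by rw [← h1, mass_eq_integral_sq]; simp only [sq]
  rw [this, mul_one]

theorem gpar_sub_ae {b : A → ℝ} {u v : A × B → ℝ} (hb : MemLp b 2 volume) (hu : MemLp u 2 volume)
    (hv : MemLp v 2 volume) :
    gpar b (fun x => u x - v x) =ᵐ[volume] fun z => gpar b u z - gpar b v z := by
  filter_upwards [memLp_slice hu, memLp_slice hv] with z h1 h2
  simp only [gpar, sub_mul]
  exact integral_sub (integrable_mul_of_memLp h1 hb) (integrable_mul_of_memLp h2 hb)

theorem memLp_gproj {b : A → ℝ} {u : A × B → ℝ} (hb : MemLp b 2 volume) (hu : MemLp u 2 volume) :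
    MemLp (gproj b u) 2 volume := hu.sub (memLp_gtens hb (memLp_gpar hb hu))

theorem integral_gproj_mul_gtens {b : A → ℝ} {w : B → ℝ} {u : A × B → ℝ} (hb : MemLp b 2 volume)
    (h1 : mass b = 1) (hw : MemLp w 2 volume) (hu : MemLp u 2 volume) :
    ∫ x, gproj b u x * gtens b w x = 0 := by
  have hg := memLp_gtens hb (memLp_gpar hb hu)
  simp only [gproj, sub_mul]
  rw [integral_sub (integrable_mul_of_memLp hu (memLp_gtens hb hw))
    (integrable_mul_of_memLp hg (memLp_gtens hb hw)), integral_mul_gtens hb hw hu,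
    integral_mul_gtens hb hw hg, gpar_gtens _ h1, sub_self]

/-- Pythagoras for the two orthogonal components. -/
theorem mass_gproj_add {b : A → ℝ} {u : A × B → ℝ} (hb : MemLp b 2 volume)
    (h1 : mass b = 1) (hu : MemLp u 2 volume) : mass (gpar b u) + mass (gproj b u) = mass u := by
  have hg := memLp_gtens hb (memLp_gpar hb hu)
  have h0 := integral_gproj_mul_gtens hb h1 (memLp_gpar hb hu) hu
  have e : ∀ x, u x ^ 2 = (gtens b (gpar b u) x ^ 2 + gproj b u x ^ 2)
      + 2 * (gproj b u x * gtens b (gpar b u) x) := fun x => by simp only [gproj]; ring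
  have i1 := integrable_sq_of_memLp hg
  have i2 := integrable_sq_of_memLp (memLp_gproj hb hu)
  have i3 := (integrable_mul_of_memLp (memLp_gproj hb hu) hg).const_mul 2
  have e1 := integral_add (i1.add i2) i3
  have e2 := integral_add i1 i2
  simp only [Pi.add_apply] at e1
  rw [mass_eq_integral_sq u]
  simp only [e]
  rw [e1, e2, integral_const_mul, h0, ← mass_eq_integral_sq, ← mass_eq_integral_sq, mass_gtens, h1]
  ring

theorem mass_gpar_le {b : A → ℝ} {u : A × B → ℝ} (hb : MemLp b 2 volume)
    (h1 : mass b = 1) (hu : MemLp u 2 volume) : mass (gpar b u) ≤ mass u := by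
  have := mass_gproj_add hb h1 hu
  linarith [mass_nonneg (gproj b u)]

theorem mass_gproj_le {b : A → ℝ} {u : A × B → ℝ} (hb : MemLp b 2 volume)
    (h1 : mass b = 1) (hu : MemLp u 2 volume) : mass (gproj b u) ≤ mass u := by
  have := mass_gproj_add hb h1 hu
  linarith [mass_nonneg (gpar b u)]

theorem l2Norm_gproj_le {b : A → ℝ} {u : A × B → ℝ} (hb : MemLp b 2 volume)
    (h1 : mass b = 1) (hu : MemLp u 2 volume) : l2Norm (gproj b u) ≤ l2Norm u :=
  Real.sqrt_le_sqrt (mass_gproj_le hb h1 hu)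

theorem gproj_sub_ae {b : A → ℝ} {u v : A × B → ℝ} (hb : MemLp b 2 volume) (hu : MemLp u 2 volume)
    (hv : MemLp v 2 volume) :
    gproj b (fun x => u x - v x) =ᵐ[volume] fun x => gproj b u x - gproj b v x := by
  have h := gpar_sub_ae hb hu hv
  have h' : ∀ᵐ p ∂((volume : Measure A).prod (volume : Measure B)),
      gpar b (fun x => u x - v x) p.2 = gpar b u p.2 - gpar b v p.2 :=
    (Measure.quasiMeasurePreserving_snd (μ := (volume : Measure A)) (ν := (volume : Measure B))).ae h
  filter_upwards [h'] with x hx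
  simp only [gproj, gtens, hx]
  ring

/-- Among the multiples of a unit vector `b`, the projection of `k` is closest to `k`. -/
theorem mass_sub_proj_le {b k : A → ℝ} (hb : MemLp b 2 volume) (h1 : mass b = 1)
    (hk : MemLp k 2 volume) (c : ℝ) :
    mass (fun a => k a - (∫ a, k a * b a) * b a) ≤ mass (fun a => k a - c * b a) := by
  have key : ∀ c : ℝ, mass (fun a => k a - c * b a) = mass k - 2 * c * (∫ a, k a * b a) + c ^ 2 := by
    intro c
    have e : ∀ a, (k a - c * b a) ^ 2 = (k a ^ 2 - 2 * c * (k a * b a)) + c ^ 2 * b a ^ 2 :=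
      fun a => by ring
    have i1 := integrable_sq_of_memLp hk
    have i2 := (integrable_mul_of_memLp hk hb).const_mul (2 * c)
    have i3 := (integrable_sq_of_memLp hb).const_mul (c ^ 2)
    have e1 := integral_add (i1.sub i2) i3
    have e2 := integral_sub i1 i2
    simp only [Pi.sub_apply] at e1
    rw [mass_eq_integral_sq]
    simp only [e]
    rw [e1, e2, integral_const_mul, integral_const_mul, ← mass_eq_integral_sq, ← mass_eq_integral_sq,
      h1]
    ring
  rw [key, key]
  nlinarith [sq_nonneg (c - ∫ a, k a * b a)]

end Fibre

/-! ### The transverse Gaussian -/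

section Gaussian

theorem Phi0_pos (y : Y) : 0 < Phi0 y := by unfold Phi0; positivity

theorem Phi0_le_one (y : Y) : Phi0 y ≤ 1 := by
  unfold Phi0
  have h1 : Real.exp (-‖y‖ ^ 2 / 2) ≤ 1 := Real.exp_le_one_iff.2 (by nlinarith [sq_nonneg ‖y‖])
  have h2 : 1 / Real.sqrt Real.pi ≤ 1 := by
    rw [div_le_one (by positivity)]
    exact Real.one_le_sqrt.2 (by linarith [Real.pi_gt_three])
  exact mul_le_one₀ h2 (Real.exp_pos _).le h1

theorem contDiff_Phi0 : ContDiff ℝ ((⊤ : ℕ∞) : WithTop ℕ∞) Phi0 := by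
  unfold Phi0
  have : ContDiff ℝ ((⊤ : ℕ∞) : WithTop ℕ∞) (fun y : Y => ‖y‖ ^ 2) := contDiff_norm_sq ℝ
  exact contDiff_const.mul ((this.neg.div_const 2).exp)

theorem continuous_Phi0 : Continuous Phi0 := contDiff_Phi0.continuous

theorem hasFDerivAt_Phi0 (y : Y) (v : Y) : fderiv ℝ Phi0 y v = - inner ℝ y v * Phi0 y := by
  have h : HasFDerivAt (fun y : Y => ‖y‖ ^ 2) (2 • innerSL ℝ y) y := (hasStrictFDerivAt_norm_sq y).hasFDerivAt
  have h2 : HasFDerivAt (fun y : Y => 1 / Real.sqrt Real.pi * Real.exp (-‖y‖ ^ 2 / 2)) _ y :=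
    ((h.neg.mul_const (2⁻¹ : ℝ)).exp).const_mul (1 / Real.sqrt Real.pi)
  have e : Phi0 = (fun y : Y => 1 / Real.sqrt Real.pi * Real.exp (-‖y‖ ^ 2 / 2)) := rfl
  rw [e, h2.fderiv]
  simp [Pi.neg_apply]
  ring_nf

theorem fderiv_Phi0_single (y : Y) (i : Fin 2) :
    fderiv ℝ Phi0 y (EuclideanSpace.single i 1) = - y i * Phi0 y := by
  rw [hasFDerivAt_Phi0]
  simp [EuclideanSpace.inner_single_right]

theorem integral_exp_neg_mul_norm_sq {c : ℝ} (hc : 0 < c) :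
    ∫ y : Y, Real.exp (-c * ‖y‖ ^ 2) = Real.pi / c := by
  rw [GaussianFourier.integral_rexp_neg_mul_sq_norm hc]
  simp

theorem integrable_exp_neg_mul_norm_sq {c : ℝ} (hc : 0 < c) :
    Integrable (fun y : Y => Real.exp (-c * ‖y‖ ^ 2)) volume := by
  -- The Bochner integral of a non-integrable function is 0 by convention, which contradicts the
  -- positive value just computed.
  by_contra h
  have := integral_exp_neg_mul_norm_sq hc
  rw [integral_undef h] at this
  have : 0 < Real.pi / c := by positivity
  linarith

theorem Phi0_sq (y : Y) : Phi0 y ^ 2 = Real.pi⁻¹ * Real.exp (-1 * ‖y‖ ^ 2) := by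
  rw [Phi0, mul_pow, div_pow, Real.sq_sqrt Real.pi_pos.le, ← Real.exp_nat_mul]
  congr 2
  · simp
  · push_cast; ring

theorem Phi0_pow_four (y : Y) : Phi0 y ^ 4 = (Real.pi ^ 2)⁻¹ * Real.exp (-2 * ‖y‖ ^ 2) := by
  rw [show (4 : ℕ) = 2 * 2 from rfl, pow_mul, Phi0_sq, mul_pow, ← Real.exp_nat_mul, inv_pow]
  congr 2
  push_cast; ring

theorem memLp_Phi0 : MemLp Phi0 2 volume := by
  rw [memLp_two_iff_integrable_sq continuous_Phi0.aestronglyMeasurable]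
  simp only [Phi0_sq]
  exact (integrable_exp_neg_mul_norm_sq one_pos).const_mul _

theorem mass_Phi0 : mass Phi0 = 1 := by
  rw [mass_eq_integral_sq]
  simp only [Phi0_sq]
  rw [integral_const_mul, integral_exp_neg_mul_norm_sq one_pos]
  field_simp

theorem integral_Phi0_pow_four : ∫ y, Phi0 y ^ 4 = 1 / (2 * Real.pi) := by
  simp only [Phi0_pow_four]
  rw [integral_const_mul, integral_exp_neg_mul_norm_sq two_pos]
  field_simp

theorem memLp_norm_mul_Phi0 : MemLp (fun y : Y => ‖y‖ * Phi0 y) 2 volume := by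
  have hm : Continuous fun y : Y => ‖y‖ * Phi0 y := continuous_norm.mul continuous_Phi0
  rw [memLp_two_iff_integrable_sq hm.aestronglyMeasurable]
  refine ((integrable_exp_neg_mul_norm_sq (half_pos one_pos)).const_mul 2).mono'
    (hm.pow 2).aestronglyMeasurable (.of_forall fun y => ?_)
  rw [Real.norm_of_nonneg (sq_nonneg _), mul_pow, Phi0_sq]
  have h1 : ‖y‖ ^ 2 ≤ 2 * Real.exp (‖y‖ ^ 2 / 2) := by
    have := Real.add_one_le_exp (‖y‖ ^ 2 / 2)
    linarith
  have h2 : Real.pi⁻¹ ≤ 1 := inv_le_one_of_one_le₀ (by linarith [Real.pi_gt_three])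
  calc ‖y‖ ^ 2 * (Real.pi⁻¹ * Real.exp (-1 * ‖y‖ ^ 2))
      ≤ 2 * Real.exp (‖y‖ ^ 2 / 2) * (1 * Real.exp (-1 * ‖y‖ ^ 2)) := by gcongr
    _ = 2 * (Real.exp (‖y‖ ^ 2 / 2) * Real.exp (-1 * ‖y‖ ^ 2)) := by ring
    _ = _ := by rw [← Real.exp_add]; congr 2; ring

theorem memLp_coord_mul_Phi0 (i : Fin 2) : MemLp (fun y : Y => - y i * Phi0 y) 2 volume := by
  refine memLp_of_abs_le memLp_norm_mul_Phi0
    ((by have := continuous_Phi0; fun_prop : Continuous fun y : Y => - y i * Phi0 y).aestronglyMeasurable)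
    fun y => ?_
  rw [abs_mul, abs_mul, abs_neg, abs_norm]
  gcongr
  simpa using PiLp.norm_apply_le y i

end Gaussian

/-! ### Weak derivatives of tensor products and of projections -/

section TensorWeak

theorem isTest_slice_right {φ : X → ℝ} (h : IsTest φ) (y : Y) : IsTest (fun z => φ (y, z)) := by
  refine ⟨h.1.comp (contDiff_const.prodMk contDiff_id), ?_⟩
  refine HasCompactSupport.of_support_subset_isCompact (h.2.isCompact.image continuous_snd) fun z hz => ?_
  exact ⟨(y, z), subset_tsupport _ hz, rfl⟩

theorem isTest_slice_left {φ : X → ℝ} (h : IsTest φ) (z : ℝ) : IsTest (fun y => φ (y, z)) := by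
  refine ⟨h.1.comp (contDiff_id.prodMk contDiff_const), ?_⟩
  refine HasCompactSupport.of_support_subset_isCompact (h.2.isCompact.image continuous_fst) fun y hy => ?_
  exact ⟨(y, z), subset_tsupport _ hy, rfl⟩

theorem fderiv_slice_right {φ : X → ℝ} (h : IsTest φ) (y : Y) (z : ℝ) :
    fderiv ℝ (fun z => φ (y, z)) z 1 = fderiv ℝ φ (y, z) eZ := by
  have hd : HasFDerivAt (fun z : ℝ => ((y, z) : X)) (ContinuousLinearMap.inr ℝ Y ℝ) z :=
    hasFDerivAt_prodMk_right y z
  have := (h.differentiable (y, z)).hasFDerivAt.comp z hd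
  rw [show (fun z => φ (y, z)) = φ ∘ fun z => (y, z) from rfl, this.fderiv]
  simp [eZ]

theorem fderiv_slice_left {φ : X → ℝ} (h : IsTest φ) (y v : Y) (z : ℝ) :
    fderiv ℝ (fun y => φ (y, z)) y v = fderiv ℝ φ (y, z) (v, 0) := by
  have hd : HasFDerivAt (fun y : Y => ((y, z) : X)) (ContinuousLinearMap.inl ℝ Y ℝ) y :=
    hasFDerivAt_prodMk_left y z
  have := (h.differentiable (y, z)).hasFDerivAt.comp y hd
  rw [show (fun y => φ (y, z)) = φ ∘ fun y => (y, z) from rfl, this.fderiv]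
  simp

/-- Fubini, since every slice of a test function is a test function on the line. -/
theorem hasWeakDeriv_gtens_eZ {b : Y → ℝ} {w g : ℝ → ℝ} (hb : MemLp b 2 volume)
    (hw : MemLp w 2 volume) (hg : MemLp g 2 volume) (h : HasWeakDeriv w 1 g) :
    HasWeakDeriv (gtens b w) eZ (gtens b g) := by
  have l1 : LocallyIntegrable (gtens b w) volume := (memLp_gtens hb hw).locallyIntegrable (by norm_num)
  have l2 : LocallyIntegrable (gtens b g) volume := (memLp_gtens hb hg).locallyIntegrable (by norm_num)
  refine ⟨l1, l2, fun φ hφ => ?_⟩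
  have e1 := integral_prod (μ := (volume : Measure Y)) (ν := (volume : Measure ℝ)) _
    ((hφ.fderiv_apply eZ).integrable_smul l1)
  have e2 := integral_prod (μ := (volume : Measure Y)) (ν := (volume : Measure ℝ)) _
    (hφ.integrable_smul l2)
  refine e1.trans (Eq.trans ?_ (congrArg Neg.neg e2.symm))
  rw [← integral_neg]
  congr 1
  ext y
  have := h.2.2 _ (isTest_slice_right hφ y)
  simp only [smul_eq_mul, fderiv_slice_right hφ] at this
  simp only [smul_eq_mul, gtens, ← mul_assoc]
  rw [integral_mul_const, integral_mul_const, this, neg_mul]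

theorem hasWeakDeriv_gtens_left {b b' : Y → ℝ} {w : ℝ → ℝ} {v : Y} (hb : MemLp b 2 volume)
    (hb' : MemLp b' 2 volume) (hw : MemLp w 2 volume) (h : HasWeakDeriv b v b') :
    HasWeakDeriv (gtens b w) (v, 0) (gtens b' w) := by
  have l1 : LocallyIntegrable (gtens b w) volume := (memLp_gtens hb hw).locallyIntegrable (by norm_num)
  have l2 : LocallyIntegrable (gtens b' w) volume := (memLp_gtens hb' hw).locallyIntegrable (by norm_num)
  refine ⟨l1, l2, fun φ hφ => ?_⟩
  have e1 := integral_prod_symm (μ := (volume : Measure Y)) (ν := (volume : Measure ℝ)) _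
    ((hφ.fderiv_apply (v, 0)).integrable_smul l1)
  have e2 := integral_prod_symm (μ := (volume : Measure Y)) (ν := (volume : Measure ℝ)) _
    (hφ.integrable_smul l2)
  refine e1.trans (Eq.trans ?_ (congrArg Neg.neg e2.symm))
  rw [← integral_neg]
  congr 1
  ext z
  have := h.2.2 _ (isTest_slice_left hφ z)
  simp only [smul_eq_mul, fderiv_slice_left hφ] at this
  simp only [smul_eq_mul, gtens, mul_left_comm _ (w z)]
  rw [integral_const_mul, integral_const_mul, this, mul_neg]

theorem hasWeakDeriv_Phi0 (i : Fin 2) :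
    HasWeakDeriv Phi0 (EuclideanSpace.single i 1) (fun y : Y => - y i * Phi0 y) := by
  have c2 : Continuous fun y : Y => - y i * Phi0 y := by have := continuous_Phi0; fun_prop
  refine ⟨continuous_Phi0.locallyIntegrable, c2.locallyIntegrable, fun φ hφ => ?_⟩
  have hs : ∀ f g : Y → ℝ, Continuous f → Continuous g → HasCompactSupport f →
      Integrable (fun y => f y * g y) volume := fun f g hf hg hc =>
    (hf.mul hg).integrable_of_hasCompactSupport hc.mul_right
  have h := integral_mul_fderiv_eq_neg_fderiv_mul_of_integrable (μ := (volume : Measure Y))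
    (f := φ) (g := Phi0) (v := EuclideanSpace.single i 1)
    (hs _ _ (hφ.fderiv_apply _).continuous continuous_Phi0 (hφ.fderiv_apply _).2)
    (by simpa only [fderiv_Phi0_single] using hs _ _ hφ.continuous c2 hφ.2)
    (hs _ _ hφ.continuous continuous_Phi0 hφ.2) (fun y _ => hφ.differentiable y)
    (fun y _ => contDiff_Phi0.differentiable (by simp) y)
  simp only [fderiv_Phi0_single] at h
  simp only [smul_eq_mul]
  linarith

/-- `MemH1` asks for a derivative in every direction; the three coordinate directions generate them
linearly. -/
theorem memH1_of_dirs {u gz : X → ℝ} {g : Fin 2 → X → ℝ} (hu : MemLp u 2 volume)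
    (hg : ∀ i, HasWeakDeriv u (eY i) (g i)) (hgm : ∀ i, MemLp (g i) 2 volume)
    (hz : HasWeakDeriv u eZ gz) (hzm : MemLp gz 2 volume) : MemH1 u := by
  refine ⟨hu, fun v => ?_⟩
  have h := (((hg 0).smul_dir (v.1 0)).add_dir ((hg 1).smul_dir (v.1 1))).add_dir (hz.smul_dir v.2)
  have e : v.1 0 • eY 0 + v.1 1 • eY 1 + v.2 • eZ = v := by
    conv_rhs => rw [decomp_dir v, Fin.sum_univ_two]
  rw [e] at h
  exact ⟨_, h, (((hgm 0).const_smul (v.1 0)).add ((hgm 1).const_smul (v.1 1))).add (hzm.const_smul v.2)⟩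

theorem tensorPhi0_eq (w : ℝ → ℝ) : tensorPhi0 w = gtens Phi0 w := rfl

theorem P1_eq (u : X → ℝ) : P1 u = gproj Phi0 u := rfl

theorem memLp_tensorPhi0 {w : ℝ → ℝ} (hw : MemLp w 2 volume) : MemLp (tensorPhi0 w) 2 volume :=
  memLp_gtens memLp_Phi0 hw

theorem mass_tensorPhi0 (w : ℝ → ℝ) : mass (tensorPhi0 w) = mass w := by
  rw [tensorPhi0_eq, mass_gtens, mass_Phi0, mul_one]

theorem hasWeakDeriv_tensorPhi0_eY {w : ℝ → ℝ} (hw : MemLp w 2 volume) (i : Fin 2) :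
    HasWeakDeriv (tensorPhi0 w) (eY i) (fun x => - x.1 i * tensorPhi0 w x) := by
  refine (hasWeakDeriv_gtens_left memLp_Phi0 (memLp_coord_mul_Phi0 i) hw
    (hasWeakDeriv_Phi0 i)).congr_ae .rfl (.of_forall fun x => ?_)
  simp only [gtens, tensorPhi0]
  ring

theorem hasWeakDeriv_tensorPhi0_eZ {w : ℝ → ℝ} (hw : MemH1 w) :
    HasWeakDeriv (tensorPhi0 w) eZ (tensorPhi0 (weakDeriv 1 w)) :=
  hasWeakDeriv_gtens_eZ memLp_Phi0 hw.1 (hw.memLp_weakDeriv 1) (hw.hasWeakDeriv 1)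

theorem memLp_weight_tensorPhi0 {w : ℝ → ℝ} (hw : MemLp w 2 volume) :
    MemLp (fun x : X => ‖x.1‖ * tensorPhi0 w x) 2 volume := by
  refine (memLp_gtens memLp_norm_mul_Phi0 hw).ae_eq (.of_forall fun x => ?_)
  simp only [gtens, tensorPhi0]
  ring

theorem memLp_coord_tensorPhi0 {w : ℝ → ℝ} (hw : MemLp w 2 volume) (i : Fin 2) :
    MemLp (fun x : X => - x.1 i * tensorPhi0 w x) 2 volume := by
  refine (memLp_gtens (memLp_coord_mul_Phi0 i) hw).ae_eq (.of_forall fun x => ?_)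
  simp only [gtens, tensorPhi0]
  ring

theorem memSigma_tensorPhi0 {w : ℝ → ℝ} (hw : MemH1 w) : MemSigma (tensorPhi0 w) :=
  memSigma_of_memLp_weight (memH1_of_dirs (memLp_tensorPhi0 hw.1)
    (fun i => hasWeakDeriv_tensorPhi0_eY hw.1 i) (memLp_coord_tensorPhi0 hw.1)
    (hasWeakDeriv_tensorPhi0_eZ hw) (memLp_tensorPhi0 (hw.memLp_weakDeriv 1)))
    (memLp_weight_tensorPhi0 hw.1)

/-- The Gaussian satisfies ∂ᵢΦ₀ = -yᵢΦ₀, so it is killed by the annihilation operators. Consequently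
σ does not see the Φ₀-component. -/
theorem ann_tensorPhi0 {w : ℝ → ℝ} (hw : MemH1 w) (i : Fin 2) :
    ann i (tensorPhi0 w) =ᵐ[volume] 0 := by
  filter_upwards [(hasWeakDeriv_tensorPhi0_eY hw.1 i).weakDeriv_ae] with x hx
  simp only [ann, hx, Pi.zero_apply]
  ring

theorem memLp_par {u : X → ℝ} (hu : MemLp u 2 volume) : MemLp (par u) 2 volume :=
  memLp_gpar memLp_Phi0 hu

theorem memLp_P1 {u : X → ℝ} (hu : MemLp u 2 volume) : MemLp (P1 u) 2 volume :=
  memLp_gproj memLp_Phi0 hu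

theorem integral_mul_tensorPhi0 {u : X → ℝ} {w : ℝ → ℝ} (hu : MemLp u 2 volume)
    (hw : MemLp w 2 volume) : ∫ x, u x * tensorPhi0 w x = ∫ z, par u z * w z :=
  integral_mul_gtens memLp_Phi0 hw hu

theorem integral_P1_mul_tensorPhi0 {u : X → ℝ} {w : ℝ → ℝ} (hu : MemLp u 2 volume)
    (hw : MemLp w 2 volume) : ∫ x, P1 u x * tensorPhi0 w x = 0 :=
  integral_gproj_mul_gtens memLp_Phi0 mass_Phi0 hw hu

theorem mass_par_add_mass_P1 {u : X → ℝ} (hu : MemLp u 2 volume) :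
    mass (par u) + mass (P1 u) = mass u := mass_gproj_add memLp_Phi0 mass_Phi0 hu

theorem integral_mul_P1 {u : X → ℝ} (hu : MemLp u 2 volume) :
    ∫ x, u x * P1 u x = mass (P1 u) := by
  have h0 := integral_P1_mul_tensorPhi0 hu (memLp_par hu)
  have e : ∀ x, u x * P1 u x = P1 u x ^ 2 + P1 u x * tensorPhi0 (par u) x := fun x => by
    simp only [P1]; ring
  simp only [e]
  rw [integral_add (integrable_sq_of_memLp (memLp_P1 hu))
    (integrable_mul_of_memLp (memLp_P1 hu) (memLp_tensorPhi0 (memLp_par hu))), h0, add_zero,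
    mass_eq_integral_sq]

theorem IsTest.memH1_real {φ : ℝ → ℝ} (h : IsTest φ) : MemH1 φ := h.memH1

theorem IsTest.weakDeriv_ae {φ : ℝ → ℝ} (h : IsTest φ) :
    weakDeriv 1 φ =ᵐ[volume] fun z => fderiv ℝ φ z 1 := (h.hasWeakDeriv 1).weakDeriv_ae

/-- Integrate by parts against ψ(z)Φ₀(y), an element of Σ, and use that the projection is adjoint to
tensoring with Φ₀. -/
theorem hasWeakDeriv_par {u : X → ℝ} (hu : MemH1 u) :
    HasWeakDeriv (par u) 1 (par (weakDeriv eZ u)) := by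
  have hp := memLp_par hu.1
  have hp' := memLp_par (hu.memLp_weakDeriv eZ)
  refine ⟨hp.locallyIntegrable (by norm_num), hp'.locallyIntegrable (by norm_num), fun ψ hψ => ?_⟩
  have hs := memSigma_tensorPhi0 hψ.memH1
  have h := hu.integral_weakDeriv_eZ_mul hs
  rw [integral_mul_tensorPhi0 (hu.memLp_weakDeriv eZ) (hψ.memLp 2)] at h
  have e : ∫ x, u x * weakDeriv eZ (tensorPhi0 ψ) x = ∫ x, u x * tensorPhi0 (fun z => fderiv ℝ ψ z 1) x := by
    refine integral_congr_ae ?_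
    have h2 := (hasWeakDeriv_gtens_eZ memLp_Phi0 (hψ.memLp 2) ((hψ.fderiv_apply 1).memLp 2)
      (hψ.hasWeakDeriv 1)).weakDeriv_ae
    filter_upwards [h2] with x hx
    rw [tensorPhi0_eq, hx]
    rfl
  rw [e, integral_mul_tensorPhi0 hu.1 ((hψ.fderiv_apply 1).memLp 2)] at h
  simp only [smul_eq_mul, mul_comm _ (par u _), mul_comm _ (par (weakDeriv eZ u) _)]
  linarith

theorem memH1_par {u : X → ℝ} (hu : MemH1 u) : MemH1 (par u) := by
  refine ⟨memLp_par hu.1, fun v => ⟨fun z => v • par (weakDeriv eZ u) z, ?_, ?_⟩⟩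
  · have := (hasWeakDeriv_par hu).smul_dir v
    simpa using this
  · exact (memLp_par (hu.memLp_weakDeriv eZ)).const_smul v

theorem weakDeriv_par {u : X → ℝ} (hu : MemH1 u) :
    weakDeriv 1 (par u) =ᵐ[volume] par (weakDeriv eZ u) := (hasWeakDeriv_par hu).weakDeriv_ae

theorem MemSigma.P1 {u : X → ℝ} (hu : MemSigma u) : MemSigma (P1 u) :=
  hu.sub (memSigma_tensorPhi0 (memH1_par hu.1))

theorem ae_comp_snd {p : ℝ → Prop} (h : ∀ᵐ z, p z) : ∀ᵐ x : X, p x.2 :=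
  (Measure.quasiMeasurePreserving_snd (μ := (volume : Measure Y)) (ν := (volume : Measure ℝ))).ae h

theorem tensorPhi0_congr_ae {w w' : ℝ → ℝ} (h : w =ᵐ[volume] w') :
    tensorPhi0 w =ᵐ[volume] tensorPhi0 w' := by
  filter_upwards [ae_comp_snd h] with x hx
  simp only [tensorPhi0, hx]

theorem weakDeriv_tensorPhi0_eZ {w : ℝ → ℝ} (hw : MemH1 w) :
    weakDeriv eZ (tensorPhi0 w) =ᵐ[volume] tensorPhi0 (weakDeriv 1 w) :=
  (hasWeakDeriv_tensorPhi0_eZ hw).weakDeriv_ae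

theorem weakDeriv_P1_eZ {u : X → ℝ} (hu : MemSigma u) :
    weakDeriv eZ (DimRed.P1 u) =ᵐ[volume] DimRed.P1 (weakDeriv eZ u) := by
  have hw := memH1_par hu.1
  filter_upwards [hu.1.weakDeriv_sub (memSigma_tensorPhi0 hw).1 eZ, weakDeriv_tensorPhi0_eZ hw,
    tensorPhi0_congr_ae (weakDeriv_par hu.1)] with x h1 h2 h3
  change weakDeriv eZ (fun x => u x - tensorPhi0 (par u) x) x = _
  rw [h1, h2, h3]
  rfl

theorem ann_P1 {u : X → ℝ} (hu : MemSigma u) (i : Fin 2) :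
    ann i (DimRed.P1 u) =ᵐ[volume] ann i u := by
  have hw := memH1_par hu.1
  filter_upwards [hu.1.weakDeriv_sub (memSigma_tensorPhi0 hw).1 (eY i), ann_tensorPhi0 hw i]
    with x h1 h2
  change weakDeriv (eY i) (fun x => u x - tensorPhi0 (par u) x) x + x.1 i * DimRed.P1 u x = _
  rw [h1]
  simp only [ann, DimRed.P1, Pi.zero_apply] at h2 ⊢
  linarith

theorem MemSigma.sigmaYSq_P1 {u : X → ℝ} (hu : MemSigma u) :
    sigmaYSq (DimRed.P1 u) = sigmaYSq u := by
  rw [hu.P1.sigmaYSq_eq, hu.sigmaYSq_eq]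
  exact Finset.sum_congr rfl fun i _ => mass_congr_ae (ann_P1 hu i)

theorem sigmaYSq_tensorPhi0 {w : ℝ → ℝ} (hw : MemH1 w) : sigmaYSq (tensorPhi0 w) = 0 := by
  rw [(memSigma_tensorPhi0 hw).sigmaYSq_eq]
  refine Finset.sum_eq_zero fun i _ => ?_
  rw [mass_congr_ae (ann_tensorPhi0 hw i)]
  simp [mass]

/-- The projection commutes with ∂_z, so this is Pythagoras applied to ∂_z u. -/
theorem MemSigma.mass_weakDeriv_eZ {u : X → ℝ} (hu : MemSigma u) :
    mass (weakDeriv eZ u) = mass (weakDeriv 1 (par u)) + mass (weakDeriv eZ (DimRed.P1 u)) := by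
  rw [mass_congr_ae (weakDeriv_par hu.1), mass_congr_ae (weakDeriv_P1_eZ hu)]
  exact (mass_par_add_mass_P1 (hu.1.memLp_weakDeriv eZ)).symm

theorem MemSigma.integral_weakDeriv_eZ_P1 {u : X → ℝ} (hu : MemSigma u) :
    ∫ x, weakDeriv eZ u x * weakDeriv eZ (DimRed.P1 u) x = mass (weakDeriv eZ (DimRed.P1 u)) := by
  rw [mass_congr_ae (weakDeriv_P1_eZ hu), ← integral_mul_P1 (hu.1.memLp_weakDeriv eZ)]
  refine integral_congr_ae ?_
  filter_upwards [weakDeriv_P1_eZ hu] with x hx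
  rw [hx]

theorem MemSigma.integral_ann_P1 {u : X → ℝ} (hu : MemSigma u) :
    ∑ i, ∫ x, ann i u x * ann i (DimRed.P1 u) x = sigmaYSq (DimRed.P1 u) := by
  rw [hu.P1.sigmaYSq_eq]
  refine Finset.sum_congr rfl fun i _ => ?_
  rw [mass_eq_integral_sq]
  refine integral_congr_ae ?_
  filter_upwards [ann_P1 hu i] with x hx
  rw [hx, sq]

end TensorWeak

/-! ### Spectral gap of the transverse oscillator -/

section SpectralGap

/-- The normalized ground state of the one-dimensional harmonic oscillator. -/
def hermite0 (s : ℝ) : ℝ := (Real.sqrt (Real.sqrt Real.pi))⁻¹ * Real.exp (-s ^ 2 / 2)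

theorem hermite0_pos (s : ℝ) : 0 < hermite0 s := by unfold hermite0; positivity

theorem continuous_hermite0 : Continuous hermite0 := by unfold hermite0; fun_prop

theorem hasDerivAt_hermite0 (s : ℝ) : HasDerivAt hermite0 (-(s * hermite0 s)) s := by
  have h : HasDerivAt (fun s : ℝ => -s ^ 2 / 2) (-s) s := by
    exact (((hasDerivAt_pow 2 s).neg).div_const 2).congr_deriv (by push_cast; ring)
  have h2 := (h.exp).const_mul (Real.sqrt (Real.sqrt Real.pi))⁻¹
  exact h2.congr_deriv (by simp only [hermite0]; ring)

theorem hermite0_sq (s : ℝ) : hermite0 s ^ 2 = (Real.sqrt Real.pi)⁻¹ * Real.exp (-1 * s ^ 2) := by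
  rw [hermite0, mul_pow, inv_pow, Real.sq_sqrt (Real.sqrt_nonneg _), ← Real.exp_nat_mul]
  congr 2
  push_cast
  ring

theorem memLp_hermite0 : MemLp hermite0 2 volume := by
  rw [memLp_two_iff_integrable_sq continuous_hermite0.aestronglyMeasurable]
  simp only [hermite0_sq]
  exact (integrable_exp_neg_mul_sq one_pos).const_mul _

theorem mass_hermite0 : mass hermite0 = 1 := by
  rw [mass_eq_integral_sq]
  simp only [hermite0_sq]
  rw [integral_const_mul, integral_gaussian, div_one]
  exact inv_mul_cancel₀ (by positivity)

/-- A Hardy-type argument with multiplier 1/(1+s). The derivative of f²/(1+s) is 2fg/(1+s) minus a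
term at least f², while f²/(1+s) vanishes at 0 and is nonnegative at T. Hence ∫f² ≤ ∫2fg/(1+s) ≤
∫(f²/2 + 2g²). -/
theorem integral_sq_le_of_deriv_eq {f g : ℝ → ℝ} (hg : Continuous g)
    (hd : ∀ s, HasDerivAt f (g s - s * f s) s) (h0 : f 0 = 0) {T : ℝ} (hT : 0 ≤ T) :
    ∫ s in 0..T, f s ^ 2 ≤ 4 * ∫ s in 0..T, g s ^ 2 := by
  have hf : Continuous f := continuous_iff_continuousAt.2 fun s => (hd s).continuousAt
  have hF : ∀ s ∈ Set.uIcc 0 T, HasDerivAt (fun s => f s ^ 2 * (1 + s)⁻¹)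
      (2 * f s * (g s - s * f s) * (1 + s)⁻¹ + f s ^ 2 * (-1 / (1 + s) ^ 2)) s := by
    intro s hs
    rw [Set.uIcc_of_le hT] at hs
    have h1 : (1 + s) ≠ 0 := by linarith [hs.1]
    exact (((hd s).pow 2).mul (((hasDerivAt_id s).const_add 1).inv h1)).congr_deriv (by simp)
  have hcont : ContinuousOn (fun s => 2 * f s * (g s - s * f s) * (1 + s)⁻¹
      + f s ^ 2 * (-1 / (1 + s) ^ 2)) (Set.uIcc 0 T) := by
    have h1 : ∀ s ∈ Set.uIcc 0 T, 1 + s ≠ 0 := fun s hs => by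
      rw [Set.uIcc_of_le hT] at hs
      linarith [hs.1]
    have h2 : ContinuousOn (fun s : ℝ => 1 + s) (Set.uIcc 0 T) := by fun_prop
    refine ContinuousOn.add (ContinuousOn.mul (by fun_prop) (h2.inv₀ h1)) ?_
    exact ContinuousOn.mul (by fun_prop) (continuousOn_const.div (h2.pow 2) fun s hs => pow_ne_zero 2 (h1 s hs))
  have hFTC := intervalIntegral.integral_eq_sub_of_hasDerivAt hF hcont.intervalIntegrable
  have hpos : 0 ≤ ∫ s in 0..T, (2 * f s * (g s - s * f s) * (1 + s)⁻¹ + f s ^ 2 * (-1 / (1 + s) ^ 2)) := by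
    rw [hFTC, h0]
    have : 0 ≤ f T ^ 2 * (1 + T)⁻¹ := by positivity
    simpa using this
  have hle : ∫ s in 0..T, (2 * f s * (g s - s * f s) * (1 + s)⁻¹ + f s ^ 2 * (-1 / (1 + s) ^ 2))
      ≤ ∫ s in 0..T, (2 * g s ^ 2 - f s ^ 2 / 2) := by
    refine intervalIntegral.integral_mono_on hT hcont.intervalIntegrable
      (Continuous.intervalIntegrable (by fun_prop) _ _) fun s hs => ?_
    have h1 : 0 < 1 + s := by linarith [hs.1]
    have e : 2 * f s * (g s - s * f s) * (1 + s)⁻¹ + f s ^ 2 * (-1 / (1 + s) ^ 2)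
        = 2 * (f s * ((1 + s)⁻¹ * g s)) - f s ^ 2 * ((2 * s * (1 + s) + 1) / (1 + s) ^ 2) := by
      field_simp
      ring
    -- After clearing the denominator this is s² ≥ 0; the coefficient of f² therefore stays at least
    -- 1 down to s = 0, where the drift -sf gives nothing.
    have h2 : 1 ≤ (2 * s * (1 + s) + 1) / (1 + s) ^ 2 := by
      rw [le_div_iff₀ (by positivity)]
      nlinarith [sq_nonneg s]
    have h3 : (1 + s)⁻¹ ≤ 1 := inv_le_one_of_one_le₀ (by linarith [hs.1])
    have h4 : ((1 + s)⁻¹ * g s) ^ 2 ≤ g s ^ 2 := by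
      rw [mul_pow]
      have : ((1 + s)⁻¹) ^ 2 ≤ 1 := pow_le_one₀ (by positivity) h3
      nlinarith [sq_nonneg (g s)]
    rw [e]
    nlinarith [mul_le_mul_of_nonneg_left h2 (sq_nonneg (f s)),
      sq_nonneg (f s - 2 * ((1 + s)⁻¹ * g s))]
  have hsub := intervalIntegral.integral_sub (μ := volume)
    (Continuous.intervalIntegrable (by fun_prop : Continuous fun s => 2 * g s ^ 2) 0 T)
    (Continuous.intervalIntegrable (by fun_prop : Continuous fun s => f s ^ 2 / 2) 0 T)
  rw [hsub, intervalIntegral.integral_const_mul, intervalIntegral.integral_div] at hle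
  linarith

/-- The equation is invariant under s ↦ -s with g replaced by -g(-s), so the half-line estimate
applies on both sides. -/
theorem mass_le_of_deriv_eq {f g : ℝ → ℝ} (hg : Continuous g) (hgm : MemLp g 2 volume)
    (hfm : MemLp f 2 volume) (hd : ∀ s, HasDerivAt f (g s - s * f s) s) (h0 : f 0 = 0) :
    mass f ≤ 4 * mass g := by
  have hf : Continuous f := continuous_iff_continuousAt.2 fun s => (hd s).continuousAt
  rw [mass_eq_integral_sq, mass_eq_integral_sq]
  have hT : Tendsto (fun n : ℕ => (n : ℝ)) atTop atTop := tendsto_natCast_atTop_atTop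
  have l1 := intervalIntegral_tendsto_integral hfm.integrable_sq (tendsto_neg_atTop_atBot.comp hT) hT
  have l2 := (intervalIntegral_tendsto_integral hgm.integrable_sq
    (tendsto_neg_atTop_atBot.comp hT) hT).const_mul 4
  refine le_of_tendsto_of_tendsto' l1 l2 fun n => ?_
  have hn : (0 : ℝ) ≤ n := Nat.cast_nonneg n
  have p := integral_sq_le_of_deriv_eq hg hd h0 hn
  have hd' : ∀ s, HasDerivAt (fun s => f (-s)) (-g (-s) - s * f (-s)) s := fun s => by
    exact ((hd (-s)).comp s (hasDerivAt_neg s)).congr_deriv (by ring)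
  have q := integral_sq_le_of_deriv_eq (g := fun s => -g (-s)) (by fun_prop) hd' (by simpa using h0) hn
  simp only [neg_sq] at q
  rw [intervalIntegral.integral_comp_neg (fun s => f s ^ 2),
    intervalIntegral.integral_comp_neg (fun s => g s ^ 2), neg_zero] at q
  have ci : ∀ h : ℝ → ℝ, Continuous h → ∀ a b : ℝ, IntervalIntegrable (fun s => h s ^ 2) volume a b :=
    fun h hh a b => (hh.pow 2).intervalIntegrable a b
  simp only [Function.comp_apply]
  rw [← intervalIntegral.integral_add_adjacent_intervals (ci f hf (-n) 0) (ci f hf 0 n),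
    ← intervalIntegral.integral_add_adjacent_intervals (ci g hg (-n) 0) (ci g hg 0 n)]
  linarith

/-- Subtract the multiple of the ground state that makes the function vanish at 0. This leaves k' +
sk unchanged, and the orthogonal projection does at least as well as any other multiple. -/
theorem gap_line {k : ℝ → ℝ} (hk : IsTest k) :
    mass (fun s => k s - (∫ s, k s * hermite0 s) * hermite0 s) ≤ 4 * mass (fun s => deriv k s + s * k s) := by
  refine (mass_sub_proj_le memLp_hermite0 mass_hermite0 (hk.memLp 2) (k 0 / hermite0 0)).trans ?_
  have ht : IsTest (fun s => deriv k s + s * k s) := by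
    have h1 := hk.fderiv_apply 1
    simp only [fderiv_apply_one_eq_deriv] at h1
    exact h1.add (hk.mul_smooth contDiff_id)
  refine mass_le_of_deriv_eq ht.continuous (ht.memLp 2) ((hk.memLp 2).sub (memLp_hermite0.const_mul _))
    (fun s => ?_) ?_
  · exact ((hk.differentiable s).hasDerivAt.sub
      ((hasDerivAt_hermite0 s).const_mul (k 0 / hermite0 0))).congr_deriv (by ring)
  · rw [div_mul_cancel₀ _ (hermite0_pos 0).ne', sub_self]

/-- The plane with coordinates as a product of two lines. -/
def planeEquiv : ℝ × ℝ ≃ᵐ Y :=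
  (MeasurableEquiv.finTwoArrow (α := ℝ)).symm.trans (MeasurableEquiv.toLp 2 (Fin 2 → ℝ))

theorem measurePreserving_planeEquiv : MeasurePreserving planeEquiv volume volume :=
  (EuclideanSpace.volume_preserving_symm_measurableEquiv_toLp (Fin 2)).symm.comp
    (volume_preserving_finTwoArrow ℝ).symm

theorem planeEquiv_zero (p : ℝ × ℝ) : planeEquiv p 0 = p.1 := rfl

theorem planeEquiv_one (p : ℝ × ℝ) : planeEquiv p 1 = p.2 := rfl

theorem planeEquiv_eq (p : ℝ × ℝ) : planeEquiv p =
    p.1 • (EuclideanSpace.single 0 1 : Y) + p.2 • (EuclideanSpace.single 1 1 : Y) := by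
  ext i
  fin_cases i
  · simp [planeEquiv_zero]
  · simp [planeEquiv_one]

theorem Phi0_planeEquiv (p : ℝ × ℝ) : Phi0 (planeEquiv p) = gtens hermite0 hermite0 p := by
  simp only [Phi0, gtens, hermite0, EuclideanSpace.norm_sq_eq, Fin.sum_univ_two, planeEquiv_zero,
    planeEquiv_one, Real.norm_eq_abs, sq_abs]
  rw [mul_mul_mul_comm, ← mul_inv, Real.mul_self_sqrt (Real.sqrt_nonneg _), one_div, ← Real.exp_add]
  congr 2
  ring

theorem mass_comp_planeEquiv (f : Y → ℝ) : mass (fun p => f (planeEquiv p)) = mass f := by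
  simp only [mass]
  exact measurePreserving_planeEquiv.integral_comp planeEquiv.measurableEmbedding (fun y => ‖f y‖ ^ 2)

theorem integral_comp_planeEquiv (f : Y → ℝ) : ∫ p, f (planeEquiv p) = ∫ y, f y :=
  measurePreserving_planeEquiv.integral_comp planeEquiv.measurableEmbedding f

theorem mass_comp_swap {A B : Type*} [MeasureSpace A] [MeasureSpace B]
    [SigmaFinite (volume : Measure A)] [SigmaFinite (volume : Measure B)] (f : A × B → ℝ) :
    mass (fun p : B × A => f p.swap) = mass f := by
  simp only [mass]
  exact integral_prod_swap (μ := (volume : Measure A)) (ν := (volume : Measure B)) (fun p => ‖f p‖ ^ 2)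

theorem memLp_comp_planeEquiv {f : Y → ℝ} (hf : MemLp f 2 volume) :
    MemLp (fun p => f (planeEquiv p)) 2 volume :=
  hf.comp_measurePreserving measurePreserving_planeEquiv

theorem isTest_line {k : Y → ℝ} (hk : IsTest k) (a : Y) (v : Y) (hv : v ≠ 0) :
    IsTest (fun s : ℝ => k (s • v + a)) := by
  refine ⟨hk.1.comp (by fun_prop), ?_⟩
  have hce : Topology.IsClosedEmbedding (fun s : ℝ => s • v + a) :=
    (Homeomorph.addRight a).isClosedEmbedding.comp (isClosedEmbedding_smul_left hv)
  exact hk.2.comp_isClosedEmbedding hce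

theorem deriv_line {k : Y → ℝ} (hk : IsTest k) (a : Y) (v : Y) (s : ℝ) :
    deriv (fun s : ℝ => k (s • v + a)) s = fderiv ℝ k (s • v + a) v := by
  have hd : HasDerivAt (fun s : ℝ => s • v + a) v s := by
    simpa using ((hasDerivAt_id s).smul_const v).add_const a
  exact ((hk.differentiable _).hasFDerivAt.comp_hasDerivAt s hd).deriv

theorem single_ne_zero' (i : Fin 2) : (EuclideanSpace.single i 1 : Y) ≠ 0 := by
  intro h
  have := congrArg (fun y : Y => y i) h
  simp at this

/-- Slicewise form of the one-dimensional gap. -/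
theorem gap_slices {K g : ℝ × ℝ → ℝ} (hK : MemLp K 2 volume) (hg : MemLp g 2 volume)
    (h : ∀ t, IsTest (fun s => K (s, t)))
    (hd : ∀ s t, deriv (fun s => K (s, t)) s + s * K (s, t) = g (s, t)) :
    mass (gproj hermite0 K) ≤ 4 * mass g := by
  rw [← integral_mass_slice (memLp_gproj memLp_hermite0 hK), ← integral_mass_slice hg,
    ← integral_const_mul]
  refine integral_mono (integrable_mass_slice (memLp_gproj memLp_hermite0 hK))
    ((integrable_mass_slice hg).const_mul 4) fun t => ?_
  have := gap_line (h t)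
  simp only [hd] at this
  exact this

theorem mass_add_le {E : Type*} [MeasureSpace E] {u v : E → ℝ} (hu : MemLp u 2 volume)
    (hv : MemLp v 2 volume) : mass (fun x => u x + v x) ≤ 2 * mass u + 2 * mass v := by
  simp only [mass_eq_integral_sq]
  rw [← integral_const_mul, ← integral_const_mul, ← integral_add (hu.integrable_sq.const_mul 2)
    (hv.integrable_sq.const_mul 2)]
  refine integral_mono (hu.add hv).integrable_sq ((hu.integrable_sq.const_mul 2).add
    (hv.integrable_sq.const_mul 2)) fun x => ?_
  beta_reduce
  nlinarith [sq_nonneg (u x - v x)]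

/-- In coordinates Φ₀ is a product and 1 - P₁P₂ = (1 - P₁) + P₁(1 - P₂), where Pᵢ projects in the
i-th variable. Each summand is controlled by the line gap with constant 4, and squaring the sum
costs a factor 2. -/
theorem gap_plane {k : Y → ℝ} (hk : IsTest k) :
    mass (fun y => k y - (∫ y, k y * Phi0 y) * Phi0 y)
      ≤ 8 * ∑ i : Fin 2, mass (fun y : Y => fderiv ℝ k y (EuclideanSpace.single i 1) + y i * k y) := by
  set K : ℝ × ℝ → ℝ := fun p => k (planeEquiv p) with hKdef
  set g : Fin 2 → ℝ × ℝ → ℝ := fun i p =>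
    fderiv ℝ k (planeEquiv p) (EuclideanSpace.single i 1) + planeEquiv p i * k (planeEquiv p) with hgdef
  have hgt : ∀ i : Fin 2, IsTest (fun y : Y => fderiv ℝ k y (EuclideanSpace.single i 1) + y i * k y) :=
    fun i => (hk.fderiv_apply _).add (hk.mul_smooth (by fun_prop))
  have hK : MemLp K 2 volume := memLp_comp_planeEquiv (hk.memLp 2)
  have hg : ∀ i, MemLp (g i) 2 volume := fun i => memLp_comp_planeEquiv ((hgt i).memLp 2)
  have hswap : ∀ {f : ℝ × ℝ → ℝ}, MemLp f 2 volume → MemLp (fun p : ℝ × ℝ => f p.swap) 2 volume :=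
    fun hf => hf.comp_measurePreserving
      (Measure.measurePreserving_swap (μ := (volume : Measure ℝ)) (ν := (volume : Measure ℝ)))
  have b1 : mass (gproj hermite0 K) ≤ 4 * mass (g 0) := by
    refine gap_slices hK (hg 0) (fun t => ?_) fun s t => ?_
    · simp only [hKdef, planeEquiv_eq]
      exact isTest_line hk _ _ (single_ne_zero' 0)
    · simp only [hKdef, hgdef, planeEquiv_zero]
      simp only [planeEquiv_eq (_, _)]
      rw [deriv_line hk]
  have b2 : mass (gproj hermite0 (fun p => K p.swap)) ≤ 4 * mass (g 1) := by
    rw [← mass_comp_swap (g 1)]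
    refine gap_slices (hswap hK) (hswap (hg 1)) (fun t => ?_) fun s t => ?_
    · simp only [hKdef, planeEquiv_eq, Prod.swap_prod_mk, add_comm (t • _)]
      exact isTest_line hk _ _ (single_ne_zero' 1)
    · simp only [hKdef, hgdef, Prod.swap_prod_mk, planeEquiv_one]
      simp only [planeEquiv_eq (_, _), add_comm (t • _)]
      rw [deriv_line hk]
  set D : ℝ × ℝ → ℝ := fun p => gproj hermite0 (fun p => K p.swap) p.swap with hD
  have hDm : MemLp D 2 volume := hswap (memLp_gproj memLp_hermite0 (hswap hK))
  have b3 : mass D ≤ 4 * mass (g 1) := by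
    rw [hD, mass_comp_swap]
    exact b2
  set J : ℝ → ℝ := gpar hermite0 (fun p => K p.swap) with hJ
  have hJm : MemLp J 2 volume := memLp_gpar memLp_hermite0 (hswap hK)
  set M : ℝ := ∫ y, k y * Phi0 y with hM
  have hMJ : ∫ s, J s * hermite0 s = M := by
    rw [hJ, ← integral_mul_gtens memLp_hermite0 memLp_hermite0 (hswap hK), hM,
      ← integral_comp_planeEquiv]
    refine Eq.trans ?_ (integral_prod_swap (μ := (volume : Measure ℝ)) (ν := (volume : Measure ℝ))
      fun p => k (planeEquiv p) * Phi0 (planeEquiv p))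
    refine integral_congr_ae (.of_forall fun p => ?_)
    simp only [hKdef, Phi0_planeEquiv, gtens, Prod.fst_swap, Prod.snd_swap, mul_comm]
  -- Here `D` is (1 - P₂)K, so this computes the coefficient of P₁(1 - P₂)K; P₁P₂K is M times the
  -- product ground state.
  have hDK : gpar hermite0 D =ᵐ[volume] fun t => gpar hermite0 K t - M * hermite0 t := by
    filter_upwards [memLp_slice hK] with t ht
    have e : ∀ s, D (s, t) * hermite0 s = K (s, t) * hermite0 s - hermite0 t * (J s * hermite0 s) :=
      fun s => by
        simp only [hD, gproj, gtens, Prod.swap_prod_mk, hJ]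
        ring
    simp only [gpar, e]
    rw [integral_sub (integrable_mul_of_memLp ht memLp_hermite0)
      ((integrable_mul_of_memLp hJm memLp_hermite0).const_mul _), integral_const_mul, hMJ]
    ring
  have hfin : (fun p : ℝ × ℝ => k (planeEquiv p) - M * Phi0 (planeEquiv p)) =ᵐ[volume]
      fun p => gproj hermite0 K p + gtens hermite0 (gpar hermite0 D) p := by
    have h' : ∀ᵐ p ∂((volume : Measure ℝ).prod (volume : Measure ℝ)),
        gpar hermite0 D p.2 = gpar hermite0 K p.2 - M * hermite0 p.2 :=
      (Measure.quasiMeasurePreserving_snd (μ := (volume : Measure ℝ)) (ν := (volume : Measure ℝ))).ae hDK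
    filter_upwards [h'] with p hp
    simp only [gproj, gtens, hp, Phi0_planeEquiv, hKdef]
    ring
  have hDp := memLp_gpar memLp_hermite0 hDm
  calc mass (fun y => k y - M * Phi0 y)
      = mass (fun p : ℝ × ℝ => k (planeEquiv p) - M * Phi0 (planeEquiv p)) :=
        (mass_comp_planeEquiv (fun y => k y - M * Phi0 y)).symm
    _ = mass (fun p => gproj hermite0 K p + gtens hermite0 (gpar hermite0 D) p) := mass_congr_ae hfin
    _ ≤ 2 * mass (gproj hermite0 K) + 2 * mass (gtens hermite0 (gpar hermite0 D)) :=
        mass_add_le (memLp_gproj memLp_hermite0 hK) (memLp_gtens memLp_hermite0 hDp)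
    _ = 2 * mass (gproj hermite0 K) + 2 * mass (gpar hermite0 D) := by
        rw [mass_gtens, mass_hermite0, mul_one]
    _ ≤ 2 * (4 * mass (g 0)) + 2 * (4 * mass (g 1)) := by
        gcongr
        exact (mass_gpar_le memLp_hermite0 mass_hermite0 hDm).trans b3
    _ = _ := by
        simp only [hgdef, Fin.sum_univ_two]
        rw [mass_comp_planeEquiv (fun y : Y => fderiv ℝ k y (EuclideanSpace.single 0 1) + y 0 * k y),
          mass_comp_planeEquiv (fun y : Y => fderiv ℝ k y (EuclideanSpace.single 1 1) + y 1 * k y)]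
        ring

theorem gap_test {φ : X → ℝ} (hφ : IsTest φ) :
    mass (P1 φ) ≤ 8 * ∑ i : Fin 2, mass (fun x : X => fderiv ℝ φ x (eY i) + x.1 i * φ x) := by
  have ht : ∀ i : Fin 2, IsTest (fun x : X => fderiv ℝ φ x (eY i) + x.1 i * φ x) := fun i =>
    (hφ.fderiv_apply _).add (hφ.mul_smooth (contDiff_coord i))
  rw [P1_eq, ← integral_mass_slice (memLp_gproj memLp_Phi0 (hφ.memLp 2))]
  simp only [fun i => (integral_mass_slice ((ht i).memLp 2)).symm]
  rw [← integral_finsetSum _ fun i _ => integrable_mass_slice ((ht i).memLp 2), ← integral_const_mul]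
  refine integral_mono (integrable_mass_slice (memLp_gproj memLp_Phi0 (hφ.memLp 2)))
    ((integrable_finsetSum _ fun i _ => integrable_mass_slice ((ht i).memLp 2)).const_mul 8) fun z => ?_
  have := gap_plane (isTest_slice_left hφ z)
  simp only [fderiv_slice_left hφ] at this
  exact this

/-- Integrate the planar gap over z for test functions, then use density; the projection is an L²
contraction. -/
theorem MemSigma.gap {u : X → ℝ} (hu : MemSigma u) : mass (DimRed.P1 u) ≤ 8 * sigmaYSq u := by
  obtain ⟨φ, hφ, hc⟩ := hu.exists_test_seq
  have hP : Tendsto (fun n => l2Norm (fun x => DimRed.P1 (φ n) x - DimRed.P1 u x)) atTop (𝓝 0) := by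
    refine squeeze_zero (fun n => l2Norm_nonneg _) (fun n => ?_) hc.1
    have h1 := gproj_sub_ae memLp_Phi0 ((hφ n).memLp 2) hu.memLp
    have h2 := l2Norm_gproj_le memLp_Phi0 mass_Phi0 (((hφ n).memLp 2).sub hu.memLp)
    rw [show (φ n - u) = fun x => φ n x - u x from rfl, l2Norm_congr_ae h1] at h2
    exact h2
  have l1 := (tendsto_l2Norm_of_tendsto_l2 (memLp_P1 hu.memLp) (fun n => memLp_P1 ((hφ n).memLp 2)) hP).pow 2
  have ht : ∀ n, ∀ i : Fin 2, IsTest (fun x : X => fderiv ℝ (φ n) x (eY i) + x.1 i * φ n x) := fun n i =>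
    ((hφ n).fderiv_apply _).add ((hφ n).mul_smooth (contDiff_coord i))
  have l2 : ∀ i, Tendsto (fun n => l2Norm (fun x : X => fderiv ℝ (φ n) x (eY i) + x.1 i * φ n x) ^ 2) atTop
      (𝓝 (l2Norm (ann i u) ^ 2)) := fun i => by
    refine (tendsto_l2Norm_of_tendsto_l2 (hu.memLp_ann i) (fun n => (ht n i).memLp 2) ?_).pow 2
    have := (hc.2.1 i).add (hc.coord hu hφ i)
    rw [add_zero] at this
    refine squeeze_zero (fun n => l2Norm_nonneg _) (fun n => ?_) this
    refine le_of_eq_of_le ?_ (l2Norm_add_le (((((hφ n).fderiv_apply (eY i)).memLp 2)).sub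
      (hu.1.memLp_weakDeriv (eY i))) (((hφ n).memSigma.memLp_coord i).sub (hu.memLp_coord i)))
    congr 1
    ext x
    simp only [ann]
    ring
  simp only [l2Norm_sq] at l1 l2
  rw [hu.sigmaYSq_eq]
  exact le_of_tendsto_of_tendsto' l1 ((tendsto_finsetSum _ fun i _ => l2 i).const_mul 8)
    fun n => gap_test (hφ n)

end SpectralGap

/-! ### Weak derivatives and continuous representatives on the line -/

section Line

theorem intervalIntegrable_of_locallyIntegrable {h : ℝ → ℝ} (hh : LocallyIntegrable h volume)
    (a b : ℝ) : IntervalIntegrable h volume a b :=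
  (hh.integrableOn_isCompact isCompact_uIcc).intervalIntegrable

/-- Integration by parts for primitives of locally integrable functions. -/
theorem integral_primitive_mul {h₁ h₂ P₁ P₂ : ℝ → ℝ} (i₁ : LocallyIntegrable h₁ volume)
    (i₂ : LocallyIntegrable h₂ volume) (hP₁ : ∀ a b, P₁ b - P₁ a = ∫ t in a..b, h₁ t)
    (hP₂ : ∀ a b, P₂ b - P₂ a = ∫ t in a..b, h₂ t) (a b : ℝ) :
    ∫ t in a..b, (h₁ t * P₂ t + P₁ t * h₂ t) = P₁ b * P₂ b - P₁ a * P₂ a := by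
  have key : ∀ {h P : ℝ → ℝ}, LocallyIntegrable h volume → (∀ a b, P b - P a = ∫ t in a..b, h t) →
      AbsolutelyContinuousOnInterval P a b ∧ ∀ᵐ x, x ∈ Set.uIcc a b → HasDerivAt P (h x) x := by
    intro h P hi hP
    have e : P = fun x => P a + ∫ t in a..x, h t := by
      ext x
      rw [← hP a x]
      ring
    have hi' := intervalIntegrable_of_locallyIntegrable hi a b
    have ac := hi'.absolutelyContinuousOnInterval_intervalIntegral (c := a) (by simp)
    constructor
    · rw [e]
      have hc : AbsolutelyContinuousOnInterval (fun _ : ℝ => P a) a b :=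
        (LipschitzWith.const (P a)).lipschitzOnWith.absolutelyContinuousOnInterval
      exact hc.add ac
    · filter_upwards [hi'.ae_hasDerivAt_integral] with x hx hxm
      rw [e]
      exact (hx hxm a (by simp)).const_add _
  obtain ⟨ac₁, d₁⟩ := key i₁ hP₁
  obtain ⟨ac₂, d₂⟩ := key i₂ hP₂
  rw [← ac₁.integral_deriv_mul_eq_sub ac₂]
  refine intervalIntegral.integral_congr_ae ?_
  filter_upwards [d₁, d₂] with x h1 h2 hx
  have hx' := Set.uIoc_subset_uIcc hx
  rw [(h1 hx').deriv, (h2 hx').deriv]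

theorem continuous_of_primitive {h P : ℝ → ℝ} (hi : LocallyIntegrable h volume)
    (hP : ∀ a b, P b - P a = ∫ t in a..b, h t) : Continuous P := by
  have e : P = fun x => P 0 + ∫ t in (0 : ℝ)..x, h t := by
    ext x
    rw [← hP 0 x]
    ring
  rw [e]
  exact continuous_const.add
    (intervalIntegral.continuous_primitive (fun a b => intervalIntegrable_of_locallyIntegrable hi a b) 0)

theorem IsTest.exists_bound {φ : ℝ → ℝ} (h : IsTest φ) :
    ∃ T : ℝ, 0 < T ∧ ∀ x, T ≤ |x| → φ x = 0 := by
  obtain ⟨R, hR⟩ := h.2.isCompact.isBounded.exists_norm_le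
  refine ⟨|R| + 1, by positivity, fun x hx => ?_⟩
  by_contra h0
  have := hR x (subset_tsupport _ h0)
  rw [Real.norm_eq_abs] at this
  linarith [le_abs_self R]

theorem integral_eq_intervalIntegral_of_bound {f : ℝ → ℝ} {T : ℝ} (hT : 0 < T)
    (h : ∀ x, T ≤ |x| → f x = 0) : ∫ x, f x = ∫ x in (-T)..T, f x := by
  rw [intervalIntegral.integral_of_le (by linarith), setIntegral_eq_integral_of_forall_compl_eq_zero]
  intro x hx
  refine h x ?_
  by_contra hlt
  push Not at hlt
  exact hx ⟨(abs_lt.1 hlt).1, (abs_lt.1 hlt).2.le⟩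

theorem IsTest.deriv_primitive {φ : ℝ → ℝ} (h : IsTest φ) (a b : ℝ) :
    φ b - φ a = ∫ t in a..b, deriv φ t := by
  have hc : Continuous (deriv φ) := by
    have := (h.fderiv_apply 1).continuous
    simpa only [fderiv_apply_one_eq_deriv] using this
  rw [intervalIntegral.integral_deriv_eq_sub (fun x _ => h.differentiable x) (hc.intervalIntegrable a b)]

theorem IsTest.deriv {φ : ℝ → ℝ} (h : IsTest φ) : IsTest (deriv φ) := by
  have h1 := h.fderiv_apply 1
  simpa only [fderiv_apply_one_eq_deriv] using h1

/-- A primitive has its density as weak derivative. -/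
theorem hasWeakDeriv_of_primitive {h P : ℝ → ℝ} (hi : LocallyIntegrable h volume)
    (hP : ∀ a b, P b - P a = ∫ t in a..b, h t) : HasWeakDeriv P 1 h := by
  refine ⟨(continuous_of_primitive hi hP).locallyIntegrable, hi, fun φ hφ => ?_⟩
  simp only [fderiv_apply_one_eq_deriv, smul_eq_mul]
  obtain ⟨T, hT, hb⟩ := hφ.exists_bound
  obtain ⟨T', hT', hb'⟩ := hφ.deriv.exists_bound
  set S := max T T'
  have hS : 0 < S := lt_max_of_lt_left hT
  have hbS : ∀ x, S ≤ |x| → φ x = 0 := fun x hx => hb x ((le_max_left _ _).trans hx)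
  have hbS' : ∀ x, S ≤ |x| → _root_.deriv φ x = 0 := fun x hx => hb' x ((le_max_right _ _).trans hx)
  rw [integral_eq_intervalIntegral_of_bound hS (f := fun x => _root_.deriv φ x * P x)
      (fun x hx => by simp [hbS' x hx]),
    integral_eq_intervalIntegral_of_bound hS (f := fun x => φ x * h x) (fun x hx => by simp [hbS x hx])]
  have key := integral_primitive_mul hφ.deriv.continuous.locallyIntegrable hi hφ.deriv_primitive hP (-S) S
  rw [hbS S (le_abs_self S), hbS (-S) (by rw [abs_neg]; exact le_abs_self S)] at key
  have i1 : IntervalIntegrable (fun t => _root_.deriv φ t * P t) volume (-S) S :=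
    (hφ.deriv.continuous.mul (continuous_of_primitive hi hP)).intervalIntegrable _ _
  have i2 : IntervalIntegrable (fun t => φ t * h t) volume (-S) S :=
    (hφ.integrable_smul hi).intervalIntegrable
  rw [intervalIntegral.integral_add i1 i2] at key
  linarith

/-- The primitive from far left vanishes on the left, and the zero mean makes it vanish on the right
as well. -/
theorem isTest_primitive {η : ℝ → ℝ} (hη : IsTest η) (h0 : ∫ x, η x = 0) :
    ∃ ψ : ℝ → ℝ, IsTest ψ ∧ ∀ x, deriv ψ x = η x := by
  obtain ⟨T, hT, hb⟩ := hη.exists_bound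
  have hd : ∀ x, HasDerivAt (fun x => ∫ t in (-T)..x, η t) (η x) x := fun x =>
    intervalIntegral.integral_hasDerivAt_right (hη.continuous.intervalIntegrable _ _)
      (hη.continuous.stronglyMeasurableAtFilter _ _) hη.continuous.continuousAt
  have hde : deriv (fun x => ∫ t in (-T)..x, η t) = η := funext fun x => (hd x).deriv
  refine ⟨fun x => ∫ t in (-T)..x, η t, ⟨?_, ?_⟩, fun x => (hd x).deriv⟩
  · rw [contDiff_infty_iff_deriv, hde]
    exact ⟨fun x => (hd x).differentiableAt, hη.1⟩
  · refine HasCompactSupport.of_support_subset_isCompact (isCompact_Icc (a := -T) (b := T)) fun x hx => ?_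
    by_contra hxn
    apply hx
    have hz : ∀ a b : ℝ, (∀ t ∈ Set.uIcc a b, T ≤ |t|) → ∫ t in a..b, η t = 0 := fun a b hab => by
      rw [intervalIntegral.integral_congr (g := fun _ => 0) fun t ht => hb t (hab t ht)]
      simp
    rw [Set.mem_Icc, not_and_or] at hxn
    push Not at hxn
    rcases hxn with h | h
    · refine hz _ _ fun t ht => ?_
      rw [Set.uIcc_of_ge h.le] at ht
      rw [le_abs]
      right
      linarith [ht.2]
    · have h1 : ∫ t in (-T)..T, η t = 0 := by
        rw [← integral_eq_intervalIntegral_of_bound hT hb, h0]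
      have h2 : ∫ t in T..x, η t = 0 := hz _ _ fun t ht => by
        rw [Set.uIcc_of_le h.le] at ht
        exact ht.1.trans (le_abs_self t)
      change ∫ t in (-T)..x, η t = 0
      rw [← intervalIntegral.integral_add_adjacent_intervals (hη.continuous.intervalIntegrable _ _)
        (hη.continuous.intervalIntegrable T x), h1, h2, add_zero]

/-- Du Bois-Reymond: for a fixed bump χ of integral one, φ - (∫φ)χ has mean zero, hence is the
derivative of a test function. -/
theorem ae_eq_const_of_hasWeakDeriv_zero {v : ℝ → ℝ} (h : HasWeakDeriv v 1 (fun _ => 0)) :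
    ∃ c : ℝ, v =ᵐ[volume] fun _ => c := by
  obtain ⟨ρ, hρ, -, hρ1, -⟩ := exists_mollifier_seq (E := ℝ)
  set χ := ρ 0
  have hχ : IsTest χ := hρ 0
  refine ⟨∫ x, χ x * v x, ?_⟩
  refine ae_eq_of_integral_contDiff_smul_eq h.1 continuous_const.locallyIntegrable fun φ hφ hc => ?_
  have ht : IsTest φ := ⟨hφ, hc⟩
  have iφ : Integrable φ volume := ht.continuous.integrable_of_hasCompactSupport hc
  have iχ : Integrable χ volume := hχ.continuous.integrable_of_hasCompactSupport hχ.2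
  obtain ⟨ψ, hψ, hd⟩ := isTest_primitive (ht.sub (hχ.const_mul (∫ x, φ x))) (by
    rw [integral_sub iφ (iχ.const_mul _), integral_const_mul, hρ1 0]
    ring)
  have h1 := h.2.2 ψ hψ
  simp only [fderiv_apply_one_eq_deriv, hd, smul_eq_mul, mul_zero, integral_zero, neg_zero, sub_mul] at h1
  have i1 : Integrable (fun x => φ x * v x) volume := ht.integrable_smul h.1
  have i2 : Integrable (fun x => (∫ x, φ x) * χ x * v x) volume :=
    (hχ.const_mul (∫ x, φ x)).integrable_smul h.1
  rw [integral_sub i1 i2] at h1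
  simp only [mul_assoc] at h1
  rw [integral_const_mul] at h1
  simp only [smul_eq_mul]
  rw [integral_mul_const]
  linarith

/-- A function with a weak derivative is almost everywhere equal to a primitive. -/
theorem HasWeakDeriv.exists_primitive {u g : ℝ → ℝ} (h : HasWeakDeriv u 1 g) :
    ∃ U : ℝ → ℝ, u =ᵐ[volume] U ∧ ∀ a b, U b - U a = ∫ t in a..b, g t := by
  have ii := fun a b => intervalIntegrable_of_locallyIntegrable h.2.1 a b
  have hG : ∀ a b, (∫ t in (0 : ℝ)..b, g t) - (∫ t in (0 : ℝ)..a, g t) = ∫ t in a..b, g t :=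
    fun a b => intervalIntegral.integral_interval_sub_left (ii 0 b) (ii 0 a)
  have hw := hasWeakDeriv_of_primitive h.2.1 hG
  have h0 := h.sub hw
  simp only [sub_self] at h0
  obtain ⟨c, hc⟩ := ae_eq_const_of_hasWeakDeriv_zero h0
  refine ⟨fun x => c + ∫ t in (0 : ℝ)..x, g t, ?_, fun a b => ?_⟩
  · filter_upwards [hc] with x hx
    linarith
  · rw [← hG a b]
    ring

/-- Classical representatives of a function with two weak derivatives. -/
theorem exists_classical {w h : ℝ → ℝ} (hw : MemH1 w) (hh : HasWeakDeriv (weakDeriv 1 w) 1 h) :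
    ∃ W P : ℝ → ℝ, w =ᵐ[volume] W ∧ weakDeriv 1 w =ᵐ[volume] P ∧ (∀ z, HasDerivAt W (P z) z) ∧
      ∀ a b, P b - P a = ∫ t in a..b, h t := by
  obtain ⟨W, hW, hWp⟩ := (hw.hasWeakDeriv 1).exists_primitive
  obtain ⟨P, hP, hPp⟩ := hh.exists_primitive
  have hPc := continuous_of_primitive hh.2.1 hPp
  refine ⟨W, P, hW, hP, fun z => ?_, hPp⟩
  have e : W = fun x => W 0 + ∫ t in (0 : ℝ)..x, P t := by
    ext x
    have : ∫ t in (0 : ℝ)..x, weakDeriv 1 w t = ∫ t in (0 : ℝ)..x, P t :=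
      intervalIntegral.integral_congr_ae (by filter_upwards [hP] with t ht _ using ht)
    rw [← this, ← hWp 0 x]
    ring
  rw [e]
  exact (intervalIntegral.integral_hasDerivAt_right (hPc.intervalIntegrable _ _)
    (hPc.stronglyMeasurableAtFilter _ _) hPc.continuousAt).const_add _

/-- Provides arbitrarily distant points where boundary terms are small, in place of pointwise decay
at infinity. -/
theorem exists_large_lt_of_integrable {f : ℝ → ℝ} (hf : Integrable f volume)
    (N : ℝ) {δ : ℝ} (hδ : 0 < δ) : ∃ T, N ≤ T ∧ f T < δ := by
  by_contra h
  push Not at h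
  have h1 : IntegrableOn (fun _ : ℝ => δ) (Set.Ici N) volume := by
    refine Integrable.mono' (hf.integrableOn (s := Set.Ici N)) (by fun_prop) ?_
    filter_upwards [ae_restrict_mem measurableSet_Ici] with x hx
    rw [Real.norm_of_nonneg hδ.le]
    exact h x hx
  simp [integrableOn_const_iff, hδ.ne'] at h1

/-- Write U(z)² = U(T)² - ∫2UU' with T far out and U(T) small. -/
theorem sq_le_of_primitive {g U : ℝ → ℝ} (hU : MemLp U 2 volume) (hg : MemLp g 2 volume)
    (hp : ∀ a b, U b - U a = ∫ t in a..b, g t) (z : ℝ) : U z ^ 2 ≤ 2 * (l2Norm U * l2Norm g) := by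
  have hgl : LocallyIntegrable g volume := hg.locallyIntegrable (by norm_num)
  refine le_of_forall_pos_le_add fun δ hδ => ?_
  obtain ⟨T, hT, hlt⟩ := exists_large_lt_of_integrable hU.integrable_sq z hδ
  have h1 := integral_primitive_mul hgl hgl hp hp z T
  have h2 : |∫ t in z..T, (g t * U t + U t * g t)| ≤ ∫ t, |2 * (U t * g t)| := by
    rw [intervalIntegral.integral_of_le hT]
    refine (abs_integral_le_integral_abs).trans ?_
    have e : ∀ t, |g t * U t + U t * g t| = |2 * (U t * g t)| := fun t => by congr 1; ring
    simp only [e]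
    exact setIntegral_le_integral ((integrable_mul_of_memLp hU hg).const_mul 2).abs
      (.of_forall fun t => abs_nonneg _)
  have h3 : ∫ t, |2 * (U t * g t)| ≤ 2 * (l2Norm U * l2Norm g) := by
    simp only [abs_mul (2 : ℝ), abs_two]
    rw [integral_const_mul]
    have := integral_abs_mul_le hU hg
    linarith
  have h4 := (abs_le.1 h2).1
  nlinarith

theorem MemH1.ae_sq_le {w : ℝ → ℝ} (hw : MemH1 w) :
    ∀ᵐ z, w z ^ 2 ≤ 2 * (l2Norm w * l2Norm (weakDeriv 1 w)) := by
  obtain ⟨W, hW, hp⟩ := (hw.hasWeakDeriv 1).exists_primitive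
  have hWm : MemLp W 2 volume := hw.1.ae_eq hW
  filter_upwards [hW] with z hz
  rw [hz, l2Norm_congr_ae hW]
  exact sq_le_of_primitive hWm (hw.memLp_weakDeriv 1) hp z

/-- Radial monotonicity almost everywhere passes to a continuous representative. -/
theorem radial_of_ae {w W : ℝ → ℝ} {G : Set ℝ} (hG : ∀ᵐ z, z ∈ G)
    (hw : ∀ z ∈ G, ∀ z' ∈ G, |z| ≤ |z'| → w z' ≤ w z) (hW : w =ᵐ[volume] W) (hc : Continuous W) :
    ∀ z z' : ℝ, |z| ≤ |z'| → W z' ≤ W z := by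
  have hdense : Dense {z | z ∈ G ∧ w z = W z} := by
    refine Measure.dense_of_ae (μ := (volume : Measure ℝ)) ?_
    filter_upwards [hG, hW] with z h1 h2 using ⟨h1, h2⟩
  have hlt : ∀ z z' : ℝ, |z| < |z'| → W z' ≤ W z := by
    intro z z' hzz
    by_contra hcon
    push Not at hcon
    have ho : IsOpen {p : ℝ × ℝ | |p.1| < |p.2| ∧ W p.1 < W p.2} :=
      (isOpen_lt (f := fun p : ℝ × ℝ => |p.1|) (g := fun p => |p.2|) (by fun_prop) (by fun_prop)).inter
        (isOpen_lt (f := fun p : ℝ × ℝ => W p.1) (g := fun p => W p.2) (by fun_prop) (by fun_prop))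
    obtain ⟨p, hp1, hp2⟩ := (hdense.prod hdense).inter_open_nonempty _ ho ⟨(z, z'), hzz, hcon⟩
    have := hw p.1 hp2.1.1 p.2 hp2.2.1 hp1.1.le
    rw [hp2.1.2, hp2.2.2] at this
    exact absurd this (not_le.2 hp1.2)
  intro z z' hzz
  by_cases h0 : z' = 0
  · have : z = 0 := by
      rw [h0, abs_zero] at hzz
      exact abs_eq_zero.1 (le_antisymm hzz (abs_nonneg _))
    rw [h0, this]
  -- When |z| = |z'| the strict case does not apply directly; it does to tz' with t > 1, and t
  -- decreases to 1.
  have hcl : Tendsto (fun t : ℝ => W (t * z')) (𝓝[>] 1) (𝓝 (W z')) := by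
    have : Continuous fun t : ℝ => W (t * z') := by fun_prop
    have := (this.tendsto 1).mono_left (nhdsWithin_le_nhds (s := Set.Ioi 1))
    simpa using this
  refine le_of_tendsto hcl ?_
  filter_upwards [eventually_mem_nhdsWithin] with t ht
  refine hlt _ _ (hzz.trans_lt ?_)
  rw [abs_mul]
  have h1 : (1 : ℝ) < |t| := lt_of_lt_of_le ht (le_abs_self t)
  nlinarith [abs_pos.2 h0]

end Line

/-! ### Approximate solitons: a priori estimates -/

section Stability

theorem abs_intervalIntegral_le {f : ℝ → ℝ} (hf : Integrable f volume) (a b : ℝ) :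
    |∫ t in a..b, f t| ≤ ∫ t, |f t| := by
  rw [← Real.norm_eq_abs]
  refine (intervalIntegral.norm_integral_le_integral_norm_uIoc (f := f)).trans ?_
  exact setIntegral_le_integral hf.norm (.of_forall fun t => norm_nonneg _)

/-- `w` is a nonnegative, even and radially nonincreasing solution, with derivative `p`, of the
perturbed equation `w'' = μ w - w³ / 2π + R` with `‖R‖_{L¹} ≤ ε`. -/
structure IsApproxSoliton (μ ε : ℝ) (w p R : ℝ → ℝ) : Prop where
  hasDerivAt : ∀ z, HasDerivAt w (p z) z
  primitive : ∀ a b, p b - p a = ∫ t in a..b, (μ * w t - w t ^ 3 / (2 * Real.pi) + R t)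
  integrable : Integrable R volume
  integral_abs_le : ∫ t, |R t| ≤ ε
  radial : ∀ z z', |z| ≤ |z'| → w z' ≤ w z
  nonneg : ∀ z, 0 ≤ w z
  memLp : MemLp w 2 volume
  memLp_deriv : MemLp p 2 volume

namespace IsApproxSoliton

variable {μ ε : ℝ} {w p R : ℝ → ℝ}

theorem continuous (h : IsApproxSoliton μ ε w p R) : Continuous w :=
  continuous_iff_continuousAt.2 fun z => (h.hasDerivAt z).continuousAt

theorem locallyIntegrable (h : IsApproxSoliton μ ε w p R) :
    LocallyIntegrable (fun t => μ * w t - w t ^ 3 / (2 * Real.pi) + R t) volume := by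
  have hc := h.continuous
  have : Continuous fun t => μ * w t - w t ^ 3 / (2 * Real.pi) := by fun_prop
  exact this.locallyIntegrable.add h.integrable.locallyIntegrable

theorem continuous_deriv (h : IsApproxSoliton μ ε w p R) : Continuous p :=
  continuous_of_primitive h.locallyIntegrable h.primitive

theorem le_zero (h : IsApproxSoliton μ ε w p R) (z : ℝ) : w z ≤ w 0 :=
  h.radial 0 z (by simp)

theorem even (h : IsApproxSoliton μ ε w p R) (z : ℝ) : w (-z) = w z :=
  le_antisymm (h.radial _ _ (by simp)) (h.radial _ _ (by simp))

theorem deriv_zero (h : IsApproxSoliton μ ε w p R) : p 0 = 0 :=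
  IsLocalMax.hasDerivAt_eq_zero (.of_forall fun z => h.le_zero z) (h.hasDerivAt 0)

theorem odd (h : IsApproxSoliton μ ε w p R) (z : ℝ) : p (-z) = -p z := by
  have h1 : HasDerivAt (fun z => w (-z)) (-p (-z)) z :=
    ((h.hasDerivAt (-z)).comp z (hasDerivAt_neg z)).congr_deriv (by ring)
  have h2 : (fun z => w (-z)) = w := funext h.even
  rw [h2] at h1
  have := h1.unique (h.hasDerivAt z)
  linarith

theorem primitive_self (h : IsApproxSoliton μ ε w p R) (a b : ℝ) : w b - w a = ∫ t in a..b, p t :=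
  (intervalIntegral.integral_eq_sub_of_hasDerivAt (fun z _ => h.hasDerivAt z)
    (h.continuous_deriv.intervalIntegrable a b)).symm

theorem abs_integral_le (h : IsApproxSoliton μ ε w p R) (a b : ℝ) : |∫ t in a..b, R t| ≤ ε := by
  exact (abs_intervalIntegral_le h.integrable a b).trans h.integral_abs_le

/-- By the mean value theorem |p| ≤ K somewhere in (z, z+1); integrating the equation from there to
z changes p by at most K² + K³ + 1. -/
theorem abs_deriv_le (h : IsApproxSoliton μ ε w p R) {K : ℝ} (hμ0 : 0 ≤ μ) (hμ : μ ≤ K)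
    (hK : w 0 ≤ K) (hε : ε ≤ 1) (z : ℝ) : |p z| ≤ K + K ^ 2 + K ^ 3 + 1 := by
  have hw : ∀ t, 0 ≤ w t ∧ w t ≤ K := fun t => ⟨h.nonneg t, (h.le_zero t).trans hK⟩
  have hK0 : 0 ≤ K := hμ0.trans hμ
  obtain ⟨s, hs, he⟩ := exists_hasDerivAt_eq_slope w p (by linarith : z < z + 1)
    h.continuous.continuousOn (fun x _ => h.hasDerivAt x)
  have h1 : |p s| ≤ K := by
    rw [he, show z + 1 - z = 1 by ring, div_one, abs_le]
    constructor <;> linarith [(hw z).1, (hw z).2, (hw (z + 1)).1, (hw (z + 1)).2]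
  have hp := h.primitive z s
  have hc := h.continuous
  have i1 : IntervalIntegrable (fun t => μ * w t - w t ^ 3 / (2 * Real.pi)) volume z s :=
    Continuous.intervalIntegrable (by fun_prop) _ _
  rw [intervalIntegral.integral_add i1 h.integrable.intervalIntegrable] at hp
  have h2 : |∫ t in z..s, (μ * w t - w t ^ 3 / (2 * Real.pi))| ≤ (K ^ 2 + K ^ 3) * |s - z| := by
    rw [← Real.norm_eq_abs]
    refine intervalIntegral.norm_integral_le_of_norm_le_const fun t _ => ?_
    rw [Real.norm_eq_abs]
    refine (abs_sub _ _).trans ?_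
    have b0 := (hw t).1
    have b1 := (hw t).2
    rw [abs_of_nonneg (by positivity), abs_of_nonneg (by positivity)]
    have h3 : μ * w t ≤ K * K := mul_le_mul hμ b1 b0 hK0
    have h4 : w t ^ 3 / (2 * Real.pi) ≤ K ^ 3 := by
      rw [div_le_iff₀ (by positivity)]
      have : w t ^ 3 ≤ K ^ 3 := by gcongr
      have : K ^ 3 * 1 ≤ K ^ 3 * (2 * Real.pi) := by gcongr; linarith [Real.pi_gt_three]
      linarith
    nlinarith
  have h5 : |s - z| ≤ 1 := by rw [abs_le]; constructor <;> linarith [hs.1, hs.2]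
  have h6 : (K ^ 2 + K ^ 3) * |s - z| ≤ K ^ 2 + K ^ 3 := mul_le_of_le_one_right (by positivity) h5
  have h7 := h.abs_integral_le z s
  rw [abs_le] at *
  constructor <;> linarith [h1.1, h1.2, h2.1, h2.2, h7.1, h7.2]

theorem exists_large_small (h : IsApproxSoliton μ ε w p R) (N : ℝ) {δ : ℝ} (hδ : 0 < δ) :
    ∃ T, N ≤ T ∧ w T ^ 2 + p T ^ 2 < δ :=
  exists_large_lt_of_integrable (h.memLp.integrable_sq.add h.memLp_deriv.integrable_sq) N hδ

/-- Conservation of energy, up to the perturbation. -/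
theorem abs_energy_zero_le (h : IsApproxSoliton μ ε w p R) {K : ℝ} (hμ0 : 0 ≤ μ) (hμ : μ ≤ K)
    (hK : w 0 ≤ K) (hε : ε ≤ 1) :
    |w 0 ^ 2 * (μ - w 0 ^ 2 / (4 * Real.pi))| ≤ 2 * (K + K ^ 2 + K ^ 3 + 1) * ε := by
  have hK0 : 0 ≤ K := hμ0.trans hμ
  have hc := h.continuous
  have hcp := h.continuous_deriv
  have hB := h.abs_deriv_le hμ0 hμ hK hε
  set B := K + K ^ 2 + K ^ 3 + 1 with hBdef
  refine le_of_forall_pos_le_add fun δ hδ => ?_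
  obtain ⟨T, hT0, hT⟩ := h.exists_large_small 0 (by positivity : 0 < δ / (K + K ^ 2 + 1))
  have e1 := integral_primitive_mul h.locallyIntegrable h.locallyIntegrable h.primitive h.primitive 0 T
  -- The function μw² - w⁴/4π is the potential part of the energy: for R = 0 its difference with p²
  -- is conserved. Here p(0) = 0, and at T both w and p are small.
  have hG : ∀ z ∈ Set.uIcc 0 T, HasDerivAt (fun z => μ * w z ^ 2 - w z ^ 4 / (4 * Real.pi))
      (2 * (p z * (μ * w z - w z ^ 3 / (2 * Real.pi)))) z := fun z _ => by
    have := (((h.hasDerivAt z).pow 2).const_mul μ).sub (((h.hasDerivAt z).pow 4).div_const (4 * Real.pi))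
    refine this.congr_deriv ?_
    push_cast
    field_simp
  have i1 : IntervalIntegrable (fun z => 2 * (p z * (μ * w z - w z ^ 3 / (2 * Real.pi)))) volume 0 T :=
    Continuous.intervalIntegrable (by fun_prop) _ _
  have e2 := intervalIntegral.integral_eq_sub_of_hasDerivAt hG i1
  have iR : Integrable (fun t => 2 * (p t * R t)) volume := by
    refine (h.integrable.bdd_mul (c := B) hcp.aestronglyMeasurable (.of_forall hB)).const_mul 2
  have e3 : ∫ t in (0 : ℝ)..T, ((μ * w t - w t ^ 3 / (2 * Real.pi) + R t) * p t
      + p t * (μ * w t - w t ^ 3 / (2 * Real.pi) + R t))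
      = (∫ t in (0 : ℝ)..T, 2 * (p t * (μ * w t - w t ^ 3 / (2 * Real.pi))))
        + ∫ t in (0 : ℝ)..T, 2 * (p t * R t) := by
    rw [← intervalIntegral.integral_add i1 iR.intervalIntegrable]
    congr 1
    ext t
    ring
  have e4 : |∫ t in (0 : ℝ)..T, 2 * (p t * R t)| ≤ 2 * B * ε := by
    refine (abs_intervalIntegral_le iR 0 T).trans ?_
    calc ∫ t, |2 * (p t * R t)| ≤ ∫ t, 2 * B * |R t| := by
          refine integral_mono iR.abs (h.integrable.abs.const_mul _) fun t => ?_
          simp only [abs_mul, abs_two]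
          have := mul_le_mul_of_nonneg_right (hB t) (abs_nonneg (R t))
          linarith
      _ = 2 * B * ∫ t, |R t| := integral_const_mul _ _
      _ ≤ 2 * B * ε := by gcongr; exact h.integral_abs_le
  have hwT0 := h.nonneg T
  have hwTK := (h.le_zero T).trans hK
  have e5 : |μ * w T ^ 2 - w T ^ 4 / (4 * Real.pi)| ≤ (K + K ^ 2) * w T ^ 2 := by
    refine (abs_sub _ _).trans ?_
    rw [abs_of_nonneg (by positivity), abs_of_nonneg (by positivity)]
    have h1 : μ * w T ^ 2 ≤ K * w T ^ 2 := by gcongr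
    have h2 : w T ^ 4 / (4 * Real.pi) ≤ K ^ 2 * w T ^ 2 := by
      rw [div_le_iff₀ (by positivity)]
      have h3 : w T ^ 4 ≤ K ^ 2 * w T ^ 2 := by
        have : w T ^ 2 ≤ K ^ 2 := by gcongr
        nlinarith [sq_nonneg (w T)]
      have h4 : K ^ 2 * w T ^ 2 * 1 ≤ K ^ 2 * w T ^ 2 * (4 * Real.pi) := by
        gcongr
        linarith [Real.pi_gt_three]
      linarith
    linarith
  rw [h.deriv_zero] at e1
  have e6 : (K + K ^ 2) * w T ^ 2 + p T ^ 2 ≤ δ := by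
    rw [lt_div_iff₀ (by positivity)] at hT
    nlinarith [sq_nonneg (w T), sq_nonneg (p T), mul_nonneg hK0 (sq_nonneg (p T)),
      mul_nonneg (sq_nonneg K) (sq_nonneg (p T))]
  have e7 : w 0 ^ 2 * (μ - w 0 ^ 2 / (4 * Real.pi)) = μ * w 0 ^ 2 - w 0 ^ 4 / (4 * Real.pi) := by ring
  rw [e7]
  rw [abs_le] at *
  constructor <;> nlinarith [e4.1, e4.2, e5.1, e5.2]

/-- On [0, z] monotonicity gives w ≥ w(z). This is the decay that makes the tail potential positive.
-/
theorem mul_sq_le_mass (h : IsApproxSoliton μ ε w p R) {z : ℝ} (hz : 0 ≤ z) :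
    z * w z ^ 2 ≤ mass w := by
  have h1 : ∫ _ in (0 : ℝ)..z, w z ^ 2 ≤ ∫ t in (0 : ℝ)..z, w t ^ 2 := by
    refine intervalIntegral.integral_mono_on hz (by simp) ((h.continuous.pow 2).intervalIntegrable _ _)
      fun t ht => ?_
    have := h.radial t z (by rw [abs_of_nonneg ht.1, abs_of_nonneg hz]; exact ht.2)
    have := h.nonneg z
    gcongr
  rw [intervalIntegral.integral_const, smul_eq_mul, sub_zero] at h1
  refine h1.trans ?_
  rw [intervalIntegral.integral_of_le hz, mass_eq_integral_sq]
  exact setIntegral_le_integral h.memLp.integrable_sq (.of_forall fun t => sq_nonneg _)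

end IsApproxSoliton

end Stability

/-! ### Stability of approximate solitons -/

section Stability

namespace IsApproxSoliton

variable {μ ε : ℝ} {w p R w' p' R' : ℝ → ℝ}

theorem eps_nonneg (h : IsApproxSoliton μ ε w p R) : 0 ≤ ε :=
  (integral_nonneg fun _ => abs_nonneg _).trans h.integral_abs_le

/-- The potential in the linear equation satisfied by the difference of two solutions. -/
def diffPotential (μ : ℝ) (w w' : ℝ → ℝ) (t : ℝ) : ℝ :=
  μ - (w t ^ 2 + w t * w' t + w' t ^ 2) / (2 * Real.pi)

theorem continuous_diffPotential (h : IsApproxSoliton μ ε w p R)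
    (h' : IsApproxSoliton μ ε w' p' R') : Continuous (diffPotential μ w w') := by
  have := h.continuous
  have := h'.continuous
  unfold diffPotential
  fun_prop

theorem sub_primitive (h : IsApproxSoliton μ ε w p R) (h' : IsApproxSoliton μ ε w' p' R')
    (a b : ℝ) : (p b - p' b) - (p a - p' a)
      = ∫ t in a..b, (diffPotential μ w w' t * (w t - w' t) + (R t - R' t)) := by
  have e1 := h.primitive a b
  have e2 := h'.primitive a b
  rw [show p b - p' b - (p a - p' a) = (p b - p a) - (p' b - p' a) by ring, e1, e2,
    ← intervalIntegral.integral_sub (intervalIntegrable_of_locallyIntegrable h.locallyIntegrable _ _)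
      (intervalIntegrable_of_locallyIntegrable h'.locallyIntegrable _ _)]
  congr 1
  ext t
  unfold diffPotential
  ring

/-- Near-zero energy says w(0)²(μ - w(0)²/4π) = O(ε). The lower bound a on w(0) excludes the trivial
branch, so both w(0)² and w'(0)² are within O(ε) of 4πμ. -/
theorem abs_sub_zero_le (h : IsApproxSoliton μ ε w p R) (h' : IsApproxSoliton μ ε w' p' R')
    {K a : ℝ} (ha : 0 < a) (hμ0 : 0 ≤ μ) (hμ : μ ≤ K) (hK : w 0 ≤ K) (hK' : w' 0 ≤ K)
    (hε : ε ≤ 1) (hw : a ≤ w 0) (hw' : a ≤ w' 0) :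
    |w 0 - w' 0| ≤ 8 * Real.pi * (K + K ^ 2 + K ^ 3 + 1) / a ^ 3 * ε := by
  have key : ∀ {w p R}, IsApproxSoliton μ ε w p R → w 0 ≤ K → a ≤ w 0 →
      |μ - w 0 ^ 2 / (4 * Real.pi)| ≤ 2 * (K + K ^ 2 + K ^ 3 + 1) * ε / a ^ 2 := by
    intro w p R h hK hw
    have := h.abs_energy_zero_le hμ0 hμ hK hε
    rw [abs_mul, abs_of_nonneg (sq_nonneg _)] at this
    rw [le_div_iff₀ (by positivity), mul_comm]
    refine le_trans ?_ this
    gcongr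
  have h1 := key h hK hw
  have h2 := key h' hK' hw'
  have hB : 2 * (K + K ^ 2 + K ^ 3 + 1) * ε / a ^ 2
      = (8 * Real.pi * (K + K ^ 2 + K ^ 3 + 1) / a ^ 3 * ε) * a / (4 * Real.pi) := by
    field_simp
    ring
  rw [hB] at h1 h2
  set D := 8 * Real.pi * (K + K ^ 2 + K ^ 3 + 1) / a ^ 3 * ε
  have h3 : |(w 0 ^ 2 - w' 0 ^ 2) / (4 * Real.pi)| ≤ 2 * (D * a / (4 * Real.pi)) := by
    rw [abs_le] at *
    rw [sub_div]
    constructor <;> linarith [h1.1, h1.2, h2.1, h2.2]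
  rw [abs_div, abs_of_pos (by positivity : 0 < 4 * Real.pi), ← mul_div_assoc,
    div_le_div_iff_of_pos_right (by positivity)] at h3
  have h4 : |w 0 - w' 0| * (2 * a) ≤ |w 0 ^ 2 - w' 0 ^ 2| := by
    rw [show w 0 ^ 2 - w' 0 ^ 2 = (w 0 - w' 0) * (w 0 + w' 0) by ring, abs_mul,
      abs_of_pos (by linarith : 0 < w 0 + w' 0)]
    gcongr
    linarith
  nlinarith

theorem abs_diffPotential_le (h : IsApproxSoliton μ ε w p R) (h' : IsApproxSoliton μ ε w' p' R')
    {K : ℝ} (hμ0 : 0 ≤ μ) (hμ : μ ≤ K) (hK : w 0 ≤ K) (hK' : w' 0 ≤ K) (t : ℝ) :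
    |diffPotential μ w w' t| ≤ K + K ^ 2 := by
  have b0 := h.nonneg t
  have b1 := (h.le_zero t).trans hK
  have b0' := h'.nonneg t
  have b1' := (h'.le_zero t).trans hK'
  have h1 : (w t ^ 2 + w t * w' t + w' t ^ 2) / (2 * Real.pi) ≤ K ^ 2 := by
    rw [div_le_iff₀ (by positivity)]
    have : w t ^ 2 ≤ K ^ 2 := by gcongr
    have : w' t ^ 2 ≤ K ^ 2 := by gcongr
    have : w t * w' t ≤ K * K := mul_le_mul b1 b1' b0' (by linarith)
    nlinarith [Real.pi_gt_three, mul_nonneg (sq_nonneg K) (by linarith [Real.pi_gt_three] : 0 ≤ Real.pi - 3)]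
  have h2 : 0 ≤ (w t ^ 2 + w t * w' t + w' t ^ 2) / (2 * Real.pi) := by positivity
  unfold diffPotential
  rw [abs_le]
  constructor <;> nlinarith [sq_nonneg K]

/-- Beyond m/c the mass bound forces both squares below c, so the nonlinear part is at most 3c/2π ≤
c/2. -/
theorem half_le_diffPotential (h : IsApproxSoliton μ ε w p R) (h' : IsApproxSoliton μ ε w' p' R')
    {c m : ℝ} (hc : 0 < c) (hμ : c ≤ μ) (hm : 0 < m) (hw : mass w ≤ m) (hw' : mass w' ≤ m) {t : ℝ}
    (ht : m / c ≤ t) : c / 2 ≤ diffPotential μ w w' t := by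
  have ht0 : 0 < t := lt_of_lt_of_le (by positivity) ht
  have key : ∀ {w p R}, IsApproxSoliton μ ε w p R → mass w ≤ m → w t ^ 2 ≤ c := by
    intro w p R h hw
    have h1 := (h.mul_sq_le_mass ht0.le).trans hw
    rw [div_le_iff₀ hc] at ht
    nlinarith
  have k1 := key h hw
  have k2 := key h' hw'
  have h1 : (w t ^ 2 + w t * w' t + w' t ^ 2) / (2 * Real.pi) ≤ c / 2 := by
    rw [div_le_iff₀ (by positivity)]
    nlinarith [Real.pi_gt_three, sq_nonneg (w t - w' t)]
  unfold diffPotential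
  linarith

theorem abs_integral_sub_le (h : IsApproxSoliton μ ε w p R) (h' : IsApproxSoliton μ ε w' p' R')
    (a b : ℝ) : |∫ t in a..b, (R t - R' t)| ≤ 2 * ε := by
  rw [intervalIntegral.integral_sub h.integrable.intervalIntegrable h'.integrable.intervalIntegrable]
  refine (abs_sub _ _).trans ?_
  linarith [h.abs_integral_le a b, h'.abs_integral_le a b]

theorem integral_abs_sub_le (h : IsApproxSoliton μ ε w p R) (h' : IsApproxSoliton μ ε w' p' R') :
    ∫ t, |R t - R' t| ≤ 2 * ε := by
  calc ∫ t, |R t - R' t| ≤ ∫ t, (|R t| + |R' t|) :=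
        integral_mono (h.integrable.sub h'.integrable).abs (h.integrable.abs.add h'.integrable.abs)
          fun t => abs_sub _ _
    _ = (∫ t, |R t|) + ∫ t, |R' t| := integral_add h.integrable.abs h'.integrable.abs
    _ ≤ 2 * ε := by linarith [h.integral_abs_le, h'.integral_abs_le]

/-- Continuous dependence on a bounded interval. -/
theorem abs_sub_le_gronwall (h : IsApproxSoliton μ ε w p R) (h' : IsApproxSoliton μ ε w' p' R')
    {A D L : ℝ} (hA : 0 ≤ A) (hV : ∀ t, |diffPotential μ w w' t| ≤ A)
    (h0 : |w 0 - w' 0| ≤ D * ε) {t : ℝ} (ht : t ∈ Set.Icc 0 L) :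
    |w t - w' t| ≤ ((D + 2) * Real.exp ((A + 1) * L)) * ε ∧
      |p t - p' t| ≤ ((D + 2) * Real.exp ((A + 1) * L) + 2) * ε := by
  have hε0 := h.eps_nonneg
  set G : ℝ → ℝ := fun t => ∫ s in (0 : ℝ)..t, (R s - R' s) with hG
  have hGb : ∀ t, |G t| ≤ 2 * ε := fun t => h.abs_integral_sub_le h' 0 t
  set V := diffPotential μ w w' with hVd
  have hVc : Continuous fun t => V t * (w t - w' t) :=
    (h.continuous_diffPotential h').mul (h.continuous.sub h'.continuous)
  have hy : ∀ t, p t - p' t - G t = ∫ s in (0 : ℝ)..t, V s * (w s - w' s) := fun t => by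
    have := h.sub_primitive h' 0 t
    have i2 : IntervalIntegrable (fun s => R s - R' s) volume 0 t :=
      (h.integrable.sub h'.integrable).intervalIntegrable
    rw [h.deriv_zero, h'.deriv_zero, intervalIntegral.integral_add (hVc.intervalIntegrable _ _)
      i2] at this
    simp only [hG]
    linarith
  -- Since R is only integrable, p - p' need not be differentiable. Subtracting the primitive `G` of
  -- R - R' gives a C¹ first-order system with `G` as a forcing of size 2ε.
  set f : ℝ → ℝ × ℝ := fun t => (w t - w' t, ∫ s in (0 : ℝ)..t, V s * (w s - w' s)) with hf
  have hfd : ∀ t, HasDerivAt f (p t - p' t, V t * (w t - w' t)) t := fun t =>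
    ((h.hasDerivAt t).sub (h'.hasDerivAt t)).prodMk
      (intervalIntegral.integral_hasDerivAt_right (hVc.intervalIntegrable _ _)
        (hVc.stronglyMeasurableAtFilter _ _) hVc.continuousAt)
  have hgr := norm_le_gronwallBound_of_norm_deriv_right_le (f := f)
    (f' := fun t => (p t - p' t, V t * (w t - w' t))) (δ := D * ε) (K := A + 1) (ε := 2 * ε)
    (a := 0) (b := L) (fun t _ => (hfd t).continuousAt.continuousWithinAt)
    (fun t _ => (hfd t).hasDerivWithinAt) (by simpa [hf, Prod.norm_def] using h0)
    (fun t _ => by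
      have n1 : |w t - w' t| ≤ ‖f t‖ := norm_fst_le (f t)
      have n2 : |∫ s in (0 : ℝ)..t, V s * (w s - w' s)| ≤ ‖f t‖ := norm_snd_le (f t)
      have hp : p t - p' t = (∫ s in (0 : ℝ)..t, V s * (w s - w' s)) + G t := by
        have := hy t; linarith
      refine norm_prod_le_iff.2 ⟨?_, ?_⟩
      · simp only [Real.norm_eq_abs]
        rw [hp]
        refine (abs_add_le _ _).trans ?_
        nlinarith [hGb t, norm_nonneg (f t), mul_nonneg hA (norm_nonneg (f t))]
      · simp only [Real.norm_eq_abs]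
        rw [abs_mul]
        have := mul_le_mul (hV t) n1 (abs_nonneg _) hA
        nlinarith [norm_nonneg (f t)]) t ht
  have hbound : gronwallBound (D * ε) (A + 1) (2 * ε) (t - 0)
      ≤ ((D + 2) * Real.exp ((A + 1) * L)) * ε := by
    rw [gronwallBound_of_K_ne_0 (by positivity), sub_zero]
    have e1 : Real.exp ((A + 1) * t) ≤ Real.exp ((A + 1) * L) := by
      gcongr
      exact ht.2
    have e2 : 1 ≤ Real.exp ((A + 1) * t) :=
      Real.one_le_exp (mul_nonneg (by positivity) ht.1)
    have e3 : 2 * ε / (A + 1) ≤ 2 * ε := div_le_self (by positivity) (by linarith)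
    have hD : 0 ≤ D * ε := (abs_nonneg _).trans h0
    have e4 : D * ε * Real.exp ((A + 1) * t) ≤ D * ε * Real.exp ((A + 1) * L) := by gcongr
    have e5 : 2 * ε / (A + 1) * (Real.exp ((A + 1) * t) - 1) ≤ 2 * ε * Real.exp ((A + 1) * L) := by
      apply mul_le_mul e3 (by linarith) (by linarith) (by positivity)
    linarith
  have hfin := hgr.trans hbound
  have n1 : |w t - w' t| ≤ ‖f t‖ := norm_fst_le (f t)
  have n2 : |∫ s in (0 : ℝ)..t, V s * (w s - w' s)| ≤ ‖f t‖ := norm_snd_le (f t)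
  refine ⟨n1.trans hfin, ?_⟩
  have hp : p t - p' t = (∫ s in (0 : ℝ)..t, V s * (w s - w' s)) + G t := by
    have := hy t; linarith
  rw [hp]
  refine (abs_add_le _ _).trans ?_
  linarith [hGb t, n2.trans hfin]

/-- Multiply the equation for v = w - w' by v and integrate: ∫(Vv² + (v')²) equals boundary terms
minus ∫v(R - R'). Since R - R' is only in L¹, v is bounded in sup norm by its value at L and its H¹
size √X, and the √X is absorbed by Young's inequality. -/
theorem integral_tail_le_of_small (h : IsApproxSoliton μ ε w p R)
    (h' : IsApproxSoliton μ ε w' p' R') {κ B L T δ : ℝ} (hκ : 0 < κ) (hκ1 : κ ≤ 1) (hB : 0 ≤ B)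
    (hV : ∀ t, L ≤ t → κ ≤ diffPotential μ w w' t) (hLT : L ≤ T)
    (hv : |w L - w' L| ≤ B * ε) (hr : |p L - p' L| ≤ B * ε)
    (hT : |(p T - p' T) * (w T - w' T)| ≤ δ) :
    ∫ t in L..T, ((w t - w' t) ^ 2 + (p t - p' t) ^ 2)
      ≤ 2 / κ * (δ + (B ^ 2 + 2 * B + 2 / κ) * ε ^ 2) := by
  have hε0 := h.eps_nonneg
  have c1 := h.continuous
  have c2 := h'.continuous
  have c3 := h.continuous_deriv
  have c4 := h'.continuous_deriv
  have cV := h.continuous_diffPotential h'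
  set V := diffPotential μ w w' with hVd
  have iR : Integrable (fun t => R t - R' t) volume := h.integrable.sub h'.integrable
  set X := ∫ t in L..T, ((w t - w' t) ^ 2 + (p t - p' t) ^ 2) with hX
  have hX0 : 0 ≤ X := intervalIntegral.integral_nonneg hLT fun t _ => by positivity
  -- From (v²)' = 2vv' ≤ v² + (v')² one gets v(t)² ≤ v(L)² + X.
  have hsq : ∀ t ∈ Set.Icc L T, |w t - w' t| ≤ B * ε + √X := fun t ht => by
    have e1 : (w t - w' t) ^ 2 - (w L - w' L) ^ 2 = ∫ s in L..t, 2 * ((w s - w' s) * (p s - p' s)) := by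
      refine (intervalIntegral.integral_eq_sub_of_hasDerivAt (f := fun t => (w t - w' t) ^ 2)
        (fun s _ => ?_) (Continuous.intervalIntegrable (by fun_prop) _ _)).symm
      refine (((h.hasDerivAt s).sub (h'.hasDerivAt s)).pow 2).congr_deriv ?_
      simp only [Pi.sub_apply]
      push_cast
      ring
    have e2 : ∫ s in L..t, 2 * ((w s - w' s) * (p s - p' s))
        ≤ ∫ s in L..t, ((w s - w' s) ^ 2 + (p s - p' s) ^ 2) :=
      intervalIntegral.integral_mono_on ht.1 (Continuous.intervalIntegrable (by fun_prop) _ _)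
        (Continuous.intervalIntegrable (by fun_prop) _ _) fun s _ => by
          nlinarith [sq_nonneg ((w s - w' s) - (p s - p' s))]
    have e3 : ∫ s in L..t, ((w s - w' s) ^ 2 + (p s - p' s) ^ 2) ≤ X :=
      intervalIntegral.integral_mono_interval le_rfl ht.1 ht.2 (.of_forall fun s => by positivity)
        (Continuous.intervalIntegrable (by fun_prop) _ _)
    have e4 : (w L - w' L) ^ 2 ≤ (B * ε) ^ 2 := sq_le_sq' (abs_le.1 hv).1 (abs_le.1 hv).2
    refine abs_le_of_sq_le_sq ?_ (by positivity)
    nlinarith [Real.sq_sqrt hX0, Real.sqrt_nonneg X, mul_nonneg hB hε0,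
      mul_nonneg (mul_nonneg hB hε0) (Real.sqrt_nonneg X)]
  have iVv : LocallyIntegrable (fun t => V t * (w t - w' t) + (R t - R' t)) volume :=
    (Continuous.locallyIntegrable (f := fun t => V t * (w t - w' t)) (by fun_prop)).add
      iR.locallyIntegrable
  have ibp := integral_primitive_mul (P₁ := fun t => p t - p' t) (P₂ := fun t => w t - w' t)
    iVv (Continuous.locallyIntegrable (f := fun t => p t - p' t) (by fun_prop))
    (fun a b => h.sub_primitive h' a b)
    (fun a b => by
      have e1 := h.primitive_self a b
      have e2 := h'.primitive_self a b
      rw [intervalIntegral.integral_sub (c3.intervalIntegrable _ _) (c4.intervalIntegrable _ _)]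
      linarith) L T
  have i1 : IntervalIntegrable (fun t => V t * (w t - w' t) ^ 2 + (p t - p' t) ^ 2) volume L T :=
    Continuous.intervalIntegrable (by fun_prop) _ _
  have i2 : IntervalIntegrable (fun t => (w t - w' t) * (R t - R' t)) volume L T :=
    (iR.intervalIntegrable).continuousOn_mul (Continuous.continuousOn (by fun_prop))
  have hsplit : ∫ t in L..T, ((V t * (w t - w' t) + (R t - R' t)) * (w t - w' t)
      + (p t - p' t) * (p t - p' t))
      = (∫ t in L..T, (V t * (w t - w' t) ^ 2 + (p t - p' t) ^ 2))
        + ∫ t in L..T, (w t - w' t) * (R t - R' t) := by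
    rw [← intervalIntegral.integral_add i1 i2]
    congr 1
    ext t
    ring
  rw [hsplit] at ibp
  have hlow : κ * X ≤ ∫ t in L..T, (V t * (w t - w' t) ^ 2 + (p t - p' t) ^ 2) := by
    rw [hX, ← intervalIntegral.integral_const_mul]
    refine intervalIntegral.integral_mono_on hLT (Continuous.intervalIntegrable (by fun_prop) _ _) i1
      fun t ht => ?_
    have := mul_le_mul_of_nonneg_right (hV t ht.1) (sq_nonneg (w t - w' t))
    have := mul_le_of_le_one_left (sq_nonneg (p t - p' t)) hκ1
    linarith
  have hRb : |∫ t in L..T, (w t - w' t) * (R t - R' t)| ≤ (B * ε + √X) * (2 * ε) := by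
    calc |∫ t in L..T, (w t - w' t) * (R t - R' t)|
        ≤ ∫ t in L..T, |(w t - w' t) * (R t - R' t)| :=
          intervalIntegral.abs_integral_le_integral_abs hLT
      _ ≤ ∫ t in L..T, (B * ε + √X) * |R t - R' t| := by
          refine intervalIntegral.integral_mono_on hLT i2.abs
            (iR.abs.intervalIntegrable.const_mul _) fun t ht => ?_
          rw [abs_mul]
          exact mul_le_mul_of_nonneg_right (hsq t ht) (abs_nonneg _)
      _ = (B * ε + √X) * ∫ t in L..T, |R t - R' t| := intervalIntegral.integral_const_mul _ _
      _ ≤ (B * ε + √X) * (2 * ε) := by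
          gcongr
          refine (le_abs_self _).trans ((abs_intervalIntegral_le iR.abs _ _).trans ?_)
          simpa using h.integral_abs_sub_le h'
  have hLb : |(p L - p' L) * (w L - w' L)| ≤ (B * ε) * (B * ε) := by
    rw [abs_mul]
    exact mul_le_mul hr hv (abs_nonneg _) (by positivity)
  have hfin : κ * X ≤ δ + (B * ε) * (B * ε) + (B * ε + √X) * (2 * ε) := by
    linarith [(abs_le.1 hT).2, (abs_le.1 hLb).1, (abs_le.1 hRb).1]
  have hyoung : √X * (2 * ε) ≤ κ / 2 * X + 2 / κ * ε ^ 2 := by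
    have e := sq_nonneg (κ * √X - 2 * ε)
    have e2 := Real.sq_sqrt hX0
    rw [← mul_le_mul_iff_right₀ (by positivity : 0 < 2 * κ)]
    have : 2 * κ * (κ / 2 * X + 2 / κ * ε ^ 2) = κ ^ 2 * X + 4 * ε ^ 2 := by
      field_simp
      ring
    rw [this]
    nlinarith
  rw [div_mul_eq_mul_div, le_div_iff₀ hκ]
  nlinarith

/-- Enlarge T to a point where the right boundary term is at most any prescribed δ; such points
exist because v and v' are in L². -/
theorem integral_tail_le (h : IsApproxSoliton μ ε w p R)
    (h' : IsApproxSoliton μ ε w' p' R') {κ B L T : ℝ} (hκ : 0 < κ) (hκ1 : κ ≤ 1) (hB : 0 ≤ B)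
    (hV : ∀ t, L ≤ t → κ ≤ diffPotential μ w w' t) (hLT : L ≤ T)
    (hv : |w L - w' L| ≤ B * ε) (hr : |p L - p' L| ≤ B * ε) :
    ∫ t in L..T, ((w t - w' t) ^ 2 + (p t - p' t) ^ 2)
      ≤ 2 / κ * (B ^ 2 + 2 * B + 2 / κ) * ε ^ 2 := by
  have c1 := h.continuous
  have c2 := h'.continuous
  have c3 := h.continuous_deriv
  have c4 := h'.continuous_deriv
  refine le_of_forall_pos_le_add fun δ hδ => ?_
  obtain ⟨S, hTS, hS⟩ := exists_large_lt_of_integrable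
    ((h.memLp.sub h'.memLp).integrable_sq.add (h.memLp_deriv.sub h'.memLp_deriv).integrable_sq) T
    (by positivity : 0 < κ / 2 * δ)
  have hS' : |(p S - p' S) * (w S - w' S)| ≤ κ / 2 * δ := by
    simp only [Pi.add_apply, Pi.sub_apply] at hS
    rw [abs_le]
    constructor <;> nlinarith [sq_nonneg ((p S - p' S) - (w S - w' S)),
      sq_nonneg ((p S - p' S) + (w S - w' S))]
  have e1 := h.integral_tail_le_of_small h' hκ hκ1 hB hV (hLT.trans hTS) hv hr hS'
  have e2 : ∫ t in L..T, ((w t - w' t) ^ 2 + (p t - p' t) ^ 2)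
      ≤ ∫ t in L..S, ((w t - w' t) ^ 2 + (p t - p' t) ^ 2) :=
    intervalIntegral.integral_mono_interval le_rfl hLT hTS (.of_forall fun s => by positivity)
      (Continuous.intervalIntegrable (by fun_prop) _ _)
  refine e2.trans (e1.trans (le_of_eq ?_))
  field_simp
  ring

/-- Two approximate solitons with the same frequency are close to each other. -/
theorem exists_stability {a c K m : ℝ} (ha : 0 < a) (hc : 0 < c) (hm : 0 < m) :
    ∃ C, 0 ≤ C ∧ ∀ {μ ε : ℝ} {w p R w' p' R' : ℝ → ℝ}, IsApproxSoliton μ ε w p R →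
      IsApproxSoliton μ ε w' p' R' → c ≤ μ → μ ≤ K → ε ≤ 1 → a ≤ w 0 → a ≤ w' 0 → w 0 ≤ K →
      w' 0 ≤ K → mass w ≤ m → mass w' ≤ m →
      mass (fun t => w t - w' t) + mass (fun t => p t - p' t) ≤ C * ε ^ 2 := by
  set D := 8 * Real.pi * (K + K ^ 2 + K ^ 3 + 1) / a ^ 3 with hD
  set A := K + K ^ 2 with hA
  set L := m / c with hL
  have hL0 : 0 < L := by positivity
  set B := (D + 2) * Real.exp ((A + 1) * L) + 2 with hB
  set κ := min (c / 2) 1 with hκ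
  have hκ0 : 0 < κ := by positivity
  -- The sign of K is unknown until a solution is given, so the absolute value is what makes the
  -- constant nonnegative unconditionally.
  refine ⟨|2 * (L * (2 * B ^ 2) + 2 / κ * (B ^ 2 + 2 * B + 2 / κ))|, abs_nonneg _, ?_⟩
  intro μ ε w p R w' p' R' h h' hcμ hμK hε hw hw' hK hK' hm1 hm2
  have hε0 := h.eps_nonneg
  have hK0 : 0 < K := hc.trans_le (hcμ.trans hμK)
  have hD0 : 0 ≤ D := by positivity
  have hA0 : 0 ≤ A := by positivity
  have hB0 : 0 ≤ B := by positivity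
  have c1 := h.continuous
  have c2 := h'.continuous
  have c3 := h.continuous_deriv
  have c4 := h'.continuous_deriv
  have hμ0 : 0 ≤ μ := (hc.trans_le hcμ).le
  have hg : ∀ t ∈ Set.Icc 0 L, |w t - w' t| ≤ B * ε ∧ |p t - p' t| ≤ B * ε := fun t ht => by
    have := h.abs_sub_le_gronwall h' hA0 (h.abs_diffPotential_le h' hμ0 hμK hK hK')
      (h.abs_sub_zero_le h' ha hμ0 hμK hK hK' hε hw hw') ht
    refine ⟨this.1.trans ?_, this.2⟩
    rw [hB]
    linarith
  have htail : ∀ T, L ≤ T → ∫ t in L..T, ((w t - w' t) ^ 2 + (p t - p' t) ^ 2)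
      ≤ 2 / κ * (B ^ 2 + 2 * B + 2 / κ) * ε ^ 2 := fun T hT =>
    h.integral_tail_le h' hκ0 (min_le_right _ _) hB0
      (fun t ht => (min_le_left _ _).trans (h.half_le_diffPotential h' hc hcμ hm hm1 hm2 ht)) hT
      (hg L ⟨hL0.le, le_rfl⟩).1 (hg L ⟨hL0.le, le_rfl⟩).2
  have hhead : ∫ t in (0 : ℝ)..L, ((w t - w' t) ^ 2 + (p t - p' t) ^ 2) ≤ L * (2 * B ^ 2) * ε ^ 2 := by
    calc ∫ t in (0 : ℝ)..L, ((w t - w' t) ^ 2 + (p t - p' t) ^ 2)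
        ≤ ∫ _ in (0 : ℝ)..L, (2 * B ^ 2 * ε ^ 2) := by
          refine intervalIntegral.integral_mono_on hL0.le
            (Continuous.intervalIntegrable (by fun_prop) _ _) (by simp) fun t ht => ?_
          obtain ⟨g1, g2⟩ := hg t ht
          have := sq_le_sq' (abs_le.1 g1).1 (abs_le.1 g1).2
          have := sq_le_sq' (abs_le.1 g2).1 (abs_le.1 g2).2
          linarith
      _ = L * (2 * B ^ 2) * ε ^ 2 := by
          rw [intervalIntegral.integral_const, smul_eq_mul]
          ring
  have iv : Integrable (fun t => (w t - w' t) ^ 2) volume := (h.memLp.sub h'.memLp).integrable_sq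
  have ir : Integrable (fun t => (p t - p' t) ^ 2) volume :=
    (h.memLp_deriv.sub h'.memLp_deriv).integrable_sq
  have hlim := intervalIntegral_tendsto_integral_Ioi (0 : ℝ) (iv.add ir).integrableOn tendsto_id
  have hIoi := le_of_tendsto hlim (b := (L * (2 * B ^ 2) + 2 / κ * (B ^ 2 + 2 * B + 2 / κ)) * ε ^ 2)
    ((eventually_ge_atTop L).mono fun T hT => by
      have e := intervalIntegral.integral_add_adjacent_intervals (μ := volume)
        (f := fun t => (w t - w' t) ^ 2 + (p t - p' t) ^ 2) (a := 0) (b := L) (c := T)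
        (Continuous.intervalIntegrable (by fun_prop) _ _)
        (Continuous.intervalIntegrable (by fun_prop) _ _)
      have := htail T hT
      simp only [Pi.add_apply, id]
      linarith)
  -- Both solutions are even with odd derivatives, so the half-line bound gives half of the total.
  have habs := integral_comp_abs (f := fun t => (w t - w' t) ^ 2 + (p t - p' t) ^ 2)
  have heq : (fun t : ℝ => (w |t| - w' |t|) ^ 2 + (p |t| - p' |t|) ^ 2)
      = fun t => (w t - w' t) ^ 2 + (p t - p' t) ^ 2 := by
    ext t
    rcases abs_cases t with ⟨e, _⟩ | ⟨e, _⟩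
    · rw [e]
    · rw [e, h.even, h'.even, h.odd, h'.odd]
      ring
  rw [mass_eq_integral_sq, mass_eq_integral_sq, ← integral_add iv ir]
  have habs' : ∫ t, ((w t - w' t) ^ 2 + (p t - p' t) ^ 2)
      = 2 * ∫ t in Set.Ioi 0, ((w t - w' t) ^ 2 + (p t - p' t) ^ 2) := by
    rw [← habs]
    exact (congrArg (fun g : ℝ → ℝ => ∫ t, g t) heq).symm
  rw [habs']
  simp only [Pi.add_apply] at hIoi
  calc _ ≤ (2 * (L * (2 * B ^ 2) + 2 / κ * (B ^ 2 + 2 * B + 2 / κ))) * ε ^ 2 := by linarith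
    _ ≤ _ := by gcongr; exact le_abs_self _

end IsApproxSoliton

end Stability

/-! ### The explicit soliton -/

section Soliton

/-- A crude lower bound, enough to dominate 1/cosh by the integrable 4/(1 + x²). -/
theorem one_add_sq_le_cosh (x : ℝ) : (1 + x ^ 2) / 4 ≤ Real.cosh x := by
  rw [← Real.cosh_abs, Real.cosh_eq, ← sq_abs]
  have h1 := Real.quadratic_le_exp_of_nonneg (abs_nonneg x)
  have h2 := Real.exp_pos (-|x|)
  nlinarith [abs_nonneg x]

theorem integrable_inv_cosh : Integrable (fun x => (Real.cosh x)⁻¹) volume := by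
  refine (integrable_inv_one_add_sq.const_mul 4).mono'
    (Real.continuous_cosh.inv₀ fun x => (Real.cosh_pos x).ne').aestronglyMeasurable
    (.of_forall fun x => ?_)
  rw [Real.norm_of_nonneg (inv_nonneg.2 (Real.cosh_pos x).le), ← div_eq_mul_inv,
    ← inv_div, inv_le_inv₀ (Real.cosh_pos x) (by positivity)]
  exact one_add_sq_le_cosh x

theorem sinh_div_cosh_eq (x : ℝ) : Real.sinh x / Real.cosh x = 1 - Real.exp (-x) / Real.cosh x := by
  have := (Real.cosh_pos x).ne'
  rw [← Real.cosh_sub_sinh]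
  field_simp
  ring

theorem tendsto_sinh_div_cosh : Tendsto (fun x => Real.sinh x / Real.cosh x) atTop (𝓝 1) := by
  have h : Tendsto (fun x => Real.exp (-x) / Real.cosh x) atTop (𝓝 0) := by
    refine squeeze_zero (fun x => by have := Real.cosh_pos x; positivity) (fun x => ?_)
      (Real.tendsto_exp_neg_atTop_nhds_zero)
    exact div_le_self (Real.exp_pos _).le (Real.one_le_cosh x)
  have := h.const_sub 1
  rw [sub_zero] at this
  exact this.congr fun x => (sinh_div_cosh_eq x).symm

theorem abs_sinh_le_cosh (x : ℝ) : |Real.sinh x| ≤ Real.cosh x := by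
  have h1 := Real.cosh_sub_sinh x
  have h2 := Real.cosh_add_sinh x
  have := Real.exp_pos x
  have := Real.exp_pos (-x)
  rw [abs_le]
  constructor <;> linarith

/-- The ground state of `-w'' - w³ / 2π = - b² w`. -/
def soliton (b z : ℝ) : ℝ := 2 * √Real.pi * b / Real.cosh (b * z)

/-- The derivative of `soliton`. -/
def solitonDeriv (b z : ℝ) : ℝ := -(2 * √Real.pi * b ^ 2 * Real.sinh (b * z) / Real.cosh (b * z) ^ 2)

variable {b : ℝ}

theorem hasDerivAt_soliton (b z : ℝ) : HasDerivAt (soliton b) (solitonDeriv b z) z := by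
  have hc : HasDerivAt (fun z => Real.cosh (b * z)) (Real.sinh (b * z) * b) z := by
    simpa using ((hasDerivAt_id z).const_mul b).cosh
  have := (hasDerivAt_const z (2 * √Real.pi * b)).div hc (Real.cosh_pos _).ne'
  refine this.congr_deriv ?_
  unfold solitonDeriv
  have := (Real.cosh_pos (b * z)).ne'
  field_simp
  ring

theorem hasDerivAt_solitonDeriv (b z : ℝ) :
    HasDerivAt (solitonDeriv b) (b ^ 2 * soliton b z - soliton b z ^ 3 / (2 * Real.pi)) z := by
  have hc : HasDerivAt (fun z => Real.cosh (b * z)) (Real.sinh (b * z) * b) z := by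
    simpa using ((hasDerivAt_id z).const_mul b).cosh
  have hs : HasDerivAt (fun z => Real.sinh (b * z)) (Real.cosh (b * z) * b) z := by
    simpa using ((hasDerivAt_id z).const_mul b).sinh
  have hne := (Real.cosh_pos (b * z)).ne'
  have := (((hs.const_mul (2 * √Real.pi * b ^ 2)).div (hc.pow 2) (pow_ne_zero 2 hne))).neg
  refine this.congr_deriv ?_
  unfold soliton
  have hpi : √Real.pi ^ 2 = Real.pi := Real.sq_sqrt Real.pi_pos.le
  have hch := Real.cosh_sq (b * z)
  have hp := Real.pi_pos.ne'
  simp only [Pi.pow_apply, Nat.cast_ofNat]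
  have e1 : (2 * √Real.pi * b / Real.cosh (b * z)) ^ 3 / (2 * Real.pi)
      = 4 * √Real.pi * b ^ 3 / Real.cosh (b * z) ^ 3 := by
    rw [div_pow, show (2 * √Real.pi * b) ^ 3 = 8 * (√Real.pi ^ 2) * √Real.pi * b ^ 3 by ring, hpi]
    field_simp
    ring
  rw [e1]
  have hs2 : Real.sinh (b * z) ^ 2 = Real.cosh (b * z) ^ 2 - 1 := by linarith
  field_simp
  rw [hs2]
  ring

theorem continuous_soliton (b : ℝ) : Continuous (soliton b) :=
  continuous_iff_continuousAt.2 fun z => (hasDerivAt_soliton b z).continuousAt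

theorem continuous_solitonDeriv (b : ℝ) : Continuous (solitonDeriv b) :=
  continuous_iff_continuousAt.2 fun z => (hasDerivAt_solitonDeriv b z).continuousAt

theorem soliton_nonneg (hb : 0 < b) (z : ℝ) : 0 ≤ soliton b z := by
  have := Real.cosh_pos (b * z)
  unfold soliton
  positivity

theorem soliton_zero (b : ℝ) : soliton b 0 = 2 * √Real.pi * b := by simp [soliton]

theorem soliton_radial (hb : 0 < b) {z z' : ℝ} (h : |z| ≤ |z'|) : soliton b z' ≤ soliton b z := by
  have := Real.cosh_pos (b * z)
  have h2 : Real.cosh (b * z) ≤ Real.cosh (b * z') := by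
    rw [Real.cosh_le_cosh, abs_mul, abs_mul]
    gcongr
  unfold soliton
  gcongr

theorem integrable_soliton (hb : 0 < b) : Integrable (soliton b) volume := by
  have := (integrable_inv_cosh.comp_mul_left' hb.ne').const_mul (2 * √Real.pi * b)
  exact this.congr (.of_forall fun z => (div_eq_mul_inv _ _).symm)

theorem memLp_soliton (hb : 0 < b) : MemLp (soliton b) 2 volume := by
  rw [memLp_two_iff_integrable_sq (continuous_soliton b).aestronglyMeasurable]
  have := (integrable_soliton hb).bdd_mul (c := 2 * √Real.pi * b)
    (continuous_soliton b).aestronglyMeasurable (.of_forall fun z => by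
      rw [Real.norm_of_nonneg (soliton_nonneg hb z), ← soliton_zero]
      exact soliton_radial hb (by simp))
  simpa [sq] using this

theorem abs_solitonDeriv_le (hb : 0 < b) (z : ℝ) : |solitonDeriv b z| ≤ |b * soliton b z| := by
  have h0 := Real.cosh_pos (b * z)
  have h1 := abs_sinh_le_cosh (b * z)
  unfold solitonDeriv soliton
  have h2 : 0 ≤ b * (2 * √Real.pi * b / Real.cosh (b * z)) := by positivity
  rw [abs_neg, abs_div, abs_of_pos (pow_pos h0 2), abs_mul,
    abs_of_nonneg (by positivity : 0 ≤ 2 * √Real.pi * b ^ 2), abs_of_nonneg h2,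
    div_le_iff₀ (by positivity)]
  calc 2 * √Real.pi * b ^ 2 * |Real.sinh (b * z)| ≤ 2 * √Real.pi * b ^ 2 * Real.cosh (b * z) := by gcongr
    _ = _ := by field_simp

theorem memLp_solitonDeriv (hb : 0 < b) : MemLp (solitonDeriv b) 2 volume :=
  ((memLp_soliton hb).const_mul b).mono (continuous_solitonDeriv b).aestronglyMeasurable
    (.of_forall (abs_solitonDeriv_le hb))

theorem soliton_primitive (b x y : ℝ) : soliton b y - soliton b x = ∫ t in x..y, solitonDeriv b t :=
  (intervalIntegral.integral_eq_sub_of_hasDerivAt (fun t _ => hasDerivAt_soliton b t)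
    ((continuous_solitonDeriv b).intervalIntegrable _ _)).symm

theorem solitonDeriv_primitive (b x y : ℝ) : solitonDeriv b y - solitonDeriv b x
    = ∫ t in x..y, (b ^ 2 * soliton b t - soliton b t ^ 3 / (2 * Real.pi)) := by
  have := continuous_soliton b
  exact (intervalIntegral.integral_eq_sub_of_hasDerivAt (fun t _ => hasDerivAt_solitonDeriv b t)
    (Continuous.intervalIntegrable (by fun_prop) _ _)).symm

/-- The square of the soliton has primitive 4πb tanh(bz). Mass is thus linear in b, and mass m
corresponds to b = m/8π. -/
theorem mass_soliton (hb : 0 < b) : mass (soliton b) = 8 * Real.pi * b := by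
  rw [mass_eq_integral_sq]
  have hd : ∀ z, HasDerivAt (fun z => 4 * Real.pi * b * (Real.sinh (b * z) / Real.cosh (b * z)))
      (soliton b z ^ 2) z := fun z => by
    have hc : HasDerivAt (fun z => Real.cosh (b * z)) (Real.sinh (b * z) * b) z := by
      simpa using ((hasDerivAt_id z).const_mul b).cosh
    have hs : HasDerivAt (fun z => Real.sinh (b * z)) (Real.cosh (b * z) * b) z := by
      simpa using ((hasDerivAt_id z).const_mul b).sinh
    have hne := (Real.cosh_pos (b * z)).ne'
    refine ((hs.div hc hne).const_mul (4 * Real.pi * b)).congr_deriv ?_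
    unfold soliton
    rw [div_pow, show (2 * √Real.pi * b) ^ 2 = 4 * √Real.pi ^ 2 * b ^ 2 by ring,
      Real.sq_sqrt Real.pi_pos.le]
    field_simp
    rw [Real.cosh_sq]
    ring
  have htop : Tendsto (fun z => 4 * Real.pi * b * (Real.sinh (b * z) / Real.cosh (b * z))) atTop
      (𝓝 (4 * Real.pi * b * 1)) :=
    (tendsto_sinh_div_cosh.comp (tendsto_id.const_mul_atTop hb)).const_mul _
  have hbot : Tendsto (fun z => 4 * Real.pi * b * (Real.sinh (b * z) / Real.cosh (b * z))) atBot
      (𝓝 (-(4 * Real.pi * b * 1))) := by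
    refine (htop.comp tendsto_neg_atBot_atTop).neg.congr fun z => ?_
    simp only [Function.comp, mul_neg, Real.sinh_neg, Real.cosh_neg, neg_div, neg_neg]
  rw [integral_of_hasDerivAt_of_tendsto hd (memLp_soliton hb).integrable_sq hbot htop]
  ring

theorem hasWeakDeriv_soliton (b : ℝ) : HasWeakDeriv (soliton b) 1 (solitonDeriv b) :=
  hasWeakDeriv_of_primitive (continuous_solitonDeriv b).locallyIntegrable (soliton_primitive b)

theorem memH1_of_hasWeakDeriv_one {w g : ℝ → ℝ} (hw : MemLp w 2 volume) (h : HasWeakDeriv w 1 g)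
    (hg : MemLp g 2 volume) : MemH1 w :=
  ⟨hw, fun v => ⟨fun x => v • g x, by simpa using h.smul_dir v, hg.const_smul v⟩⟩

theorem memH1_soliton (hb : 0 < b) : MemH1 (soliton b) :=
  memH1_of_hasWeakDeriv_one (memLp_soliton hb) (hasWeakDeriv_soliton b) (memLp_solitonDeriv hb)

theorem weakDeriv_soliton (b : ℝ) : weakDeriv 1 (soliton b) =ᵐ[volume] solitonDeriv b :=
  (hasWeakDeriv_soliton b).weakDeriv_ae

theorem integrable_soliton_pow_four (hb : 0 < b) : Integrable (fun z => soliton b z ^ 4) volume := by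
  have h := (memLp_soliton hb).integrable_sq.bdd_mul (c := (2 * √Real.pi * b) ^ 2)
    (((continuous_soliton b).pow 2).aestronglyMeasurable) (.of_forall fun z => by
      simp only [Pi.pow_apply]
      rw [Real.norm_of_nonneg (sq_nonneg _), ← soliton_zero]
      exact pow_le_pow_left₀ (soliton_nonneg hb z) (soliton_radial hb (by simp)) 2)
  refine h.congr (.of_forall fun z => ?_)
  simp only [Pi.pow_apply]
  ring

/-- The first integral of the soliton equation at zero energy. -/
theorem solitonDeriv_sq (b z : ℝ) :
    solitonDeriv b z ^ 2 = b ^ 2 * soliton b z ^ 2 - soliton b z ^ 4 / (4 * Real.pi) := by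
  have hpi : √Real.pi ^ 2 = Real.pi := Real.sq_sqrt Real.pi_pos.le
  have hch := Real.cosh_sq (b * z)
  have hne := (Real.cosh_pos (b * z)).ne'
  have hp := Real.pi_pos.ne'
  have e2 : soliton b z ^ 2 = 4 * Real.pi * b ^ 2 / Real.cosh (b * z) ^ 2 := by
    unfold soliton
    rw [div_pow, show (2 * √Real.pi * b) ^ 2 = 4 * √Real.pi ^ 2 * b ^ 2 by ring, hpi]
  have e3 : solitonDeriv b z ^ 2 = 4 * Real.pi * b ^ 4 * Real.sinh (b * z) ^ 2 / Real.cosh (b * z) ^ 4 := by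
    unfold solitonDeriv
    rw [neg_sq, div_pow, show (2 * √Real.pi * b ^ 2 * Real.sinh (b * z)) ^ 2
      = 4 * √Real.pi ^ 2 * b ^ 4 * Real.sinh (b * z) ^ 2 by ring, hpi, ← pow_mul]
  rw [show soliton b z ^ 4 = (soliton b z ^ 2) ^ 2 by ring, e2, e3]
  field_simp
  rw [hch]
  ring

/-- By the equation and its first integral, (ww')' = 2b²w² - (3/4π)w⁴, whose integral over the line
vanishes. -/
theorem integral_soliton_pow_four (hb : 0 < b) :
    ∫ z, soliton b z ^ 4 = 8 * Real.pi * b ^ 2 / 3 * mass (soliton b) := by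
  have i2 := (memLp_soliton hb).integrable_sq
  have i4 := integrable_soliton_pow_four hb
  have hd : ∀ z, HasDerivAt (fun z => soliton b z * solitonDeriv b z)
      (2 * b ^ 2 * soliton b z ^ 2 - 3 / (4 * Real.pi) * soliton b z ^ 4) z := fun z => by
    refine ((hasDerivAt_soliton b z).mul (hasDerivAt_solitonDeriv b z)).congr_deriv ?_
    rw [← sq, solitonDeriv_sq]
    field_simp
    ring
  have h := integral_eq_zero_of_hasDerivAt_of_integrable hd
    ((i2.const_mul (2 * b ^ 2)).sub (i4.const_mul (3 / (4 * Real.pi))))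
    (integrable_mul_of_memLp (memLp_soliton hb) (memLp_solitonDeriv hb))
  rw [integral_sub (i2.const_mul _) (i4.const_mul _), integral_const_mul, integral_const_mul,
    ← mass_eq_integral_sq] at h
  have hp := Real.pi_pos.ne'
  field_simp at h ⊢
  linarith

theorem mass_solitonDeriv (hb : 0 < b) :
    mass (solitonDeriv b) = b ^ 2 * mass (soliton b) - (∫ z, soliton b z ^ 4) / (4 * Real.pi) := by
  have i2 := (memLp_soliton hb).integrable_sq
  have i4 := integrable_soliton_pow_four hb
  rw [mass_eq_integral_sq, mass_eq_integral_sq, integral_congr_ae (.of_forall (solitonDeriv_sq b)),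
    integral_sub (i2.const_mul _) (i4.div_const _), integral_const_mul, integral_div]

/-- The energy of the soliton. -/
theorem half_mass_solitonDeriv_sub (hb : 0 < b) :
    1 / 2 * mass (weakDeriv 1 (soliton b)) - 1 / (8 * Real.pi) * ∫ z, soliton b z ^ 4
      = -(4 * Real.pi * b ^ 3 / 3) := by
  rw [mass_congr_ae (weakDeriv_soliton b), mass_solitonDeriv hb, integral_soliton_pow_four hb,
    mass_soliton hb]
  field_simp
  ring

/-- A soliton of frequency b² solves the equation at frequency μ up to (b² - μ)w. This allows
solutions of slightly different frequencies to be compared by a stability theorem stated at one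
frequency. -/
theorem isApproxSoliton_soliton (hb : 0 < b) {μ ε : ℝ} (hε : |b ^ 2 - μ| * ∫ z, soliton b z ≤ ε) :
    IsApproxSoliton μ ε (soliton b) (solitonDeriv b) (fun z => (b ^ 2 - μ) * soliton b z) where
  hasDerivAt := hasDerivAt_soliton b
  primitive x y := by
    rw [solitonDeriv_primitive]
    congr 1
    ext t
    ring
  integrable := (integrable_soliton hb).const_mul _
  integral_abs_le := by
    refine le_trans (le_of_eq ?_) hε
    rw [← integral_const_mul]
    congr 1
    ext t
    rw [abs_mul, abs_of_nonneg (soliton_nonneg hb t)]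
  radial z z' h := soliton_radial hb h
  nonneg := soliton_nonneg hb
  memLp := memLp_soliton hb
  memLp_deriv := memLp_solitonDeriv hb

end Soliton

/-! ### First variation under a mass constraint -/

section Variation

variable {E : Type*} [NormedAddCommGroup E] [NormedSpace ℝ E] [MeasureSpace E] [BorelSpace E]
  [FiniteDimensional ℝ E]

theorem mass_add_const_mul {u v : E → ℝ} (hu : MemLp u 2 volume) (hv : MemLp v 2 volume) (t : ℝ) :
    mass (fun x => u x + t * v x) = mass u + 2 * t * (∫ x, u x * v x) + t ^ 2 * mass v := by
  have i1 := integrable_sq_of_memLp hu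
  have i2 := integrable_mul_of_memLp hu hv
  have i3 := integrable_sq_of_memLp hv
  simp only [mass_eq_integral_sq]
  have i12 : Integrable (fun x => u x ^ 2 + 2 * t * (u x * v x)) volume := i1.add (i2.const_mul _)
  rw [← integral_const_mul, ← integral_const_mul, ← integral_add i1 (i2.const_mul _),
    ← integral_add i12 (i3.const_mul _)]
  congr 1
  ext x
  ring

theorem mass_const_mul (c : ℝ) (u : E → ℝ) : mass (fun x => c * u x) = c ^ 2 * mass u := by
  simp only [mass_eq_integral_sq, mul_pow, integral_const_mul]

theorem integrable_pow_mul_pow {u v : E → ℝ} (hu : MemLp u 4 volume) (hv : MemLp v 4 volume) {i j : ℕ}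
    (hij : i + j = 4) : Integrable (fun x => u x ^ i * v x ^ j) volume := by
  have i1 : Integrable (fun x => ‖u x‖ ^ 4) volume := hu.integrable_norm_pow (by norm_num)
  have i2 : Integrable (fun x => ‖v x‖ ^ 4) volume := hv.integrable_norm_pow (by norm_num)
  refine (i1.add i2).mono' ((hu.1.pow i).mul (hv.1.pow j)) (.of_forall fun x => ?_)
  simp only [Pi.add_apply, norm_mul, norm_pow]
  have h0 := norm_nonneg (u x)
  have h1 := norm_nonneg (v x)
  have : ‖u x‖ ^ i * ‖v x‖ ^ j ≤ max ‖u x‖ ‖v x‖ ^ i * max ‖u x‖ ‖v x‖ ^ j := by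
    gcongr
    · exact le_max_left _ _
    · exact le_max_right _ _
  rw [← pow_add, hij] at this
  refine this.trans ?_
  rcases max_cases ‖u x‖ ‖v x‖ with ⟨e, -⟩ | ⟨e, -⟩ <;> rw [e] <;> nlinarith [pow_nonneg h0 4, pow_nonneg h1 4]

theorem integrable_pow_four {u : E → ℝ} (hu : MemLp u 4 volume) :
    Integrable (fun x => u x ^ 4) volume := by
  simpa using integrable_pow_mul_pow hu hu (i := 4) (j := 0) rfl

theorem integrable_cube_mul {u v : E → ℝ} (hu : MemLp u 4 volume) (hv : MemLp v 4 volume) :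
    Integrable (fun x => u x ^ 3 * v x) volume := by
  simpa using integrable_pow_mul_pow hu hv (i := 3) (j := 1) rfl

/-- Expanding the fourth power makes the integral a polynomial in t, so no differentiation under the
integral is needed. -/
theorem hasDerivAt_integral_pow_four {u v : E → ℝ} (hu : MemLp u 4 volume) (hv : MemLp v 4 volume) :
    HasDerivAt (fun t : ℝ => ∫ x, (u x + t * v x) ^ 4) (4 * ∫ x, u x ^ 3 * v x) 0 := by
  have i0 := integrable_pow_mul_pow hu hv (i := 4) (j := 0) rfl
  have i1 := integrable_pow_mul_pow hu hv (i := 3) (j := 1) rfl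
  have i2 := integrable_pow_mul_pow hu hv (i := 2) (j := 2) rfl
  have i3 := integrable_pow_mul_pow hu hv (i := 1) (j := 3) rfl
  have i4 := integrable_pow_mul_pow hu hv (i := 0) (j := 4) rfl
  have e : (fun t : ℝ => ∫ x, (u x + t * v x) ^ 4) = fun t => (∫ x, u x ^ 4 * v x ^ 0)
      + 4 * t * (∫ x, u x ^ 3 * v x ^ 1) + 6 * t ^ 2 * (∫ x, u x ^ 2 * v x ^ 2)
      + 4 * t ^ 3 * (∫ x, u x ^ 1 * v x ^ 3) + t ^ 4 * ∫ x, u x ^ 0 * v x ^ 4 := by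
    ext t
    have j1 : Integrable (fun x => u x ^ 4 * v x ^ 0 + 4 * t * (u x ^ 3 * v x ^ 1)) volume :=
      i0.add (i1.const_mul _)
    have j2 : Integrable (fun x => u x ^ 4 * v x ^ 0 + 4 * t * (u x ^ 3 * v x ^ 1)
        + 6 * t ^ 2 * (u x ^ 2 * v x ^ 2)) volume := j1.add (i2.const_mul _)
    have j3 : Integrable (fun x => u x ^ 4 * v x ^ 0 + 4 * t * (u x ^ 3 * v x ^ 1)
        + 6 * t ^ 2 * (u x ^ 2 * v x ^ 2) + 4 * t ^ 3 * (u x ^ 1 * v x ^ 3)) volume :=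
      j2.add (i3.const_mul _)
    rw [← integral_const_mul, ← integral_const_mul, ← integral_const_mul, ← integral_const_mul,
      ← integral_add i0 (i1.const_mul _), ← integral_add j1 (i2.const_mul _),
      ← integral_add j2 (i3.const_mul _), ← integral_add j3 (i4.const_mul _)]
    congr 1
    ext x
    ring
  rw [e]
  have h1 := hasDerivAt_id (0 : ℝ)
  have := ((((hasDerivAt_const (0 : ℝ) (∫ x, u x ^ 4 * v x ^ 0)).add
    ((h1.const_mul 4).mul_const (∫ x, u x ^ 3 * v x ^ 1))).add
    (((h1.pow 2).const_mul 6).mul_const (∫ x, u x ^ 2 * v x ^ 2))).add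
    (((h1.pow 3).const_mul 4).mul_const (∫ x, u x ^ 1 * v x ^ 3))).add
    ((h1.pow 4).mul_const (∫ x, u x ^ 0 * v x ^ 4))
  refine this.congr_deriv ?_
  simp

/-- First order condition for a normalized one-parameter family. -/
theorem stationary_of_normalized {m a₀ a₁ a₂ b₀ b₁ α β c : ℝ} {B : ℝ → ℝ} (hm : 0 < m)
    (hB : HasDerivAt B (4 * b₁) 0) (hB0 : B 0 = b₀)
    (hmin : ∀ᶠ t in 𝓝 (0 : ℝ), a₀ - c * b₀ ≤
      m / (m + 2 * t * α + t ^ 2 * β) * (a₀ + 2 * t * a₁ + t ^ 2 * a₂)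
        - c * ((m / (m + 2 * t * α + t ^ 2 * β)) ^ 2 * B t)) :
    a₁ - 2 * c * b₁ = (a₀ - 2 * c * b₀) / m * α := by
  have h1 := hasDerivAt_id (0 : ℝ)
  have quad : ∀ x y z : ℝ, HasDerivAt (fun t : ℝ => x + 2 * t * y + t ^ 2 * z) (2 * y) 0 := by
    intro x y z
    have := ((hasDerivAt_const (0 : ℝ) x).add ((h1.const_mul 2).mul_const y)).add
      ((h1.pow 2).mul_const z)
    exact this.congr_deriv (by simp)
  have hM := quad m α β
  have hA := quad a₀ a₁ a₂
  have hs : HasDerivAt (fun t : ℝ => m / (m + 2 * t * α + t ^ 2 * β)) (-(2 * α) / m) 0 := by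
    refine ((hasDerivAt_const (0 : ℝ) m).div hM (by simpa using hm.ne')).congr_deriv ?_
    simp
    field_simp
  have hg := (hs.mul hA).sub ((((hs.pow 2).mul hB)).const_mul c)
  have hmin' : IsLocalMin (fun t : ℝ => m / (m + 2 * t * α + t ^ 2 * β) * (a₀ + 2 * t * a₁ + t ^ 2 * a₂)
      - c * ((m / (m + 2 * t * α + t ^ 2 * β)) ^ 2 * B t)) 0 := by
    filter_upwards [hmin] with t ht
    refine le_trans (le_of_eq ?_) ht
    simp [hB0, hm.ne']
  have := hmin'.hasDerivAt_eq_zero hg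
  simp [hB0, hm.ne'] at this
  field_simp at this ⊢
  linarith

end Variation

/-! ### Real minimizers and their Euler–Lagrange equations -/

section RealMinimizer

theorem MemH1.weakDeriv_ofComplex {E : Type*} [NormedAddCommGroup E] [NormedSpace ℝ E] [MeasureSpace E]
    [BorelSpace E] [FiniteDimensional ℝ E] {u : E → ℝ} (h : MemH1 u) (v : E) :
    weakDeriv v (fun x => (u x : ℂ)) =ᵐ[volume] fun x => ((weakDeriv v u x : ℝ) : ℂ) :=
  h.weakDeriv_ofReal (𝕜 := ℂ) v


theorem mass_ofReal {E : Type*} [MeasureSpace E] (u : E → ℝ) :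
    mass (fun x => (u x : ℂ)) = mass u := by
  simp [mass]

theorem MemSigma.ofReal {u : X → ℝ} (h : MemSigma u) : MemSigma (fun x => (u x : ℂ)) :=
  ⟨h.1.ofReal, by simpa using h.2⟩

theorem MemSigma.of_ofReal {u : X → ℝ} (h : MemSigma (fun x => (u x : ℂ))) : MemSigma u :=
  ⟨MemH1.of_ofReal (𝕜 := ℂ) h.1, by simpa using h.2⟩

theorem MemSigma.sigmaYSq_ofReal {u : X → ℝ} (h : MemSigma u) :
    sigmaYSq (fun x => (u x : ℂ)) = sigmaYSq u := by
  refine integral_congr_ae ?_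
  filter_upwards [h.1.weakDeriv_ofComplex (eY 0), h.1.weakDeriv_ofComplex (eY 1)] with x h0 h1
  simp only [gradYSq, Fin.sum_univ_two]
  simp [h0, h1]

theorem MemSigma.energy3_ofReal {u : X → ℝ} (h : MemSigma u) (ω : ℝ) :
    energy3 ω (fun x => (u x : ℂ)) = energy3 ω u := by
  rw [energy3, energy3, h.sigmaYSq_ofReal, mass_congr_ae (h.1.weakDeriv_ofComplex eZ), mass_ofReal]
  simp

theorem MemH1.energy1_ofReal {w : ℝ → ℝ} (h : MemH1 w) :
    energy1 (fun z => (w z : ℂ)) = energy1 w := by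
  rw [energy1, energy1, mass_congr_ae (h.weakDeriv_ofComplex 1), mass_ofReal]
  simp

namespace IsMinimizer3

variable {ω m : ℝ} {Q : X → ℝ}

theorem memSigma (h : IsMinimizer3 ω m Q) : MemSigma Q := MemSigma.of_ofReal h.mem.1

theorem mass_eq (h : IsMinimizer3 ω m Q) : mass Q = m := by rw [← mass_ofReal]; exact h.mem.2.1

theorem sigmaYSq_le (h : IsMinimizer3 ω m Q) : sigmaYSq Q ≤ √ω := by
  rw [← h.memSigma.sigmaYSq_ofReal]; exact h.mem.2.2

theorem energy_le (h : IsMinimizer3 ω m Q) {u : X → ℝ} (hu : MemSigma u) (hm : mass u = m)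
    (hs : sigmaYSq u ≤ √ω) : energy3 ω Q ≤ energy3 ω u := by
  rw [← h.memSigma.energy3_ofReal, ← hu.energy3_ofReal]
  exact h.isMinOn ⟨hu.ofReal, (mass_ofReal u).trans hm, hu.sigmaYSq_ofReal.trans_le hs⟩

end IsMinimizer3

namespace IsGroundState1

variable {m : ℝ} {Q : ℝ → ℝ}

theorem memH1 (h : IsGroundState1 m Q) : MemH1 Q := MemH1.of_ofReal (𝕜 := ℂ) h.mem.1

theorem mass_eq (h : IsGroundState1 m Q) : mass Q = m := by rw [← mass_ofReal]; exact h.mem.2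

theorem energy_le (h : IsGroundState1 m Q) {w : ℝ → ℝ} (hw : MemH1 w) (hm : mass w = m) :
    energy1 Q ≤ energy1 w := by
  rw [← h.memH1.energy1_ofReal, ← hw.energy1_ofReal]
  exact h.isMinOn ⟨hw.ofReal, (mass_ofReal w).trans hm⟩

end IsGroundState1

theorem MemH1.mass_weakDeriv_comb {E : Type*} [NormedAddCommGroup E] [NormedSpace ℝ E] [MeasureSpace E]
    [BorelSpace E] [FiniteDimensional ℝ E] {u v : E → ℝ} (hu : MemH1 u) (hv : MemH1 v) (k t : ℝ) (e : E) :
    mass (weakDeriv e (fun x => k * (u x + t * v x))) = k ^ 2 * (mass (weakDeriv e u)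
      + 2 * t * (∫ x, weakDeriv e u x * weakDeriv e v x) + t ^ 2 * mass (weakDeriv e v)) := by
  rw [← mass_add_const_mul (hu.memLp_weakDeriv e) (hv.memLp_weakDeriv e), ← mass_const_mul]
  refine mass_congr_ae ?_
  filter_upwards [(hu.add (hv.const_mul t)).weakDeriv_const_mul k e, hu.weakDeriv_add (hv.const_mul t) e,
    hv.weakDeriv_const_mul t e] with x h1 h2 h3
  rw [h1, h2, h3]

theorem MemSigma.sigmaYSq_comb {u v : X → ℝ} (hu : MemSigma u) (hv : MemSigma v) (k t : ℝ) :
    sigmaYSq (fun x => k * (u x + t * v x)) = k ^ 2 * (sigmaYSq u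
      + 2 * t * (∑ i, ∫ x, ann i u x * ann i v x) + t ^ 2 * sigmaYSq v) := by
  have key : ∀ i, mass (ann i (fun x => k * (u x + t * v x))) = k ^ 2 * (mass (ann i u)
      + 2 * t * (∫ x, ann i u x * ann i v x) + t ^ 2 * mass (ann i v)) := fun i => by
    rw [← mass_add_const_mul (hu.memLp_ann i) (hv.memLp_ann i), ← mass_const_mul]
    refine mass_congr_ae ?_
    filter_upwards [(hu.1.add (hv.1.const_mul t)).weakDeriv_const_mul k (eY i),
      hu.1.weakDeriv_add (hv.1.const_mul t) (eY i), hv.1.weakDeriv_const_mul t (eY i)] with x h1 h2 h3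
    simp only [ann, h1, h2, h3]
    ring
  rw [((hu.add (hv.const_mul t)).const_mul k).sigmaYSq_eq, hu.sigmaYSq_eq, hv.sigmaYSq_eq]
  simp only [key, Fin.sum_univ_two]
  ring

theorem integral_comb_pow_four {E : Type*} [MeasureSpace E] (u v : E → ℝ) (k t : ℝ) :
    ∫ x, (k * (u x + t * v x)) ^ 4 = (k ^ 2) ^ 2 * ∫ x, (u x + t * v x) ^ 4 := by
  simp only [mul_pow, integral_const_mul]
  ring

theorem MemSigma.memLp_four {u : X → ℝ} (hu : MemSigma u) : MemLp u 4 volume := by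
  obtain ⟨C, -, H⟩ := exists_gagliardo
  exact (H u hu).1

theorem norm_pow_four (a : ℝ) : ‖a‖ ^ 4 = a ^ 4 := by
  rw [Real.norm_eq_abs, ← abs_pow, abs_of_nonneg (by positivity)]

theorem energy3_eq (ω : ℝ) (u : X → ℝ) : energy3 ω u
    = ω / 2 * sigmaYSq u + 1 / 2 * mass (weakDeriv eZ u) - 1 / 4 * ∫ x, u x ^ 4 := by
  simp only [energy3, norm_pow_four]

theorem energy1_eq (w : ℝ → ℝ) : energy1 w
    = 1 / 2 * mass (weakDeriv 1 w) - 1 / (8 * Real.pi) * ∫ x, w x ^ 4 := by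
  simp only [energy1, norm_pow_four]

theorem eventually_normalizer {m α β : ℝ} (hm : 0 < m) :
    (∀ᶠ t in 𝓝 (0 : ℝ), 0 < m + 2 * t * α + t ^ 2 * β) ∧
      Tendsto (fun t : ℝ => m / (m + 2 * t * α + t ^ 2 * β)) (𝓝 0) (𝓝 1) := by
  have hc : Continuous fun t : ℝ => m + 2 * t * α + t ^ 2 * β := by fun_prop
  have ht : Tendsto (fun t : ℝ => m + 2 * t * α + t ^ 2 * β) (𝓝 0) (𝓝 m) := by
    simpa using hc.tendsto 0
  refine ⟨ht.eventually (lt_mem_nhds hm), ?_⟩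
  have := (tendsto_const_nhds (x := m)).div ht hm.ne'
  rwa [div_self hm.ne'] at this

/-- The weak Euler–Lagrange equation for a minimizer in the interior of the constraint. -/
theorem IsMinimizer3.stationary {ω m : ℝ} {Q : X → ℝ} (h : IsMinimizer3 ω m Q) (hm : 0 < m)
    (hlt : sigmaYSq Q < √ω) {φ : X → ℝ} (hφ : MemSigma φ) :
    (ω * ∑ i, ∫ x, ann i Q x * ann i φ x) + (∫ x, weakDeriv eZ Q x * weakDeriv eZ φ x)
      - ∫ x, Q x ^ 3 * φ x
      = -(((∫ x, Q x ^ 4) - ω * sigmaYSq Q - mass (weakDeriv eZ Q)) / m) * ∫ x, Q x * φ x := by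
  have hQ := h.memSigma
  set S := ∑ i, ∫ x, ann i Q x * ann i φ x with hS
  obtain ⟨hpos, hk⟩ := eventually_normalizer (α := ∫ x, Q x * φ x) (β := mass φ) hm
  -- Strictness of the transverse constraint keeps all small variations admissible, so no second
  -- multiplier arises.
  have hsig : ∀ᶠ t in 𝓝 (0 : ℝ), m / (m + 2 * t * (∫ x, Q x * φ x) + t ^ 2 * mass φ)
      * (sigmaYSq Q + 2 * t * S + t ^ 2 * sigmaYSq φ) < √ω := by
    have hc : Continuous fun t : ℝ => sigmaYSq Q + 2 * t * S + t ^ 2 * sigmaYSq φ := by fun_prop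
    have := hk.mul (hc.tendsto 0)
    refine this.eventually (gt_mem_nhds ?_)
    simpa using hlt
  have := stationary_of_normalized (m := m) (a₀ := ω * sigmaYSq Q + mass (weakDeriv eZ Q))
    (a₁ := ω * S + ∫ x, weakDeriv eZ Q x * weakDeriv eZ φ x)
    (a₂ := ω * sigmaYSq φ + mass (weakDeriv eZ φ)) (b₀ := ∫ x, Q x ^ 4) (b₁ := ∫ x, Q x ^ 3 * φ x)
    (α := ∫ x, Q x * φ x) (β := mass φ) (c := 1 / 2) hm
    (hasDerivAt_integral_pow_four hQ.memLp_four hφ.memLp_four) (by simp) (by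
      filter_upwards [hpos, hsig] with t h1 h2
      set M := m + 2 * t * (∫ x, Q x * φ x) + t ^ 2 * mass φ with hM
      -- The factor √(m/M) restores the mass; only its square enters, since all terms of the energy
      -- have even degree.
      have hk2 : √(m / M) ^ 2 = m / M := Real.sq_sqrt (by positivity)
      have hu : MemSigma (fun x => √(m / M) * (Q x + t * φ x)) := (hQ.add (hφ.const_mul t)).const_mul _
      have e1 := hQ.sigmaYSq_comb hφ (√(m / M)) t
      have e2 := hQ.1.mass_weakDeriv_comb hφ.1 (√(m / M)) t eZ
      have e3 := integral_comb_pow_four Q φ (√(m / M)) t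
      have e4 : mass (fun x => √(m / M) * (Q x + t * φ x)) = m := by
        rw [mass_const_mul, mass_add_const_mul hQ.memLp hφ.memLp, h.mass_eq, hk2]
        exact div_mul_cancel₀ _ h1.ne'
      rw [hk2] at e1 e2 e3
      have := h.energy_le hu e4 (by rw [e1]; exact h2.le)
      rw [energy3_eq, energy3_eq, e1, e2, e3] at this
      simp only [← hS] at this
      nlinarith)
  rw [show (2 : ℝ) * (1 / 2) = 1 by norm_num, one_mul, one_mul] at this
  rw [this]
  ring

/-- In one dimension H¹ functions are essentially bounded, so w⁴ is bounded by a constant times w².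
-/
theorem MemH1.memLp_four {w : ℝ → ℝ} (hw : MemH1 w) : MemLp w 4 volume := by
  have h := hw.ae_sq_le
  set K := 2 * (l2Norm w * l2Norm (weakDeriv 1 w))
  have hi : Integrable (fun z => w z ^ 4) volume := by
    have := hw.1.integrable_sq.bdd_mul (c := K) (hw.1.1.pow 2) (by
      filter_upwards [h] with z hz
      simpa using hz)
    exact this.congr (.of_forall fun z => by simp; ring)
  rw [← integrable_norm_rpow_iff hw.1.1 (by norm_num) (by norm_num)]
  refine hi.congr (.of_forall fun z => ?_)
  simp only [ENNReal.toReal_ofNat]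
  rw [show ((4 : ℝ)) = ((4 : ℕ) : ℝ) by norm_num, Real.rpow_natCast, norm_pow_four]

theorem IsGroundState1.stationary {m : ℝ} {Q : ℝ → ℝ} (h : IsGroundState1 m Q) (hm : 0 < m)
    {φ : ℝ → ℝ} (hφ : MemH1 φ) :
    (∫ x, weakDeriv 1 Q x * weakDeriv 1 φ x) - 1 / (2 * Real.pi) * ∫ x, Q x ^ 3 * φ x
      = -((1 / (2 * Real.pi) * (∫ x, Q x ^ 4) - mass (weakDeriv 1 Q)) / m) * ∫ x, Q x * φ x := by
  have hQ := h.memH1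
  obtain ⟨hpos, -⟩ := eventually_normalizer (α := ∫ x, Q x * φ x) (β := mass φ) hm
  have := stationary_of_normalized (m := m) (a₀ := mass (weakDeriv 1 Q))
    (a₁ := ∫ x, weakDeriv 1 Q x * weakDeriv 1 φ x)
    (a₂ := mass (weakDeriv 1 φ)) (b₀ := ∫ x, Q x ^ 4) (b₁ := ∫ x, Q x ^ 3 * φ x)
    (α := ∫ x, Q x * φ x) (β := mass φ) (c := 1 / (4 * Real.pi)) hm
    (hasDerivAt_integral_pow_four hQ.memLp_four hφ.memLp_four) (by simp) (by
      filter_upwards [hpos] with t h1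
      set M := m + 2 * t * (∫ x, Q x * φ x) + t ^ 2 * mass φ with hM
      have hk2 : √(m / M) ^ 2 = m / M := Real.sq_sqrt (by positivity)
      have hu : MemH1 (fun x => √(m / M) * (Q x + t * φ x)) := (hQ.add (hφ.const_mul t)).const_mul _
      have e2 := hQ.mass_weakDeriv_comb hφ (√(m / M)) t 1
      have e3 := integral_comb_pow_four Q φ (√(m / M)) t
      have e4 : mass (fun x => √(m / M) * (Q x + t * φ x)) = m := by
        rw [mass_const_mul, mass_add_const_mul hQ.1 hφ.1, h.mass_eq, hk2]
        exact div_mul_cancel₀ _ h1.ne'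
      rw [hk2] at e2 e3
      have := h.energy_le hu e4
      rw [energy1_eq, energy1_eq, e2, e3] at this
      have e5 : 1 / (4 * Real.pi) = 2 * (1 / (8 * Real.pi)) := by field_simp; norm_num
      rw [e5]
      linarith)
  have e6 : 2 * (1 / (4 * Real.pi)) = 1 / (2 * Real.pi) := by field_simp; norm_num
  rw [e6] at this
  rw [this]
  ring

end RealMinimizer

/-! ### A priori bounds and smallness of the orthogonal part -/

section Bounds

theorem MemH1.integral_pow_four_le {w : ℝ → ℝ} (hw : MemH1 w) :
    ∫ z, w z ^ 4 ≤ 2 * (l2Norm w * l2Norm (weakDeriv 1 w)) * mass w := by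
  rw [mass_eq_integral_sq, ← integral_const_mul]
  refine integral_mono_ae (integrable_pow_four hw.memLp_four) (hw.1.integrable_sq.const_mul _) ?_
  filter_upwards [hw.ae_sq_le] with z hz
  nlinarith [sq_nonneg (w z)]

theorem integral_tensorPhi0_pow_four (w : ℝ → ℝ) :
    ∫ x, tensorPhi0 w x ^ 4 = (∫ z, w z ^ 4) / (2 * Real.pi) := by
  simp only [tensorPhi0_eq, gtens_pow]
  rw [integral_gtens, integral_Phi0_pow_four]
  ring

theorem mass_P1_le {u : X → ℝ} (hu : MemLp u 2 volume) : mass (P1 u) ≤ mass u := by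
  linarith [mass_par_add_mass_P1 hu, mass_nonneg (par u)]

theorem mass_par_le {u : X → ℝ} (hu : MemLp u 2 volume) : mass (par u) ≤ mass u := by
  linarith [mass_par_add_mass_P1 hu, mass_nonneg (P1 u)]

theorem sigmaYSq_nonneg {u : X → ℝ} (hu : MemSigma u) : 0 ≤ sigmaYSq u := by
  rw [hu.sigmaYSq_eq]
  exact Finset.sum_nonneg fun i _ => mass_nonneg _

theorem MemSigma.mass_weakDeriv_P1_le {u : X → ℝ} (hu : MemSigma u) :
    mass (weakDeriv eZ (DimRed.P1 u)) ≤ mass (weakDeriv eZ u) := by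
  linarith [hu.mass_weakDeriv_eZ, mass_nonneg (weakDeriv 1 (par u))]

theorem MemSigma.mass_weakDeriv_par_le {u : X → ℝ} (hu : MemSigma u) :
    mass (weakDeriv 1 (par u)) ≤ mass (weakDeriv eZ u) := by
  linarith [hu.mass_weakDeriv_eZ, mass_nonneg (weakDeriv eZ (DimRed.P1 u))]

/-- Quartic bound for the part orthogonal to the lowest state. -/
theorem exists_integral_P1_pow_four_le : ∃ C : ℝ, 0 < C ∧ ∀ u : X → ℝ, MemSigma u →
    ∫ x, P1 u x ^ 4 ≤ C * √(mass u) * sigmaYSq u * √(mass (weakDeriv eZ u)) := by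
  obtain ⟨C, hC, H⟩ := exists_gagliardo
  refine ⟨17 * C + 1, by positivity, fun u hu => ?_⟩
  have hσ := sigmaYSq_nonneg hu
  have h1 := (H _ hu.P1).2
  -- The transverse Dirichlet energy is at most σ + 2‖P₁u‖², and the gap constant 8 gives 1 + 2·8 =
  -- 17.
  have h2 : ∑ i, mass (weakDeriv (eY i) (P1 u)) ≤ 17 * sigmaYSq u := by
    have e := hu.P1.sum_mass_eq
    have g := hu.gap
    rw [hu.sigmaYSq_P1] at e
    linarith [mass_nonneg (fun x : X => ‖x.1‖ * P1 u x)]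
  have h3 : l2Norm (P1 u) ≤ √(mass u) := Real.sqrt_le_sqrt (mass_P1_le hu.memLp)
  have h4 : l2Norm (weakDeriv eZ (P1 u)) ≤ √(mass (weakDeriv eZ u)) :=
    Real.sqrt_le_sqrt hu.mass_weakDeriv_P1_le
  have h5 : 0 ≤ ∑ i, mass (weakDeriv (eY i) (P1 u)) := Finset.sum_nonneg fun i _ => mass_nonneg _
  calc _ ≤ _ := h1
    _ ≤ C * √(mass u) * (17 * sigmaYSq u) * √(mass (weakDeriv eZ u)) := by
        have := l2Norm_nonneg (P1 u)
        have := l2Norm_nonneg (weakDeriv eZ (P1 u))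
        gcongr
    _ = 17 * C * √(mass u) * sigmaYSq u * √(mass (weakDeriv eZ u)) := by ring
    _ ≤ _ := by gcongr; linarith

/-- Pointwise convexity, (a + b)⁴ ≤ 8(a⁴ + b⁴). -/
theorem integral_pow_four_le_split {u : X → ℝ} (hu : MemSigma u) :
    ∫ x, u x ^ 4 ≤ 8 * ((∫ z, par u z ^ 4) / (2 * Real.pi)) + 8 * ∫ x, P1 u x ^ 4 := by
  have hg := memSigma_tensorPhi0 (memH1_par hu.1)
  have i1 := integrable_pow_four hg.memLp_four
  have i2 := integrable_pow_four hu.P1.memLp_four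
  rw [← integral_tensorPhi0_pow_four, ← integral_const_mul, ← integral_const_mul,
    ← integral_add (i1.const_mul 8) (i2.const_mul 8)]
  refine integral_mono (integrable_pow_four hu.memLp_four) ((i1.const_mul 8).add (i2.const_mul 8))
    fun x => ?_
  have e : u x = tensorPhi0 (par u) x + P1 u x := by simp [P1]
  simp only
  rw [e]
  generalize tensorPhi0 (par u) x = a
  generalize P1 u x = b
  nlinarith [sq_nonneg (a - b), sq_nonneg (a ^ 2 - b ^ 2), sq_nonneg (a + b),
    mul_nonneg (sq_nonneg (a - b)) (sq_nonneg (a - b)), mul_nonneg (sq_nonneg (a - b)) (sq_nonneg (a + b))]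

theorem integral_par_pow_four_le {u : X → ℝ} (hu : MemSigma u) :
    (∫ z, par u z ^ 4) / (2 * Real.pi) ≤ mass u * √(mass u) * √(mass (weakDeriv eZ u)) := by
  have h := (memH1_par hu.1).integral_pow_four_le
  have h1 : l2Norm (par u) ≤ √(mass u) := Real.sqrt_le_sqrt (mass_par_le hu.memLp)
  have h2 : l2Norm (weakDeriv 1 (par u)) ≤ √(mass (weakDeriv eZ u)) :=
    Real.sqrt_le_sqrt hu.mass_weakDeriv_par_le
  have h3 := mass_par_le hu.memLp
  have h0 := l2Norm_nonneg (weakDeriv 1 (par u))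
  rw [div_le_iff₀ (by positivity)]
  calc _ ≤ _ := h
    _ ≤ 2 * (√(mass u) * √(mass (weakDeriv eZ u))) * mass u := by
        have := mass_nonneg (par u)
        gcongr
    _ ≤ mass u * √(mass u) * √(mass (weakDeriv eZ u)) * (2 * Real.pi) := by
        have : 0 ≤ mass u * √(mass u) * √(mass (weakDeriv eZ u)) := by
          have := mass_nonneg u
          positivity
        nlinarith [Real.pi_gt_three]

theorem sqrt_mul_le_young {A Z : ℝ} (hZ : 0 ≤ Z) : A * √Z ≤ Z / 8 + 2 * A ^ 2 := by
  nlinarith [sq_nonneg (√Z - 4 * A), Real.sq_sqrt hZ]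

theorem energy3_tensorPhi0_soliton (ω : ℝ) {b : ℝ} (hb : 0 < b) :
    energy3 ω (tensorPhi0 (soliton b)) = -(4 * Real.pi * b ^ 3 / 3) := by
  rw [← half_mass_solitonDeriv_sub hb, energy3_eq, sigmaYSq_tensorPhi0 (memH1_soliton hb),
    mass_congr_ae (weakDeriv_tensorPhi0_eZ (memH1_soliton hb)), mass_tensorPhi0,
    integral_tensorPhi0_pow_four]
  field_simp
  ring

/-- The soliton of mass m times Φ₀ is admissible, with σ = 0, and its energy is negative
independently of ω. -/
theorem IsMinimizer3.energy_le_soliton {ω m : ℝ} {Q : X → ℝ} (h : IsMinimizer3 ω m Q) (hm : 0 < m) :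
    energy3 ω Q ≤ -(4 * Real.pi * (m / (8 * Real.pi)) ^ 3 / 3) := by
  have hb : 0 < m / (8 * Real.pi) := by positivity
  rw [← energy3_tensorPhi0_soliton ω hb]
  refine h.energy_le (memSigma_tensorPhi0 (memH1_soliton hb)) ?_ ?_
  · rw [mass_tensorPhi0, mass_soliton hb]
    field_simp
  · rw [sigmaYSq_tensorPhi0 (memH1_soliton hb)]
    exact Real.sqrt_nonneg _

/-- A priori bounds for minimizers. -/
theorem exists_apriori {m : ℝ} (hm : 0 < m) : ∃ ω₀ C : ℝ, 1 ≤ ω₀ ∧ 0 < C ∧ ∀ ω Q, ω₀ ≤ ω →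
    IsMinimizer3 ω m Q → sigmaYSq Q < √ω ∧ sigmaYSq Q ≤ C / ω ∧ mass (weakDeriv eZ Q) ≤ C ∧
      ∫ x, Q x ^ 4 ≤ C := by
  obtain ⟨C₁, hC₁, H₁⟩ := exists_integral_P1_pow_four_le
  set a := 2 * (2 * (m * √m)) ^ 2 with ha
  set D := 2 * (2 * (C₁ * √m)) ^ 2 with hD
  have ha0 : 0 < a := by positivity
  have hD0 : 0 < D := by positivity
  -- The threshold 4a + 1 makes the final bound σ ≤ 4a/ω smaller than 1, hence interior to the
  -- constraint; (4D)² makes √ω ≥ 4D, which absorbs Dσ².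
  refine ⟨max 1 (max (4 * a + 1) ((4 * D) ^ 2)), 4 * (2 * a + D * (4 * a) ^ 2) , le_max_left _ _,
    by positivity, fun ω Q hω h => ?_⟩
  have hω1 : 1 ≤ ω := (le_max_left _ _).trans hω
  have hω2 : 4 * a + 1 ≤ ω := ((le_max_left _ _).trans (le_max_right _ _)).trans hω
  have hω3 : (4 * D) ^ 2 ≤ ω := ((le_max_right _ _).trans (le_max_right _ _)).trans hω
  have hω0 : 0 < ω := by linarith
  have hQ := h.memSigma
  have hσ0 := sigmaYSq_nonneg hQ
  have hσ := h.sigmaYSq_le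
  have hE := h.energy_le_soliton hm
  rw [energy3_eq] at hE
  have hZ0 := mass_nonneg (weakDeriv eZ Q)
  have hP := integral_pow_four_le_split hQ
  have hg := integral_par_pow_four_le hQ
  have hf := H₁ Q hQ
  rw [h.mass_eq] at hg hf
  set σ := sigmaYSq Q
  set Z := mass (weakDeriv eZ Q)
  set P := ∫ x, Q x ^ 4
  have y1 := sqrt_mul_le_young (A := 2 * (m * √m)) hZ0
  have y2 := sqrt_mul_le_young (A := 2 * (C₁ * √m) * σ) hZ0
  have hP4 : P / 4 ≤ Z / 4 + a + D * σ ^ 2 := by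
    have : 2 * (2 * (C₁ * √m) * σ) ^ 2 = D * σ ^ 2 := by rw [hD]; ring
    nlinarith
  have hsq : √ω ^ 2 = ω := Real.sq_sqrt hω0.le
  have hs4 : 4 * D ≤ √ω := Real.le_sqrt_of_sq_le hω3
  -- The only use of the constraint σ ≤ √ω: it lowers the quadratic term to Dσ√ω, which ωσ
  -- dominates. Without it the energy bound alone could not exclude large σ.
  have hDσ : D * σ ^ 2 ≤ ω * σ / 4 := by
    have e1 : D * σ ^ 2 ≤ D * (σ * √ω) := by
      have := mul_le_mul_of_nonneg_left hσ hσ0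
      nlinarith
    have e2 : 4 * D * (σ * √ω) ≤ √ω * (σ * √ω) := by gcongr
    nlinarith
  have hb3 : 0 ≤ 4 * Real.pi * (m / (8 * Real.pi)) ^ 3 / 3 := by positivity
  have hsum : ω * σ + Z ≤ 4 * a := by linarith
  have hωσ : 0 ≤ ω * σ := by positivity
  have hσ1 : σ ≤ 4 * a / ω := by
    rw [le_div_iff₀ hω0]
    linarith
  have hlt : 4 * a / ω < 1 := by
    rw [div_lt_one hω0]
    linarith
  have hone : 1 ≤ √ω := Real.one_le_sqrt.2 hω1
  have hDa : 0 ≤ D * (4 * a) ^ 2 := by positivity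
  refine ⟨by linarith, hσ1.trans ?_, by linarith, ?_⟩
  · gcongr
    linarith
  · have : D * σ ^ 2 ≤ D * (4 * a) ^ 2 := by
      have : σ ≤ 4 * a := by nlinarith
      gcongr
    linarith

/-- The Lagrange multiplier of a minimizer. -/
def multiplier (ω m : ℝ) (Q : X → ℝ) : ℝ :=
  ((∫ x, Q x ^ 4) - ω * sigmaYSq Q - mass (weakDeriv eZ Q)) / m

/-- The multiplier times m equals -2E + ½∫Q⁴, and E is at most the negative soliton energy; the
latter also bounds ∫Q⁴ from below. -/
theorem IsMinimizer3.multiplier_bounds {ω m : ℝ} {Q : X → ℝ} (h : IsMinimizer3 ω m Q) (hm : 0 < m)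
    (hω : 0 ≤ ω) : 2 * (4 * Real.pi * (m / (8 * Real.pi)) ^ 3 / 3) / m ≤ multiplier ω m Q ∧
      multiplier ω m Q ≤ (∫ x, Q x ^ 4) / m ∧
      4 * (4 * Real.pi * (m / (8 * Real.pi)) ^ 3 / 3) ≤ ∫ x, Q x ^ 4 := by
  have hE := h.energy_le_soliton hm
  rw [energy3_eq] at hE
  have h1 := mass_nonneg (weakDeriv eZ Q)
  have h2 : 0 ≤ ω * sigmaYSq Q := mul_nonneg hω (sigmaYSq_nonneg h.memSigma)
  have h3 : 0 ≤ ∫ x, Q x ^ 4 := integral_nonneg fun x => by positivity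
  unfold multiplier
  refine ⟨?_, ?_, ?_⟩
  · gcongr
    linarith
  · gcongr
    linarith
  · linarith

/-- The remainder estimate for the cubic term. -/
theorem abs_cube_mul_le (a b : ℝ) : |(a + b) ^ 3 * b| ≤ 4 * (|a| ^ 3 * |b|) + 4 * b ^ 4 := by
  have h : |a + b| ^ 3 ≤ 4 * (|a| ^ 3 + |b| ^ 3) := by
    have h1 : |a + b| ^ 3 ≤ (|a| + |b|) ^ 3 := pow_le_pow_left₀ (abs_nonneg _) (abs_add_le a b) 3
    have := abs_nonneg a
    have := abs_nonneg b
    nlinarith [mul_nonneg (add_nonneg (abs_nonneg a) (abs_nonneg b)) (sq_nonneg (|a| - |b|))]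
  rw [abs_mul, abs_pow]
  have e : b ^ 4 = |b| ^ 3 * |b| := by
    rw [← pow_succ, Even.pow_abs (by decide)]
  rw [e]
  nlinarith [abs_nonneg b]

theorem ae_tensorPhi0_par_sq_le {u : X → ℝ} (hu : MemSigma u) :
    ∀ᵐ x, tensorPhi0 (par u) x ^ 2 ≤ 2 * (√(mass u) * √(mass (weakDeriv eZ u))) := by
  filter_upwards [ae_comp_snd (memH1_par hu.1).ae_sq_le] with x hx
  have h1 : l2Norm (par u) ≤ √(mass u) := Real.sqrt_le_sqrt (mass_par_le hu.memLp)
  have h2 : l2Norm (weakDeriv 1 (par u)) ≤ √(mass (weakDeriv eZ u)) :=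
    Real.sqrt_le_sqrt hu.mass_weakDeriv_par_le
  have h0 := l2Norm_nonneg (weakDeriv 1 (par u))
  have h3 : tensorPhi0 (par u) x ^ 2 ≤ par u x.2 ^ 2 := by
    rw [tensorPhi0, mul_pow]
    refine mul_le_of_le_one_right (sq_nonneg _) (pow_le_one₀ (Phi0_pos _).le (Phi0_le_one _))
  refine h3.trans (hx.trans ?_)
  gcongr

/-- With u = g + f, g the Φ₀-part, the cube costs at most 4|g|³|f| + 4f⁴. The one-dimensional sup
bound controls g², leaving a term linear in ‖f‖. -/
theorem abs_integral_cube_mul_P1_le {u : X → ℝ} (hu : MemSigma u) :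
    |∫ x, u x ^ 3 * P1 u x| ≤ 8 * (√(mass u) * √(mass (weakDeriv eZ u))) * √(mass u) * l2Norm (P1 u)
      + 4 * ∫ x, P1 u x ^ 4 := by
  set K := 2 * (√(mass u) * √(mass (weakDeriv eZ u))) with hK
  have hK0 : 0 ≤ K := by positivity
  have hgS := memSigma_tensorPhi0 (memH1_par hu.1)
  set g := tensorPhi0 (par u) with hg
  have i4 := integrable_pow_four hu.P1.memLp_four
  have igf : Integrable (fun x => |g x * P1 u x|) volume :=
    (integrable_mul_of_memLp hgS.memLp hu.P1.memLp).abs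
  have e1 : ∀ᵐ x, |u x ^ 3 * P1 u x| ≤ 4 * K * |g x * P1 u x| + 4 * P1 u x ^ 4 := by
    filter_upwards [ae_tensorPhi0_par_sq_le hu] with x hx
    have e : u x = g x + P1 u x := by simp [P1, hg]
    have := abs_cube_mul_le (g x) (P1 u x)
    rw [← e] at this
    have h3 : |g x| ^ 3 * |P1 u x| ≤ K * |g x * P1 u x| := by
      rw [abs_mul, ← mul_assoc, pow_succ, sq_abs]
      gcongr
    linarith
  calc |∫ x, u x ^ 3 * P1 u x| ≤ ∫ x, |u x ^ 3 * P1 u x| := abs_integral_le_integral_abs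
    _ ≤ ∫ x, (4 * K * |g x * P1 u x| + 4 * P1 u x ^ 4) :=
        integral_mono_ae (integrable_cube_mul hu.memLp_four hu.P1.memLp_four).abs
          ((igf.const_mul _).add (i4.const_mul _)) e1
    _ = 4 * K * (∫ x, |g x * P1 u x|) + 4 * ∫ x, P1 u x ^ 4 := by
        rw [integral_add (igf.const_mul _) (i4.const_mul _), integral_const_mul, integral_const_mul]
    _ ≤ 4 * K * (√(mass u) * l2Norm (P1 u)) + 4 * ∫ x, P1 u x ^ 4 := by
        have h1 := integral_abs_mul_le hgS.memLp hu.P1.memLp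
        have h2 : l2Norm g ≤ √(mass u) := by
          refine Real.sqrt_le_sqrt ?_
          rw [hg, mass_tensorPhi0]
          exact mass_par_le hu.memLp
        have h3 : l2Norm g * l2Norm (P1 u) ≤ √(mass u) * l2Norm (P1 u) := by
          have := l2Norm_nonneg (P1 u)
          gcongr
        have := h1.trans h3
        gcongr
    _ = _ := by rw [hK]; ring

/-- The part of a minimizer orthogonal to the lowest state is small. -/
theorem exists_P1_bounds {m : ℝ} (hm : 0 < m) : ∃ ω₀ C : ℝ, 1 ≤ ω₀ ∧ 0 < C ∧ ∀ ω Q, ω₀ ≤ ω →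
    IsMinimizer3 ω m Q → sigmaYSq Q < √ω ∧ mass (weakDeriv eZ Q) ≤ C ∧ ∫ x, Q x ^ 4 ≤ C ∧
      ∫ x, P1 Q x ^ 4 ≤ C / ω ∧
      √(sigmaYSq Q) ≤ C / ω ∧ l2Norm (P1 Q) ≤ C / ω ∧ mass (weakDeriv eZ (P1 Q)) ≤ C / ω := by
  obtain ⟨ω₁, C₁, hω₁, hC₁, H₁⟩ := exists_apriori hm
  obtain ⟨C₂, hC₂, H₂⟩ := exists_integral_P1_pow_four_le
  set A := 8 * (√m * √C₁) * √m * 3 with hA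
  set B := 4 * (C₂ * √m * √C₁) with hB
  have hA0 : 0 < A := by positivity
  have hB0 : 0 < B := by positivity
  refine ⟨max ω₁ (2 * B), C₁ + B * C₁ + 3 * (2 * A) + 2 * A ^ 2, hω₁.trans (le_max_left _ _),
    by positivity, fun ω Q hω h => ?_⟩
  have hω1 : ω₁ ≤ ω := (le_max_left _ _).trans hω
  have hω2 : 2 * B ≤ ω := (le_max_right _ _).trans hω
  have hω0 : 0 < ω := by linarith
  obtain ⟨a1, a2, a3, a4⟩ := H₁ ω Q hω1 h
  have hQ := h.memSigma
  have hσ0 := sigmaYSq_nonneg hQ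
  -- Testing with f itself: by orthogonality the left side is ωσ + ‖∂_z f‖² - ∫Q³f, and the right
  -- side is -μ‖f‖² ≤ 0 since the multiplier is nonnegative.
  have hel := h.stationary hm a1 hQ.P1
  rw [hQ.integral_ann_P1, hQ.sigmaYSq_P1, hQ.integral_weakDeriv_eZ_P1, integral_mul_P1 hQ.memLp] at hel
  have hmu := (h.multiplier_bounds hm hω0.le).1
  unfold multiplier at hmu
  have hmu0 : 0 ≤ ((∫ x, Q x ^ 4) - ω * sigmaYSq Q - mass (weakDeriv eZ Q)) / m :=
    le_trans (by positivity) hmu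
  have hf4 : 4 * ∫ x, P1 Q x ^ 4 ≤ B * sigmaYSq Q := by
    have h1 := H₂ Q hQ
    rw [h.mass_eq] at h1
    have h2 : C₂ * √m * sigmaYSq Q * √(mass (weakDeriv eZ Q)) ≤ C₂ * √m * sigmaYSq Q * √C₁ := by
      gcongr
    rw [hB]
    linarith
  -- The 3 rounds up √8 from the spectral gap.
  have hgap : l2Norm (P1 Q) ≤ 3 * √(sigmaYSq Q) := by
    have h1 : (3 : ℝ) = √9 := by
      rw [show (9 : ℝ) = 3 ^ 2 by norm_num, Real.sqrt_sq (by norm_num)]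
    rw [h1, ← Real.sqrt_mul (by norm_num)]
    refine Real.sqrt_le_sqrt (hQ.gap.trans ?_)
    linarith
  have hc := abs_integral_cube_mul_P1_le hQ
  rw [h.mass_eq] at hc
  have hc2 : 8 * (√m * √(mass (weakDeriv eZ Q))) * √m * l2Norm (P1 Q) ≤ A * √(sigmaYSq Q) := by
    calc _ ≤ 8 * (√m * √C₁) * √m * (3 * √(sigmaYSq Q)) := by
          have := l2Norm_nonneg (P1 Q)
          gcongr
      _ = _ := by rw [hA]; ring
  have hmf := mass_nonneg (P1 Q)
  have hZf := mass_nonneg (weakDeriv eZ (P1 Q))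
  have hmain : ω * sigmaYSq Q + mass (weakDeriv eZ (P1 Q)) ≤ A * √(sigmaYSq Q) + B * sigmaYSq Q := by
    have := le_abs_self (∫ x, Q x ^ 3 * P1 Q x)
    have := mul_nonneg hmu0 hmf
    linarith
  have hhalf : ω / 2 * sigmaYSq Q + mass (weakDeriv eZ (P1 Q)) ≤ A * √(sigmaYSq Q) := by
    have : B * sigmaYSq Q ≤ ω / 2 * sigmaYSq Q := by
      gcongr
      linarith
    linarith
  have hsq := Real.sq_sqrt hσ0
  have hs0 := Real.sqrt_nonneg (sigmaYSq Q)
  -- The right side of `hhalf` is linear in √σ and the left quadratic, so one factor √σ cancels and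
  -- improves σ = O(1/ω) to σ = O(1/ω²).
  have hs : √(sigmaYSq Q) ≤ 2 * A / ω := by
    rcases hs0.eq_or_lt with h0 | h0
    · rw [← h0]
      positivity
    · rw [le_div_iff₀ hω0]
      nlinarith
  have hBC : 0 < B * C₁ := by positivity
  have hA2 : 0 < A ^ 2 := by positivity
  refine ⟨a1, by linarith, by linarith, ?_, hs.trans ?_, ?_, ?_⟩
  · have : B * sigmaYSq Q ≤ B * (C₁ / ω) := by gcongr
    rw [← mul_div_assoc] at this
    have h5 : B * C₁ / ω ≤ (C₁ + B * C₁ + 3 * (2 * A) + 2 * A ^ 2) / ω := by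
      gcongr
      linarith
    have h6 : 0 ≤ ∫ x, P1 Q x ^ 4 := integral_nonneg fun x => by positivity
    linarith
  · gcongr
    linarith
  · calc _ ≤ 3 * (2 * A / ω) := hgap.trans (by gcongr)
      _ = 3 * (2 * A) / ω := by ring
      _ ≤ _ := by gcongr; linarith
  · calc _ ≤ A * (2 * A / ω) := by
          have : 0 ≤ ω / 2 * sigmaYSq Q := by positivity
          have : A * √(sigmaYSq Q) ≤ A * (2 * A / ω) := by gcongr
          linarith
      _ = 2 * A ^ 2 / ω := by ring
      _ ≤ _ := by gcongr; linarith

end Bounds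

/-! ### Reduction to the one-dimensional equation -/

section Reduction

theorem integrable_mul_Phi0 {u : X → ℝ} (hu : Integrable u volume) :
    Integrable (fun x : X => u x * Phi0 x.1) volume := by
  have := hu.bdd_mul (c := 1) (g := u) (f := fun x : X => Phi0 x.1)
    (continuous_Phi0.comp continuous_fst).aestronglyMeasurable
    (.of_forall fun x => by rw [Real.norm_of_nonneg (Phi0_pos _).le]; exact Phi0_le_one _)
  exact this.congr (.of_forall fun x => mul_comm _ _)

theorem ae_integrable_slice_mul_Phi0 {u : X → ℝ} (hu : Integrable u volume) :
    ∀ᵐ z : ℝ, Integrable (fun y : Y => u (y, z) * Phi0 y) volume :=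
  Integrable.prod_left_ae (μ := (volume : Measure Y)) (ν := (volume : Measure ℝ)) (integrable_mul_Phi0 hu)

theorem integrable_par {u : X → ℝ} (hu : Integrable u volume) : Integrable (par u) volume :=
  Integrable.integral_prod_right (μ := (volume : Measure Y)) (ν := (volume : Measure ℝ))
    (integrable_mul_Phi0 hu)

theorem integral_abs_par_le {u : X → ℝ} (hu : Integrable u volume) :
    ∫ z, |par u z| ≤ ∫ x, |u x| := by
  have hi := (integrable_mul_Phi0 hu).abs
  calc ∫ z, |par u z| ≤ ∫ z : ℝ, ∫ y : Y, |u (y, z) * Phi0 y| := by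
        refine integral_mono (integrable_par hu).abs
          (Integrable.integral_prod_right (μ := (volume : Measure Y)) (ν := (volume : Measure ℝ)) hi)
          fun z => abs_integral_le_integral_abs
    _ = ∫ x : X, |u x * Phi0 x.1| :=
        (integral_prod_symm (μ := (volume : Measure Y)) (ν := (volume : Measure ℝ)) _ hi).symm
    _ ≤ ∫ x, |u x| := by
        refine integral_mono hi hu.abs fun x => ?_
        simp only [abs_mul, abs_of_pos (Phi0_pos x.1)]
        exact mul_le_of_le_one_right (abs_nonneg _) (Phi0_le_one _)

theorem par_sub_ae {u v : X → ℝ} (hu : Integrable u volume) (hv : Integrable v volume) :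
    par (fun x => u x - v x) =ᵐ[volume] fun z => par u z - par v z := by
  filter_upwards [ae_integrable_slice_mul_Phi0 hu, ae_integrable_slice_mul_Phi0 hv] with z h1 h2
  simp only [par, sub_mul]
  exact integral_sub h1 h2

/-- Version of the adjointness for functions that are only integrable, as needed for Q³; boundedness
of ψ and Φ₀ replaces the L² pairing. -/
theorem integral_mul_tensorPhi0_of_integrable {u : X → ℝ} {ψ : ℝ → ℝ} (hu : Integrable u volume)
    (hψ : IsTest ψ) : ∫ x, u x * tensorPhi0 ψ x = ∫ z, par u z * ψ z := by
  obtain ⟨B, hB⟩ := hψ.2.exists_bound_of_continuous hψ.continuous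
  have hi : Integrable (fun x : X => u x * tensorPhi0 ψ x) volume := by
    have := (integrable_mul_Phi0 hu).bdd_mul (c := B) (f := fun x : X => ψ x.2)
      (hψ.continuous.comp continuous_snd).aestronglyMeasurable (.of_forall fun x => hB _)
    refine this.congr (.of_forall fun x => ?_)
    simp only [tensorPhi0]
    ring
  refine (integral_prod_symm (μ := (volume : Measure Y)) (ν := (volume : Measure ℝ)) _ hi).trans ?_
  congr 1
  ext z
  rw [par, ← integral_mul_const]
  congr 1
  ext y
  simp only [tensorPhi0]
  ring

theorem par_tensorPhi0_cube (w : ℝ → ℝ) (z : ℝ) :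
    par (fun x => tensorPhi0 w x ^ 3) z = w z ^ 3 / (2 * Real.pi) := by
  have : ∀ y : Y, (w z * Phi0 y) ^ 3 * Phi0 y = w z ^ 3 * Phi0 y ^ 4 := fun y => by ring
  simp only [par, tensorPhi0, this]
  rw [integral_const_mul, integral_Phi0_pow_four]
  ring

theorem integrable_cube {E : Type*} [MeasureSpace E] {u : E → ℝ} (h2 : MemLp u 2 volume)
    (h4 : Integrable (fun x => u x ^ 4) volume) : Integrable (fun x => u x ^ 3) volume := by
  refine (h2.integrable_sq.add h4).mono' (h2.1.pow 3) (.of_forall fun x => ?_)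
  simp only [Real.norm_eq_abs, Pi.add_apply]
  rw [abs_le]
  constructor <;> nlinarith [sq_nonneg (u x * (u x - 1)), sq_nonneg (u x * (u x + 1)), sq_nonneg (u x)]

theorem memLp_sq_of_integrable_pow_four {E : Type*} [MeasureSpace E] {u : E → ℝ}
    (h : AEStronglyMeasurable u volume) (h4 : Integrable (fun x => u x ^ 4) volume) :
    MemLp (fun x => u x ^ 2) 2 volume := by
  refine (memLp_two_iff_integrable_sq (h.pow 2)).2 ?_
  exact h4.congr (.of_forall fun x => by simp only [Pi.pow_apply]; ring)

theorem l2Norm_sq_fun {E : Type*} [MeasureSpace E] (u : E → ℝ) :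
    l2Norm (fun x => u x ^ 2) = √(∫ x, u x ^ 4) := by
  rw [l2Norm, mass_eq_integral_sq]
  simp only [← pow_mul]

/-- Pointwise |u³ - g³| ≤ (3/2)|u - g|(u² + g²), then Cauchy–Schwarz. With g the Φ₀-part of Q this
is the L¹ smallness of the remainder. -/
theorem integral_abs_cube_sub_le {E : Type*} [MeasureSpace E] {u g : E → ℝ} (hu : MemLp u 2 volume)
    (hg : MemLp g 2 volume) (hu4 : Integrable (fun x => u x ^ 4) volume)
    (hg4 : Integrable (fun x => g x ^ 4) volume) :
    ∫ x, |u x ^ 3 - g x ^ 3| ≤ 3 / 2 * l2Norm (fun x => u x - g x)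
      * (√(∫ x, u x ^ 4) + √(∫ x, g x ^ 4)) := by
  have hf := hu.sub hg
  have hu2 := memLp_sq_of_integrable_pow_four hu.1 hu4
  have hg2 := memLp_sq_of_integrable_pow_four hg.1 hg4
  have i1 := (integrable_mul_of_memLp hf hu2).abs
  have i2 := (integrable_mul_of_memLp hf hg2).abs
  have e : ∀ x, |u x ^ 3 - g x ^ 3| ≤ 3 / 2 * |(u x - g x) * u x ^ 2| + 3 / 2 * |(u x - g x) * g x ^ 2| := by
    intro x
    have hq : 0 ≤ u x ^ 2 + u x * g x + g x ^ 2 := by nlinarith [sq_nonneg (u x + g x)]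
    rw [show u x ^ 3 - g x ^ 3 = (u x - g x) * (u x ^ 2 + u x * g x + g x ^ 2) by ring, abs_mul, abs_mul,
      abs_mul, abs_of_nonneg (sq_nonneg (u x)), abs_of_nonneg (sq_nonneg (g x)), abs_of_nonneg hq]
    have := mul_le_mul_of_nonneg_left (by nlinarith [sq_nonneg (u x - g x)] :
      u x ^ 2 + u x * g x + g x ^ 2 ≤ 3 / 2 * u x ^ 2 + 3 / 2 * g x ^ 2) (abs_nonneg (u x - g x))
    linarith
  calc ∫ x, |u x ^ 3 - g x ^ 3|
      ≤ ∫ x, (3 / 2 * |(u x - g x) * u x ^ 2| + 3 / 2 * |(u x - g x) * g x ^ 2|) :=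
        integral_mono ((integrable_cube hu hu4).sub (integrable_cube hg hg4)).abs
          ((i1.const_mul _).add (i2.const_mul _)) e
    _ = 3 / 2 * (∫ x, |(u x - g x) * u x ^ 2|) + 3 / 2 * ∫ x, |(u x - g x) * g x ^ 2| := by
        rw [← integral_const_mul, ← integral_const_mul]
        exact integral_add (i1.const_mul _) (i2.const_mul _)
    _ ≤ 3 / 2 * (l2Norm (fun x => u x - g x) * √(∫ x, u x ^ 4))
        + 3 / 2 * (l2Norm (fun x => u x - g x) * √(∫ x, g x ^ 4)) := by
        have h1 := integral_abs_mul_le hf hu2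
        have h2 := integral_abs_mul_le hf hg2
        rw [l2Norm_sq_fun] at h1 h2
        exact add_le_add (mul_le_mul_of_nonneg_left h1 (by norm_num))
          (mul_le_mul_of_nonneg_left h2 (by norm_num))
    _ = _ := by ring

variable {ω m : ℝ} {Q : X → ℝ}

theorem IsMinimizer3.integrable_cube (h : IsMinimizer3 ω m Q) :
    Integrable (fun x => Q x ^ 3) volume :=
  DimRed.integrable_cube h.memSigma.memLp (integrable_pow_four h.memSigma.memLp_four)

/-- Take ψ(z)Φ₀(y) in the Euler–Lagrange equation: the annihilation terms vanish, and ω disappears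
except through the multiplier. -/
theorem IsMinimizer3.hasWeakDeriv_weakDeriv_par (h : IsMinimizer3 ω m Q) (hm : 0 < m)
    (hlt : sigmaYSq Q < √ω) : HasWeakDeriv (weakDeriv 1 (par Q)) 1
      (fun z => multiplier ω m Q * par Q z - par (fun x => Q x ^ 3) z) := by
  have hQ := h.memSigma
  have hw := memH1_par hQ.1
  have hc := integrable_par h.integrable_cube
  have hwl : LocallyIntegrable (par Q) volume := hw.1.locallyIntegrable (by norm_num)
  refine ⟨(hw.memLp_weakDeriv 1).locallyIntegrable (by norm_num),
    (hwl.smul (multiplier ω m Q)).sub hc.locallyIntegrable, fun ψ hψ => ?_⟩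
  have hψS := memSigma_tensorPhi0 hψ.memH1_real
  have hel := h.stationary hm hlt hψS
  have e1 : ∑ i, ∫ x, ann i Q x * ann i (tensorPhi0 ψ) x = 0 := by
    refine Finset.sum_eq_zero fun i _ => integral_eq_zero_of_ae ?_
    filter_upwards [ann_tensorPhi0 hψ.memH1_real i] with x hx
    simp [hx]
  have e2 : ∫ x, weakDeriv eZ Q x * weakDeriv eZ (tensorPhi0 ψ) x
      = ∫ z, weakDeriv 1 (par Q) z * fderiv ℝ ψ z 1 := by
    have s1 : ∫ x, weakDeriv eZ Q x * weakDeriv eZ (tensorPhi0 ψ) x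
        = ∫ x, weakDeriv eZ Q x * tensorPhi0 (weakDeriv 1 ψ) x := by
      refine integral_congr_ae ?_
      filter_upwards [weakDeriv_tensorPhi0_eZ hψ.memH1_real] with x hx
      rw [hx]
    rw [s1, integral_mul_tensorPhi0 (hQ.1.memLp_weakDeriv eZ) (hψ.memH1_real.memLp_weakDeriv 1)]
    refine integral_congr_ae ?_
    filter_upwards [weakDeriv_par hQ.1, hψ.weakDeriv_ae] with z h1 h2
    rw [h1, h2]
  rw [e1, e2, integral_mul_tensorPhi0_of_integrable h.integrable_cube hψ,
    integral_mul_tensorPhi0 hQ.memLp hψ.memH1_real.1] at hel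
  have i1 : Integrable (fun z => par Q z * ψ z) volume := integrable_mul_of_memLp hw.1 (hψ.memLp 2)
  have i2 : Integrable (fun z => par (fun x => Q x ^ 3) z * ψ z) volume := by
    have := hψ.integrable_smul hc.locallyIntegrable
    exact this.congr (.of_forall fun z => by simp only [smul_eq_mul]; ring)
  have e3 : ∫ z, ψ z • (multiplier ω m Q * par Q z - par (fun x => Q x ^ 3) z)
      = multiplier ω m Q * (∫ z, par Q z * ψ z) - ∫ z, par (fun x => Q x ^ 3) z * ψ z := by
    rw [← integral_const_mul, ← integral_sub (i1.const_mul _) i2]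
    congr 1
    ext z
    simp only [smul_eq_mul]
    ring
  rw [e3]
  have e4 : ∫ z, (fderiv ℝ ψ z 1) • weakDeriv 1 (par Q) z
      = ∫ z, weakDeriv 1 (par Q) z * fderiv ℝ ψ z 1 := by
    congr 1
    ext z
    simp only [smul_eq_mul]
    ring
  rw [e4]
  unfold multiplier
  linarith

theorem IsMinimizer3.par_nonneg (h : IsMinimizer3 ω m Q) (z : ℝ) : 0 ≤ par Q z :=
  integral_nonneg fun y => mul_nonneg (h.nonneg _) (Phi0_pos y).le

theorem nonneg_of_ae {w W : ℝ → ℝ} (hw : ∀ z, 0 ≤ w z) (hW : w =ᵐ[volume] W) (hc : Continuous W) (z : ℝ) :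
    0 ≤ W z := by
  have hd : Dense {z | 0 ≤ W z} := by
    refine Measure.dense_of_ae (μ := (volume : Measure ℝ)) ?_
    filter_upwards [hW] with z hz
    rw [← hz]
    exact hw z
  have hcl : IsClosed {z | 0 ≤ W z} := isClosed_le continuous_const hc
  have := hd.closure_eq
  rw [hcl.closure_eq] at this
  exact (Set.eq_univ_iff_forall.1 this) z

/-- As ∫Φ₀⁴ = 1/2π, the projection of (wΦ₀)³ is w³/2π. The remainder is therefore the projection of
(wΦ₀)³ - Q³, and the projection does not increase the L¹ norm because 0 ≤ Φ₀ ≤ 1. -/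
theorem IsMinimizer3.exists_isApproxSoliton (h : IsMinimizer3 ω m Q) (hm : 0 < m)
    (hlt : sigmaYSq Q < √ω) {ε : ℝ}
    (hε : 3 / 2 * l2Norm (P1 Q) * (√(∫ x, Q x ^ 4) + √(∫ x, tensorPhi0 (par Q) x ^ 4)) ≤ ε) :
    ∃ W p R : ℝ → ℝ, par Q =ᵐ[volume] W ∧ weakDeriv 1 (par Q) =ᵐ[volume] p ∧
      IsApproxSoliton (multiplier ω m Q) ε W p R := by
  have hQ := h.memSigma
  have hw := memH1_par hQ.1
  have hwd := h.hasWeakDeriv_weakDeriv_par hm hlt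
  obtain ⟨W, p, hW, hp, hd, hprim⟩ := exists_classical hw hwd
  have hWc : Continuous W := continuous_iff_continuousAt.2 fun z => (hd z).continuousAt
  have hgS := memSigma_tensorPhi0 hw
  have hQ4 := integrable_pow_four hQ.memLp_four
  have hg4 := integrable_pow_four hgS.memLp_four
  have ig3 := DimRed.integrable_cube hgS.memLp hg4
  have hc := integrable_par h.integrable_cube
  have iw3 : Integrable (fun z => par Q z ^ 3 / (2 * Real.pi)) volume :=
    (DimRed.integrable_cube hw.1 (integrable_pow_four hw.memLp_four)).div_const _
  refine ⟨W, p, fun z => par Q z ^ 3 / (2 * Real.pi) - par (fun x => Q x ^ 3) z, hW, hp,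
    ⟨hd, fun a b => ?_, iw3.sub hc, ?_, ?_, ?_, hw.1.ae_eq hW, (hw.memLp_weakDeriv 1).ae_eq hp⟩⟩
  · rw [hprim]
    refine intervalIntegral.integral_congr_ae ?_
    filter_upwards [hW] with z hz _
    rw [← hz]
    ring
  · have e : (fun z => par Q z ^ 3 / (2 * Real.pi) - par (fun x => Q x ^ 3) z)
        =ᵐ[volume] par (fun x => tensorPhi0 (par Q) x ^ 3 - Q x ^ 3) := by
      filter_upwards [par_sub_ae ig3 h.integrable_cube] with z hz
      rw [hz, par_tensorPhi0_cube]
    have e' : ∫ z, |par Q z ^ 3 / (2 * Real.pi) - par (fun x => Q x ^ 3) z|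
        = ∫ z, |par (fun x => tensorPhi0 (par Q) x ^ 3 - Q x ^ 3) z| := by
      refine integral_congr_ae ?_
      filter_upwards [e] with z hz
      rw [hz]
    rw [e']
    refine (integral_abs_par_le (ig3.sub h.integrable_cube)).trans (le_trans ?_ hε)
    have := integral_abs_cube_sub_le hQ.memLp hgS.memLp hQ4 hg4
    refine le_trans (le_of_eq ?_) this
    congr 1
    ext x
    exact abs_sub_comm _ _
  -- Monotonicity passes through the fibre integral only where the slice is integrable, elsewhere
  -- `par` takes the default value 0; hence the full-measure set G.
  · refine radial_of_ae (G := {z | Integrable (fun y : Y => Q (y, z) * Phi0 y) volume}) ?_ ?_ hW hWc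
    · filter_upwards [memLp_slice hQ.memLp] with z hz
      exact integrable_mul_of_memLp hz memLp_Phi0
    · intro z hz z' hz' hzz
      refine integral_mono hz' hz fun y => ?_
      exact mul_le_mul_of_nonneg_right (h.symm_decreasing (y, z) (y, z') le_rfl hzz) (Phi0_pos y).le
  · exact nonneg_of_ae h.par_nonneg hW hWc

/-- The longitudinal profile of a minimizer is an approximate soliton. -/
theorem exists_profile {m : ℝ} (hm : 0 < m) : ∃ ω₀ C a c K : ℝ, 1 ≤ ω₀ ∧ 0 < C ∧ 0 < a ∧ 0 < c ∧
    ∀ ω Q, ω₀ ≤ ω → IsMinimizer3 ω m Q → sigmaYSq Q < √ω ∧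
      √(sigmaYSq Q) ≤ C / ω ∧ l2Norm (P1 Q) ≤ C / ω ∧ mass (weakDeriv eZ (P1 Q)) ≤ C / ω ∧
      c ≤ multiplier ω m Q ∧ multiplier ω m Q ≤ K ∧
      ∃ W p R : ℝ → ℝ, par Q =ᵐ[volume] W ∧ weakDeriv 1 (par Q) =ᵐ[volume] p ∧
        IsApproxSoliton (multiplier ω m Q) (C / ω) W p R ∧ a ≤ W 0 ∧ W 0 ≤ K := by
  obtain ⟨ω₁, C₁, hω₁, hC₁, H₁⟩ := exists_P1_bounds hm
  set e := 4 * Real.pi * (m / (8 * Real.pi)) ^ 3 / 3 with he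
  have he0 : 0 < e := by positivity
  set D := m * √m * √C₁ with hD
  -- The threshold makes the quartic contribution of the orthogonal part at most 2e, half of the
  -- lower bound 4e for ∫Q⁴; the rest forces W(0)² ≥ e/m. The upper bounds come from μ ≤ ∫Q⁴/m and
  -- the one-dimensional sup estimate.
  refine ⟨max ω₁ (8 * C₁ / (2 * e)), C₁ + 3 / 2 * C₁ * (√C₁ + √D), √(e / m), 2 * e / m,
    max (C₁ / m) (√(2 * (√m * √C₁))), hω₁.trans (le_max_left _ _), by positivity, by positivity,
    by positivity, fun ω Q hω h => ?_⟩
  have hω1 : ω₁ ≤ ω := (le_max_left _ _).trans hω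
  have hω2 : 8 * C₁ / (2 * e) ≤ ω := (le_max_right _ _).trans hω
  have hω0 : 0 < ω := by linarith
  obtain ⟨b1, b2, b3, b4, b5, b6, b7⟩ := H₁ ω Q hω1 h
  obtain ⟨m1, m2, m3⟩ := h.multiplier_bounds hm hω0.le
  have hQ := h.memSigma
  have hw := memH1_par hQ.1
  have hg4 : ∫ x, tensorPhi0 (par Q) x ^ 4 ≤ D := by
    rw [integral_tensorPhi0_pow_four, hD]
    refine (integral_par_pow_four_le hQ).trans ?_
    rw [h.mass_eq]
    gcongr
  have hCle : ∀ {x : ℝ}, x ≤ C₁ / ω → x ≤ (C₁ + 3 / 2 * C₁ * (√C₁ + √D)) / ω := fun hx => by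
    refine hx.trans ?_
    gcongr
    have : 0 ≤ 3 / 2 * C₁ * (√C₁ + √D) := by positivity
    linarith
  refine ⟨b1, hCle b5, hCle b6, hCle b7, m1, (m2.trans ?_).trans (le_max_left _ _), ?_⟩
  · gcongr
  obtain ⟨W, p, R, hW, hp, hs⟩ := h.exists_isApproxSoliton hm b1
    (ε := (C₁ + 3 / 2 * C₁ * (√C₁ + √D)) / ω) (by
      calc 3 / 2 * l2Norm (P1 Q) * (√(∫ x, Q x ^ 4) + √(∫ x, tensorPhi0 (par Q) x ^ 4))
          ≤ 3 / 2 * (C₁ / ω) * (√C₁ + √D) := by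
            have := l2Norm_nonneg (P1 Q)
            gcongr
        _ = (3 / 2 * C₁ * (√C₁ + √D)) / ω := by ring
        _ ≤ _ := by gcongr; linarith)
  refine ⟨W, p, R, hW, hp, hs, ?_, ?_⟩
  · have hWm : mass W ≤ m := by
      rw [← mass_congr_ae hW, ← h.mass_eq]
      exact mass_par_le hQ.memLp
    have h4 : ∫ z, par Q z ^ 4 ≤ W 0 ^ 2 * m := by
      have e1 : ∫ z, par Q z ^ 4 ≤ W 0 ^ 2 * mass W := by
        rw [mass_eq_integral_sq, ← integral_const_mul]
        refine integral_mono_ae (integrable_pow_four hw.memLp_four) (hs.memLp.integrable_sq.const_mul _) ?_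
        filter_upwards [hW] with z hz
        rw [hz]
        have := pow_le_pow_left₀ (hs.nonneg z) (hs.le_zero z) 2
        nlinarith [sq_nonneg (W z)]
      exact e1.trans (by gcongr)
    have h5 := integral_pow_four_le_split hQ
    have h6 : 8 * (C₁ / ω) ≤ 2 * e := by
      rw [div_le_iff₀ (by positivity)] at hω2
      rw [← mul_div_assoc, div_le_iff₀ hω0]
      linarith
    have h7 : 2 * e ≤ 8 * ((∫ z, par Q z ^ 4) / (2 * Real.pi)) := by linarith
    have h8 : e ≤ W 0 ^ 2 * m := by
      have h9 : (∫ z, par Q z ^ 4) / (2 * Real.pi) * (2 * Real.pi) = ∫ z, par Q z ^ 4 :=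
        div_mul_cancel₀ _ (by positivity)
      nlinarith [Real.pi_gt_three]
    refine Real.sqrt_le_iff.2 ⟨hs.nonneg 0, ?_⟩
    rw [div_le_iff₀ hm]
    exact h8
  · refine le_trans ?_ (le_max_right _ _)
    refine Real.le_sqrt_of_sq_le ?_
    have h1 := sq_le_of_primitive hs.memLp hs.memLp_deriv hs.primitive_self 0
    rw [← l2Norm_congr_ae hW, ← l2Norm_congr_ae hp] at h1
    refine h1.trans ?_
    have h2 : l2Norm (par Q) ≤ √m := by
      refine Real.sqrt_le_sqrt ?_
      rw [← h.mass_eq]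
      exact mass_par_le hQ.memLp
    have h3 : l2Norm (weakDeriv 1 (par Q)) ≤ √C₁ :=
      Real.sqrt_le_sqrt (hQ.mass_weakDeriv_par_le.trans b2)
    have := l2Norm_nonneg (weakDeriv 1 (par Q))
    gcongr

end Reduction

/-! ### Lagrange multipliers and identification of the ground state -/

section Multipliers

theorem exists_isTest_integral_mul_ne_zero {E : Type*} [NormedAddCommGroup E] [NormedSpace ℝ E]
    [MeasureSpace E] [BorelSpace E] [FiniteDimensional ℝ E] {u : E → ℝ}
    (hu : LocallyIntegrable u volume) (h0 : ¬ u =ᵐ[volume] 0) :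
    ∃ φ, IsTest φ ∧ ∫ x, u x * φ x ≠ 0 := by
  by_contra hcon
  push Not at hcon
  refine h0 (ae_eq_zero_of_integral_contDiff_smul_eq_zero hu fun φ hφ hc => ?_)
  rw [← hcon φ ⟨hφ, hc⟩]
  congr 1
  ext x
  rw [smul_eq_mul, mul_comm]

theorem not_ae_eq_zero_of_mass_pos {E : Type*} [MeasureSpace E] {u : E → ℝ} (h : 0 < mass u) :
    ¬ u =ᵐ[volume] 0 := fun h0 => by
  rw [mass_congr_ae h0] at h
  simp [mass] at h

variable {ω m : ℝ}

theorem eulerLagrange3_integral_eq {Q φ : X → ℝ} (hQ : MemSigma Q) (hφ : IsTest φ) :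
    ω * (∫ x : X, ((∑ i : Fin 2, weakDeriv (eY i) Q x * fderiv ℝ φ x (eY i))
        + ‖x.1‖ ^ 2 * Q x * φ x - 2 * Q x * φ x)) + (∫ x : X, weakDeriv eZ Q x * fderiv ℝ φ x eZ)
      = (ω * ∑ i, ∫ x, ann i Q x * ann i φ x) + ∫ x, weakDeriv eZ Q x * weakDeriv eZ φ x := by
  rw [← hQ.integral_formY hφ.memSigma]
  have e1 : ∀ v : X, weakDeriv v φ =ᵐ[volume] fun x => fderiv ℝ φ x v :=
    fun v => (hφ.hasWeakDeriv v).weakDeriv_ae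
  congr 1
  · congr 1
    refine integral_congr_ae ?_
    filter_upwards [e1 (eY 0), e1 (eY 1)] with x h0 h1
    simp only [Fin.sum_univ_two, h0, h1]
  · refine integral_congr_ae ?_
    filter_upwards [e1 eZ] with x h0
    rw [h0]

theorem IsMinimizer3.eulerLagrange {Q : X → ℝ} (h : IsMinimizer3 ω m Q) (hm : 0 < m)
    (hlt : sigmaYSq Q < √ω) : EulerLagrange3 ω (multiplier ω m Q) Q :=
  ⟨h.memSigma, fun φ hφ => by
    rw [eulerLagrange3_integral_eq h.memSigma hφ]
    exact h.stationary hm hlt hφ.memSigma⟩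

/-- A nonzero Q has nonzero pairing with some test function, so the equation determines its
multiplier. -/
theorem EulerLagrange3.unique {Q : X → ℝ} {μ μ' : ℝ} (h : EulerLagrange3 ω μ Q)
    (h' : EulerLagrange3 ω μ' Q) (h0 : 0 < mass Q) : μ = μ' := by
  obtain ⟨φ, hφ, hne⟩ := exists_isTest_integral_mul_ne_zero (h.1.memLp.locallyIntegrable (by norm_num))
    (not_ae_eq_zero_of_mass_pos h0)
  have := (h.2 φ hφ).symm.trans (h'.2 φ hφ)
  exact neg_injective (mul_right_cancel₀ hne this)

theorem EulerLagrange1.unique {Q : ℝ → ℝ} {μ μ' : ℝ} (h : EulerLagrange1 μ Q)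
    (h' : EulerLagrange1 μ' Q) (h0 : 0 < mass Q) : μ = μ' := by
  obtain ⟨φ, hφ, hne⟩ := exists_isTest_integral_mul_ne_zero (h.1.1.locallyIntegrable (by norm_num))
    (not_ae_eq_zero_of_mass_pos h0)
  have := (h.2 φ hφ).symm.trans (h'.2 φ hφ)
  exact neg_injective (mul_right_cancel₀ hne this)

/-- The Lagrange multiplier of the one-dimensional ground state. -/
def multiplier1 (m : ℝ) (Q : ℝ → ℝ) : ℝ :=
  (1 / (2 * Real.pi) * (∫ x, Q x ^ 4) - mass (weakDeriv 1 Q)) / m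

theorem IsGroundState1.eulerLagrange {Q : ℝ → ℝ} (h : IsGroundState1 m Q) (hm : 0 < m) :
    EulerLagrange1 (multiplier1 m Q) Q :=
  ⟨h.memH1, fun φ hφ => by
    have := h.stationary hm hφ.memH1_real
    have e : ∫ z, weakDeriv 1 Q z * deriv φ z = ∫ z, weakDeriv 1 Q z * weakDeriv 1 φ z := by
      refine integral_congr_ae ?_
      filter_upwards [hφ.weakDeriv_ae] with z hz
      rw [hz, fderiv_apply_one_eq_deriv]
    rw [e]
    exact this⟩

/-- The multiplier times m equals -2E + (1/4π)∫Q⁴, and E is negative by comparison with the soliton.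
-/
theorem IsGroundState1.multiplier1_pos {Q : ℝ → ℝ} (h : IsGroundState1 m Q) (hm : 0 < m) :
    0 < multiplier1 m Q := by
  have hb : 0 < m / (8 * Real.pi) := by positivity
  have hE := h.energy_le (memH1_soliton hb) (by rw [mass_soliton hb]; field_simp)
  rw [energy1_eq, energy1_eq, half_mass_solitonDeriv_sub hb] at hE
  have he : 0 < 4 * Real.pi * (m / (8 * Real.pi)) ^ 3 / 3 := by positivity
  have hP : 0 ≤ 1 / (8 * Real.pi) * ∫ x, Q x ^ 4 :=
    mul_nonneg (by positivity) (integral_nonneg fun x => by positivity)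
  have e : 1 / (2 * Real.pi) = 4 * (1 / (8 * Real.pi)) := by field_simp; norm_num
  unfold multiplier1
  refine div_pos ?_ hm
  rw [e]
  linarith

theorem EulerLagrange1.hasWeakDeriv {Q : ℝ → ℝ} {μ : ℝ} (h : EulerLagrange1 μ Q) :
    HasWeakDeriv (weakDeriv 1 Q) 1 (fun z => μ * Q z - Q z ^ 3 / (2 * Real.pi)) := by
  have hQ := h.1
  have hi3 := integrable_cube hQ.1 (integrable_pow_four hQ.memLp_four)
  have hQl : LocallyIntegrable Q volume := hQ.1.locallyIntegrable (by norm_num)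
  refine ⟨(hQ.memLp_weakDeriv 1).locallyIntegrable (by norm_num),
    (hQl.smul μ).sub (hi3.div_const _).locallyIntegrable, fun φ hφ => ?_⟩
  have hel := h.2 φ hφ
  have i1 : Integrable (fun z => Q z * φ z) volume := integrable_mul_of_memLp hQ.1 (hφ.memLp 2)
  have i2 : Integrable (fun z => Q z ^ 3 * φ z) volume :=
    integrable_cube_mul hQ.memLp_four (hφ.memLp 4)
  have e3 : ∫ z, φ z • (μ * Q z - Q z ^ 3 / (2 * Real.pi))
      = μ * (∫ z, Q z * φ z) - 1 / (2 * Real.pi) * ∫ z, Q z ^ 3 * φ z := by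
    rw [← integral_const_mul, ← integral_const_mul, ← integral_sub (i1.const_mul _) (i2.const_mul _)]
    congr 1
    ext z
    simp only [smul_eq_mul]
    ring
  have e4 : ∫ z, (fderiv ℝ φ z 1) • weakDeriv 1 Q z = ∫ z, weakDeriv 1 Q z * deriv φ z := by
    congr 1
    ext z
    rw [smul_eq_mul, fderiv_apply_one_eq_deriv, mul_comm]
  rw [e3, e4]
  linarith

theorem ae_eq_of_mass_sub_eq_zero {E : Type*} [MeasureSpace E] {u v : E → ℝ} (hu : MemLp u 2 volume)
    (hv : MemLp v 2 volume) (h : mass (fun x => u x - v x) = 0) : u =ᵐ[volume] v := by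
  rw [mass_eq_integral_sq] at h
  have hz := (integral_eq_zero_iff_of_nonneg (fun x => sq_nonneg _) (hu.sub hv).integrable_sq).1 h
  filter_upwards [hz] with x hx
  simp only [Pi.zero_apply, Pi.sub_apply] at hx
  linarith [pow_eq_zero_iff (two_ne_zero) |>.1 hx]

/-- The ground state is the soliton of mass `m`. -/
theorem IsGroundState1.ae_eq_soliton {Q : ℝ → ℝ} (h : IsGroundState1 m Q) (hm : 0 < m) :
    Q =ᵐ[volume] soliton (m / (8 * Real.pi)) ∧ multiplier1 m Q = (m / (8 * Real.pi)) ^ 2 := by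
  have hμ := h.multiplier1_pos hm
  set μ := multiplier1 m Q with hμdef
  have hQ := h.memH1
  obtain ⟨W, p, hW, hp, hd, hprim⟩ := exists_classical hQ (h.eulerLagrange hm).hasWeakDeriv
  have hWc : Continuous W := continuous_iff_continuousAt.2 fun z => (hd z).continuousAt
  have hs : IsApproxSoliton μ 0 W p (fun _ => 0) :=
    { hasDerivAt := hd
      primitive := fun a b => by
        rw [hprim]
        refine intervalIntegral.integral_congr_ae ?_
        filter_upwards [hW] with z hz _
        rw [← hz, add_zero]
      integrable := integrable_zero _ _ _
      integral_abs_le := by simp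
      radial := radial_of_ae (G := Set.univ) (by simp) (fun z _ z' _ hz => h.symm_decreasing z z' hz) hW hWc
      nonneg := nonneg_of_ae (fun z => (h.pos z).le) hW hWc
      memLp := hQ.1.ae_eq hW
      memLp_deriv := (hQ.memLp_weakDeriv 1).ae_eq hp }
  have hWm : mass W = m := by rw [← mass_congr_ae hW, h.mass_eq]
  have hW0 : 0 < W 0 := by
    refine (hs.nonneg 0).lt_of_ne fun h0 => ?_
    have hz : W = 0 := by
      ext z
      exact le_antisymm ((hs.le_zero z).trans h0.ge) (hs.nonneg z)
    rw [hz] at hWm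
    simp [mass] at hWm
    exact hm.ne hWm
  have hb : 0 < √μ := Real.sqrt_pos.2 hμ
  have hsol : IsApproxSoliton μ 0 (soliton (√μ)) (solitonDeriv (√μ)) _ :=
    isApproxSoliton_soliton hb (by rw [Real.sq_sqrt hμ.le, sub_self]; simp)
  -- Here both functions are exact solutions, so stability is used with ε = 0 and forces equality.
  -- The parameters only have to bracket these two functions.
  obtain ⟨C, -, H⟩ := IsApproxSoliton.exists_stability (a := min (W 0) (soliton (√μ) 0)) (c := μ)
    (K := max μ (max (W 0) (soliton (√μ) 0))) (m := max m (mass (soliton (√μ))))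
    (lt_min hW0 (by rw [soliton_zero]; positivity)) hμ (lt_max_of_lt_left hm)
  have hz := H hs hsol le_rfl (le_max_left _ _) zero_le_one (min_le_left _ _) (min_le_right _ _)
    ((le_max_left _ _).trans (le_max_right _ _)) ((le_max_right _ _).trans (le_max_right _ _))
    (hWm.le.trans (le_max_left _ _)) (le_max_right _ _)
  have h1 := mass_nonneg (fun t => W t - soliton (√μ) t)
  have h2 := mass_nonneg (fun t => p t - solitonDeriv (√μ) t)
  have h3 : mass (fun t => W t - soliton (√μ) t) = 0 := by nlinarith
  have hae := ae_eq_of_mass_sub_eq_zero hs.memLp hsol.memLp h3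
  have hbm : √μ = m / (8 * Real.pi) := by
    have := mass_congr_ae hae
    rw [hWm, mass_soliton hb] at this
    rw [this]
    field_simp
  rw [← hbm]
  exact ⟨hW.trans hae, (Real.sq_sqrt hμ.le).symm⟩

end Multipliers

/-! ### Convergence of the profile and of the frequency -/

section Convergence

theorem IsApproxSoliton.mono {μ ε ε' : ℝ} {w p R : ℝ → ℝ} (h : IsApproxSoliton μ ε w p R)
    (hε : ε ≤ ε') : IsApproxSoliton μ ε' w p R :=
  { h with integral_abs_le := h.integral_abs_le.trans hε }

theorem abs_sub_le_of_abs_sqrt_sub_le {x y d B : ℝ} (hx : 0 ≤ x) (hy : 0 ≤ y) (h : |√x - √y| ≤ d)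
    (hB : √x + √y ≤ B) : |x - y| ≤ d * B := by
  have e : x - y = (√x - √y) * (√x + √y) := by
    nlinarith [Real.sq_sqrt hx, Real.sq_sqrt hy]
  have h0 : 0 ≤ √x + √y := by positivity
  rw [e, abs_mul, abs_of_nonneg h0]
  exact mul_le_mul h hB h0 ((abs_nonneg _).trans h)

-- Stability is used twice. Comparison with the soliton of frequency μ yields √μ close to b = m/8π
-- through the masses; the soliton of parameter b then has remainder O(1/ω) at frequency μ and can
-- be compared with the profile.
set_option maxHeartbeats 800000 in
theorem exists_soliton_close {m : ℝ} (hm : 0 < m) : ∃ ω₀ C : ℝ, 1 ≤ ω₀ ∧ 0 < C ∧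
    ∀ ω Q, ω₀ ≤ ω → IsMinimizer3 ω m Q → sigmaYSq Q < √ω ∧
      √(sigmaYSq Q) ≤ C / ω ∧ l2Norm (P1 Q) ≤ C / ω ∧ mass (weakDeriv eZ (P1 Q)) ≤ C / ω ∧
      |multiplier ω m Q - (m / (8 * Real.pi)) ^ 2| ≤ C / ω ∧
      mass (fun z => par Q z - soliton (m / (8 * Real.pi)) z)
        + mass (fun z => weakDeriv 1 (par Q) z - solitonDeriv (m / (8 * Real.pi)) z) ≤ (C / ω) ^ 2 := by
  obtain ⟨ω₁, C₁, a, c, K, hω₁, hC₁, ha, hc, H₁⟩ := exists_profile hm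
  set b := m / (8 * Real.pi) with hb
  have hb0 : 0 < b := by positivity
  set J := ∫ z, soliton b z with hJ
  have hJ0 : 0 ≤ J := integral_nonneg fun z => soliton_nonneg hb0 z
  obtain ⟨C₂, hC₂, H₂⟩ := IsApproxSoliton.exists_stability
    (a := min a (min (2 * √Real.pi * √c) (2 * √Real.pi * b))) (c := c)
    (K := max K (max (2 * √Real.pi * √K) (2 * √Real.pi * b))) (m := max m (8 * Real.pi * √K))
    (by positivity) hc (lt_max_of_lt_left hm)
  set C₃ := (√C₂ + 1) * (√m + √(8 * Real.pi * √K)) / (8 * Real.pi) * (b + √K) with hC₃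
  have hC₃0 : 0 ≤ C₃ := by positivity
  set N := C₃ * J + 1 with hN
  have hN1 : 1 ≤ N := by
    rw [hN]
    have : 0 ≤ C₃ * J := by positivity
    linarith
  refine ⟨max ω₁ (N * C₁), C₁ + C₃ * C₁ + √C₂ * (N * C₁), hω₁.trans (le_max_left _ _), by positivity,
    fun ω Q hω h => ?_⟩
  have hω1 : ω₁ ≤ ω := (le_max_left _ _).trans hω
  have hω2 : N * C₁ ≤ ω := (le_max_right _ _).trans hω
  have hω0 : 0 < ω := by linarith
  obtain ⟨p1, p2, p3, p4, p5, p6, W, p, R, hW, hp, hs, hWa, hWK⟩ := H₁ ω Q hω1 h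
  set μ := multiplier ω m Q with hμ
  set ε := C₁ / ω with hε
  have hε0 : 0 < ε := by positivity
  have hNε : N * ε ≤ 1 := by
    rw [hε, ← mul_div_assoc, div_le_one hω0]
    exact hω2
  have hε1 : ε ≤ 1 := (le_mul_of_one_le_left hε0.le hN1).trans hNε
  have hμ0 : 0 < μ := hc.trans_le p5
  have hbμ : 0 < √μ := Real.sqrt_pos.2 hμ0
  have hbK : √μ ≤ √K := Real.sqrt_le_sqrt p6
  have hbc : √c ≤ √μ := Real.sqrt_le_sqrt p5
  have hQ := h.memSigma
  have hWm : mass W ≤ m := by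
    rw [← mass_congr_ae hW, ← h.mass_eq]
    exact mass_par_le hQ.memLp
  have hs1 : IsApproxSoliton μ ε (soliton (√μ)) (solitonDeriv (√μ)) _ :=
    isApproxSoliton_soliton hbμ (by rw [Real.sq_sqrt hμ0.le, sub_self]; simpa using hε0.le)
  have st1 := H₂ hs hs1 p5 (p6.trans (le_max_left _ _)) hε1 ((min_le_left _ _).trans hWa)
    (by
      rw [soliton_zero]
      refine ((min_le_right _ _).trans (min_le_left _ _)).trans ?_
      gcongr)
    (hWK.trans (le_max_left _ _))
    (by
      rw [soliton_zero]
      refine le_trans ?_ ((le_max_left _ _).trans (le_max_right _ _))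
      gcongr)
    (hWm.trans (le_max_left _ _))
    (by
      rw [mass_soliton hbμ]
      refine le_trans ?_ (le_max_right _ _)
      gcongr)
  have hsqrt : ∀ {x t : ℝ}, 0 ≤ t → x ≤ C₂ * t ^ 2 → √x ≤ √C₂ * t := fun ht hx => by
    refine (Real.sqrt_le_sqrt hx).trans (le_of_eq ?_)
    rw [Real.sqrt_mul hC₂, Real.sqrt_sq ht]
  have d1 : l2Norm (fun t => W t - soliton (√μ) t) ≤ √C₂ * ε :=
    hsqrt hε0.le (by linarith [mass_nonneg (fun t => p t - solitonDeriv (√μ) t)])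
  have d2 : |√(mass W) - √(8 * Real.pi * √μ)| ≤ √C₂ * ε := by
    rw [← mass_soliton hbμ]
    exact (abs_l2Norm_sub_le hs.memLp hs1.memLp).trans d1
  have hmsplit : mass W + mass (P1 Q) = m := by
    rw [← mass_congr_ae hW, ← h.mass_eq]
    exact mass_par_add_mass_P1 hQ.memLp
  -- Mass lost to the orthogonal part: √m ≤ ‖W‖ + ‖f‖ and ‖f‖ ≤ ε.
  have d3 : |√m - √(mass W)| ≤ ε := by
    have e1 : √m ≤ √(mass W) + √(mass (P1 Q)) := by
      rw [← hmsplit]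
      refine Real.sqrt_le_iff.2 ⟨by positivity, ?_⟩
      nlinarith [Real.sq_sqrt (mass_nonneg W), Real.sq_sqrt (mass_nonneg (P1 Q)),
        mul_nonneg (Real.sqrt_nonneg (mass W)) (Real.sqrt_nonneg (mass (P1 Q)))]
    have e2 := Real.sqrt_le_sqrt hWm
    have e3 : √(mass (P1 Q)) ≤ ε := p3
    rw [abs_le]
    constructor <;> linarith
  have d4 : |√m - √(8 * Real.pi * √μ)| ≤ (√C₂ + 1) * ε := by
    have := abs_sub_le (√m) (√(mass W)) (√(8 * Real.pi * √μ))
    linarith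
  have d5 : |m - 8 * Real.pi * √μ| ≤ (√C₂ + 1) * ε * (√m + √(8 * Real.pi * √K)) := by
    refine abs_sub_le_of_abs_sqrt_sub_le hm.le (by positivity) d4 ?_
    gcongr
  have d6 : |b - √μ| ≤ (√C₂ + 1) * ε * (√m + √(8 * Real.pi * √K)) / (8 * Real.pi) := by
    rw [le_div_iff₀ (by positivity), ← abs_of_pos (by positivity : 0 < 8 * Real.pi), ← abs_mul,
      abs_of_pos (by positivity : 0 < 8 * Real.pi)]
    refine le_trans (le_of_eq ?_) d5
    congr 1
    rw [hb]
    field_simp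
  have d7 : |b ^ 2 - μ| ≤ C₃ * ε := by
    have e : b ^ 2 - μ = (b - √μ) * (b + √μ) := by
      nlinarith [Real.sq_sqrt hμ0.le]
    rw [e, abs_mul, abs_of_pos (by positivity : 0 < b + √μ)]
    calc |b - √μ| * (b + √μ)
        ≤ ((√C₂ + 1) * ε * (√m + √(8 * Real.pi * √K)) / (8 * Real.pi)) * (b + √K) := by gcongr
      _ = C₃ * ε := by rw [hC₃]; ring
  -- The factor N = C₃J + 1 covers both the frequency mismatch, with J the L¹ norm of the soliton,
  -- and the original error ε, so that both solutions share one error bound.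
  have hs2 : IsApproxSoliton μ (N * ε) (soliton b) (solitonDeriv b) _ :=
    isApproxSoliton_soliton hb0 (by
      have : |b ^ 2 - μ| * J ≤ C₃ * ε * J := by gcongr
      have e : N * ε = C₃ * ε * J + ε := by rw [hN]; ring
      linarith)
  have st2 := H₂ (hs.mono (le_mul_of_one_le_left hε0.le hN1)) hs2 p5 (p6.trans (le_max_left _ _)) hNε
    ((min_le_left _ _).trans hWa)
    (by
      rw [soliton_zero]
      exact (min_le_right _ _).trans (min_le_right _ _))
    (hWK.trans (le_max_left _ _))
    (by
      rw [soliton_zero]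
      exact (le_max_right _ _).trans (le_max_right _ _))
    (hWm.trans (le_max_left _ _))
    (by
      rw [mass_soliton hb0]
      refine le_trans (le_of_eq ?_) (le_max_left _ _)
      rw [hb]
      field_simp)
  have t1 : 0 ≤ C₃ * C₁ := by positivity
  have t2 : 0 ≤ √C₂ * (N * C₁) := by positivity
  have hle : ∀ {x y : ℝ}, x ≤ y / ω → y ≤ C₁ + C₃ * C₁ + √C₂ * (N * C₁) →
      x ≤ (C₁ + C₃ * C₁ + √C₂ * (N * C₁)) / ω := fun hx hy => hx.trans (by gcongr)
  refine ⟨p1, hle p2 (by linarith), hle p3 (by linarith), hle p4 (by linarith), ?_, ?_⟩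
  · rw [abs_sub_comm]
    refine hle (y := C₃ * C₁) (d7.trans (le_of_eq ?_)) (by linarith)
    rw [hε, mul_div_assoc]
  · have e1 : mass (fun z => par Q z - soliton b z) = mass (fun t => W t - soliton b t) :=
      mass_congr_ae (by filter_upwards [hW] with z hz; rw [hz])
    have e2 : mass (fun z => weakDeriv 1 (par Q) z - solitonDeriv b z)
        = mass (fun t => p t - solitonDeriv b t) :=
      mass_congr_ae (by filter_upwards [hp] with z hz; rw [hz])
    rw [e1, e2]
    refine st2.trans ?_
    have e3 : C₂ * (N * ε) ^ 2 = (√C₂ * (N * C₁) / ω) ^ 2 := by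
      rw [hε, div_pow, mul_pow √C₂, Real.sq_sqrt hC₂]
      ring
    rw [e3]
    gcongr
    linarith

end Convergence

/-! ### The Σ and H¹ norms in terms of mass, σ and ∂_z -/

section Norms

/-- The transverse gradient and weight together equal σ + 2‖u‖², which with the L² term makes the
coefficient 3. -/
theorem sigmaNorm_eq {u : X → ℝ} (hu : MemSigma u) :
    sigmaNorm u = √(3 * mass u + sigmaYSq u + mass (weakDeriv eZ u)) := by
  have i0 := integrable_sq_of_memLp hu.memLp
  have iy := fun i => integrable_sq_of_memLp (hu.1.memLp_weakDeriv (eY i))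
  have iz := integrable_sq_of_memLp (hu.1.memLp_weakDeriv eZ)
  have iw := integrable_sq_of_memLp hu.memLp_weight
  have hs := hu.sum_mass_eq
  rw [sigmaNorm]
  congr 1
  have e : ∫ x : X, (‖u x‖ ^ 2 + (gradYSq u x + ‖weakDeriv eZ u x‖ ^ 2) + ‖x.1‖ ^ 2 * ‖u x‖ ^ 2)
      = mass u + ((∑ i, mass (weakDeriv (eY i) u)) + mass (weakDeriv eZ u))
        + mass (fun x : X => ‖x.1‖ * u x) := by
    simp only [gradYSq, Real.norm_eq_abs, sq_abs, Fin.sum_univ_two, mass_eq_integral_sq, mul_pow] at *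
    have j1 : Integrable (fun x => weakDeriv (eY 0) u x ^ 2 + weakDeriv (eY 1) u x ^ 2) volume :=
      (iy 0).add (iy 1)
    have j2 : Integrable (fun x => weakDeriv (eY 0) u x ^ 2 + weakDeriv (eY 1) u x ^ 2
      + weakDeriv eZ u x ^ 2) volume := j1.add iz
    have j3 : Integrable (fun x => u x ^ 2 + (weakDeriv (eY 0) u x ^ 2 + weakDeriv (eY 1) u x ^ 2
      + weakDeriv eZ u x ^ 2)) volume := i0.add j2
    rw [integral_add j3 iw, integral_add i0 j2, integral_add j1 iz, integral_add (iy 0) (iy 1)]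
  rw [e]
  linarith

theorem h1NormX_le {u : X → ℝ} (hu : MemSigma u) :
    h1NormX u ≤ √(3 * mass u + sigmaYSq u + mass (weakDeriv eZ u)) := by
  have i0 := integrable_sq_of_memLp hu.memLp
  have iy := fun i => integrable_sq_of_memLp (hu.1.memLp_weakDeriv (eY i))
  have iz := integrable_sq_of_memLp (hu.1.memLp_weakDeriv eZ)
  have iw := integrable_sq_of_memLp hu.memLp_weight
  rw [← sigmaNorm_eq hu]
  simp only [h1NormX, sigmaNorm, gradYSq, Real.norm_eq_abs, sq_abs, Fin.sum_univ_two, mul_pow] at *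
  refine Real.sqrt_le_sqrt (integral_mono (i0.add (((iy 0).add (iy 1)).add iz))
    ((i0.add (((iy 0).add (iy 1)).add iz)).add iw) fun x => ?_)
  simp only
  have : 0 ≤ ‖x.1‖ ^ 2 * u x ^ 2 := by positivity
  linarith

theorem MemSigma.sigmaYSq_add_le {u v : X → ℝ} (hu : MemSigma u) (hv : MemSigma v) :
    sigmaYSq (fun x => u x + v x) ≤ 2 * sigmaYSq u + 2 * sigmaYSq v := by
  rw [(hu.add hv).sigmaYSq_eq, hu.sigmaYSq_eq, hv.sigmaYSq_eq, Finset.mul_sum, Finset.mul_sum,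
    ← Finset.sum_add_distrib]
  refine Finset.sum_le_sum fun i _ => ?_
  refine le_trans (le_of_eq (mass_congr_ae ?_)) (mass_add_le (hu.memLp_ann i) (hv.memLp_ann i))
  filter_upwards [hu.1.weakDeriv_add hv.1 (eY i)] with x hx
  simp only [ann, hx]
  ring

theorem MemH1.mass_weakDeriv_add_le {E : Type*} [NormedAddCommGroup E] [NormedSpace ℝ E] [MeasureSpace E]
    [BorelSpace E] [FiniteDimensional ℝ E] {u v : E → ℝ} (hu : MemH1 u) (hv : MemH1 v) (e : E) :
    mass (weakDeriv e (fun x => u x + v x)) ≤ 2 * mass (weakDeriv e u) + 2 * mass (weakDeriv e v) := by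
  rw [mass_congr_ae (hu.weakDeriv_add hv e)]
  exact mass_add_le (hu.memLp_weakDeriv e) (hv.memLp_weakDeriv e)

end Norms

end DimRed

end

/-! ### Assembly of the four estimates -/

theorem theorem1p2 (m : ℝ) (hm : 0 < m) :
    ∃ ω₀ : ℝ, 1 ≤ ω₀ ∧ ∃ C : ℝ, 0 < C ∧
      ∀ ω : ℝ, ω₀ ≤ ω →
      ∀ Qinf : ℝ → ℝ, DimRed.IsGroundState1 m Qinf →
      ∀ Q : DimRed.X → ℝ, DimRed.IsMinimizer3 ω m Q →
        -- convergence in the weighted energy space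
        (DimRed.MemSigma (fun x => Q x - DimRed.tensorPhi0 Qinf x) ∧
          DimRed.sigmaNorm (fun x => Q x - DimRed.tensorPhi0 Qinf x) ≤ C / Real.sqrt ω) ∧
        -- the Lagrange multipliers exist and converge
        ((∃ μ : ℝ, DimRed.EulerLagrange3 ω μ Q) ∧
          (∃ μinf : ℝ, DimRed.EulerLagrange1 μinf Qinf) ∧
          ∀ μ μinf : ℝ, DimRed.EulerLagrange3 ω μ Q → DimRed.EulerLagrange1 μinf Qinf →
            |μ - μinf| ≤ C / ω) ∧
        -- the part orthogonal to the lowest Hermite state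
        (DimRed.MemSigma (DimRed.P1 Q) ∧
          DimRed.l2Norm (DimRed.P1 Q) ≤ C / ω ∧
          DimRed.sigmaYNorm (DimRed.P1 Q) ≤ C / ω ∧
          DimRed.l2Norm (DimRed.weakDeriv DimRed.eZ (DimRed.P1 Q)) ≤ C / Real.sqrt ω) ∧
        -- the component along the lowest Hermite state
        (DimRed.MemH1 (fun z => DimRed.par Q z - Qinf z) ∧
          DimRed.h1NormZ (fun z => DimRed.par Q z - Qinf z) ≤ C / ω ∧
          DimRed.MemH1 (DimRed.tensorPhi0 (fun z => DimRed.par Q z - Qinf z)) ∧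
          DimRed.h1NormX (DimRed.tensorPhi0 (fun z => DimRed.par Q z - Qinf z)) ≤ C / ω) := by
  open DimRed in
  obtain ⟨ω₀, C, hω₀, hC, H⟩ := exists_soliton_close hm
  -- The three summands serve the O(1/ω) bounds, the H¹(ℝ³) bound, and the ω^{-1/2} bounds
  -- respectively.
  set C' := C + 2 * C + √(8 * C + 24 * C ^ 2) with hC'
  have hC'0 : 0 ≤ √(8 * C + 24 * C ^ 2) := Real.sqrt_nonneg _
  refine ⟨ω₀, hω₀, C', by positivity, fun ω hω Qinf hinf Q hQ => ?_⟩
  have hω1 : 1 ≤ ω := hω₀.trans hω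
  have hω0 : 0 < ω := by linarith
  obtain ⟨h1, h2, h3, h4, h5, h6⟩ := H ω Q hω hQ
  obtain ⟨hsol, hmult⟩ := hinf.ae_eq_soliton hm
  have hQS := hQ.memSigma
  have hw := memH1_par hQS.1
  have hb : 0 < m / (8 * Real.pi) := by positivity
  have hle : ∀ {x y : ℝ}, x ≤ y / ω → y ≤ C' → x ≤ C' / ω := fun hx hy => hx.trans (by gcongr)
  have hv : MemH1 (fun z => par Q z - Qinf z) := hw.sub hinf.memH1
  have hvt := memSigma_tensorPhi0 hv
  have hvd : weakDeriv 1 (fun z => par Q z - Qinf z)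
      =ᵐ[volume] fun z => weakDeriv 1 (par Q) z - solitonDeriv (m / (8 * Real.pi)) z := by
    have e := ((hasWeakDeriv_soliton (m / (8 * Real.pi))).congr_ae hsol.symm .rfl).weakDeriv_ae
    filter_upwards [hw.weakDeriv_sub hinf.memH1 1, e] with z hz1 hz2
    rw [hz1, hz2]
  have hmv : mass (fun z => par Q z - Qinf z) + mass (weakDeriv 1 (fun z => par Q z - Qinf z))
      ≤ (C / ω) ^ 2 := by
    rw [mass_congr_ae hvd]
    refine le_trans (le_of_eq ?_) h6
    congr 1
    refine mass_congr_ae ?_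
    filter_upwards [hsol] with z hz
    rw [hz]
  have hmt : mass (tensorPhi0 (fun z => par Q z - Qinf z)) = mass (fun z => par Q z - Qinf z) :=
    mass_tensorPhi0 _
  have hmtd : mass (weakDeriv eZ (tensorPhi0 (fun z => par Q z - Qinf z)))
      = mass (weakDeriv 1 (fun z => par Q z - Qinf z)) := by
    rw [mass_congr_ae (weakDeriv_tensorPhi0_eZ hv), mass_tensorPhi0]
  have hst := sigmaYSq_tensorPhi0 hv
  have n1 := mass_nonneg (fun z => par Q z - Qinf z)
  have n2 := mass_nonneg (weakDeriv 1 (fun z => par Q z - Qinf z))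
  have hCω : 0 ≤ C / ω := by positivity
  have hσ0 := sigmaYSq_nonneg hQS
  have hm1 : mass (P1 Q) ≤ (C / ω) ^ 2 := by
    rw [← l2Norm_sq]
    exact pow_le_pow_left₀ (l2Norm_nonneg _) h3 2
  have hs1 : sigmaYSq Q ≤ (C / ω) ^ 2 := by
    rw [← Real.sq_sqrt hσ0]
    exact pow_le_pow_left₀ (Real.sqrt_nonneg _) h2 2
  have hsq : (C / ω) ^ 2 ≤ C ^ 2 / ω := by
    rw [div_pow]
    gcongr
    nlinarith
  -- The error splits into the orthogonal part and the Φ₀-part; all contributions to its squared Σ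
  -- norm are bounded by multiples of 1/ω², except ‖∂_z f‖², for which only O(1/ω) is available.
  have hu : (fun x => Q x - tensorPhi0 Qinf x)
      = fun x => P1 Q x + tensorPhi0 (fun z => par Q z - Qinf z) x := by
    ext x
    simp only [P1, tensorPhi0]
    ring
  refine ⟨⟨?_, ?_⟩, ⟨⟨_, hQ.eulerLagrange hm h1⟩, ⟨_, hinf.eulerLagrange hm⟩, fun μ μinf hμ hμinf => ?_⟩,
    ⟨hQS.P1, hle h3 (by linarith), ?_, ?_⟩, ⟨hv, ?_, hvt.1, ?_⟩⟩
  · exact hQS.sub (memSigma_tensorPhi0 hinf.memH1)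
  · rw [hu, sigmaNorm_eq (hQS.P1.add hvt)]
    have a1 := mass_add_le hQS.P1.memLp hvt.memLp
    have a2 := hQS.P1.sigmaYSq_add_le hvt
    have a3 := hQS.P1.1.mass_weakDeriv_add_le hvt.1 eZ
    rw [hQS.sigmaYSq_P1, hst] at a2
    rw [hmtd] at a3
    rw [hmt] at a1
    have hfin : √(8 * C + 24 * C ^ 2) / √ω ≤ C' / √ω := by
      gcongr
      linarith
    refine le_trans ?_ hfin
    rw [← Real.sqrt_div' _ hω0.le]
    refine Real.sqrt_le_sqrt ?_
    have e : (8 * C + 24 * C ^ 2) / ω = 8 * (C / ω) + 24 * (C ^ 2 / ω) := by ring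
    rw [e]
    linarith
  · rw [hμ.unique (hQ.eulerLagrange hm h1) (by rw [hQ.mass_eq]; exact hm),
      hμinf.unique (hinf.eulerLagrange hm) (by rw [hinf.mass_eq]; exact hm), hmult]
    exact hle h5 (by linarith)
  · rw [sigmaYNorm, hQS.sigmaYSq_P1]
    exact hle h2 (by linarith)
  · have hfin : √(8 * C + 24 * C ^ 2) / √ω ≤ C' / √ω := by
      gcongr
      linarith
    refine le_trans ?_ hfin
    rw [← Real.sqrt_div' _ hω0.le]
    refine Real.sqrt_le_sqrt (h4.trans ?_)
    gcongr
    nlinarith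
  · rw [h1NormZ]
    refine hle (y := C) ?_ (by linarith)
    exact (Real.sqrt_le_sqrt hmv).trans (Real.sqrt_sq hCω).le
  · refine (h1NormX_le hvt).trans (hle (y := 2 * C) ?_ (by linarith))
    rw [hmt, hst, hmtd, mul_div_assoc, ← Real.sqrt_sq (by positivity : 0 ≤ 2 * (C / ω))]
    refine Real.sqrt_le_sqrt ?_
    nlinarith
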